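/- Let $n\ge 2$, let $\mathcal O=\mathcal O_{\mathbb C^n,0}$, and let $D$ be a germ of (reduced) divisor in $(\mathbb C^n,0)$ with reduced equation $f\in\mathcal O$. Say that $D$ is \emph{strongly Euler-homogeneous at} $p$ if some reduced local equation $g$ of $D$ at $p$ satisfies $\delta(g)=g$ for a germ at $p$ of holomorphic vector field $\delta$ vanishing at $p$; it is so \emph{on} a germ of subset $E\subset D$ if it is so at every point of $E$ (close to $0$), and it is strongly Euler-homogeneous if this holds on $E=D$. Put $\mathcal J_f=(\partial_1 f,\dots,\partial_n f,f)\subset\mathcal O$ and, for $i\in\mathbb Z$, $$I_i=\operatorname{Fitt}_{n-i}(\mathcal J_f/(f)),\quad \tilde I_i=\operatorname{Fitt}_{n+1-i}(\mathcal J_f),\quad D_i=V(I_{i+1}),\quad \tilde D_i=V(\tilde I_{i+1}),$$ where $\operatorname{Fitt}_j(M)$ is the $j$-th Fitting ideal (zero for $j<0$) and $V(I)$ is the germ at $0$ of the zero set of $I$. All equalities of sets below are equalities of germs at $0$. If $\delta_1,\dots,\delta_m$ generate the $\mathcal O$-module of vector fields $\delta$ with $\delta(f)\in(f)$, and $\delta_k(f)=\alpha_k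 f$, let $A=(\delta_k(x_j))_{k,j}$ be the Saito matrix and $\tilde A=(A\mid-\bar\alpha)$, where $\bar\alpha=(\alpha_1,\dots,\alpha_m)^t$, the extended Saito matrix. Then $D_i=\{p:\operatorname{rank}A(p)\le i\}$ and $\tilde D_i=\{p:\operatorname{rank}\tilde A(p)\le i\}$ for all $i$. Moreover: The singular locus decomposes as $\operatorname{Sing}D=D_E\sqcup D_{NE}$, where $$D_E=\bigsqcup_{i=0}^{n-2}(D_i\setminus\tilde D_i),\qquad D_{NE}=\bigsqcup_{i=0}^{n-2}(\tilde D_i\setminus D_{i-1})$$ (all unions being disjoint) are respectively the set of singular points at which $D$ is strongly Euler-homogeneous and the set of singular points at which it is not. Also $\tilde D_0=D_0\cap D_{NE}$, and: 1. The following are equivalent: $D$ is strongly Euler-homogeneous on $D_0$; $\tilde D_0=\varnothing$; $\tilde I_1=\mathcal O$; $\sqrt{\operatorname{Fitt}_n(\mathcal J_f)}=\sqrt{\operatorname{Fitt}_n(\mathcal J_f/(f))}$. 2. The following are equivalent: $D$ is strongly Euler-homogeneous on $D\setminus D_0$; $\tilde D_i=D_{i-1}$ for $1\le i\le n-2$;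 $\sqrt{\tilde I_{i+1}}=\sqrt{I_i}$ for $1\le i\le n-2$; $\sqrt{\operatorname{Fitt}_i(\mathcal J_f)}=\sqrt{\operatorname{Fitt}_i(\mathcal J_f/(f))}$ for $2\le i\le n-1$. 3. The following are equivalent: $D$ is strongly Euler-homogeneous; $\tilde D_0=\varnothing$ and $\tilde D_i=D_{i-1}$ for $1\le i\le n-2$; $\tilde I_1=\mathcal O$ and $\sqrt{\tilde I_{i+1}}=\sqrt{I_i}$ for $1\le i\le n-2$; $\sqrt{\operatorname{Fitt}_i(\mathcal J_f)}=\sqrt{\operatorname{Fitt}_i(\mathcal J_f/(f))}$ for $2\le i\le n$. In particular, for $n=2$, $D$ is strongly Euler-homogeneous if and only if $\tilde D_0=\varnothing$. -/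

import Mathlib

open Filter Topology

noncomputable section

/-- The `j`-th Fitting ideal of a finitely generated module `M` over a commutative ring `R`
(`j` an integer): for generators `v 0, …, v (m - 1)` of `M`, the ideal generated by the minors of
order `m - j` of the matrices whose rows are linear relations between the generators. This ideal
does not depend on the generators; we write the sum over all finite families of generators, which
avoids a choice. A minor of order `≤ 0` is `1`; a minor whose order exceeds `m` repeats a column
and is `0`, so that the ideal is `⊥` for `j < 0`. -/
def fittingIdeal (R M : Type*) [CommRing R] [AddCommGroup M] [Module R M] (j : ℤ) : Ideal R :=
  ⨆ (m : ℕ) (v : Fin m → M) (_ : Submodule.span R (Set.range v) = ⊤),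
    Ideal.span {d : R | ∃ (r : Fin ((m : ℤ) - j).toNat → Fin m → R)
      (c : Fin ((m : ℤ) - j).toNat → Fin m),
      (∀ a, ∑ b, r a b • v b = 0) ∧ d = (Matrix.of fun a b => r a (c b)).det}

namespace DivisorGerm

/-- The space `ℂⁿ` (only its topology and its linear structure matter). -/
abbrev Cn (n : ℕ) : Type := Fin n → ℂ

/-- The ring of germs at `p` of holomorphic functions on `ℂⁿ`. -/
def holGerms {n : ℕ} (p : Cn n) : Subring (Germ (𝓝 p) ℂ) where
  carrier := {φ | ∃ g : Cn n → ℂ, AnalyticAt ℂ g p ∧ (g : Germ (𝓝 p) ℂ) = φ}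
  mul_mem' := by
    rintro _ _ ⟨g, hg, rfl⟩ ⟨h, hh, rfl⟩
    exact ⟨g * h, hg.mul hh, rfl⟩
  one_mem' := ⟨1, analyticAt_const, rfl⟩
  add_mem' := by
    rintro _ _ ⟨g, hg, rfl⟩ ⟨h, hh, rfl⟩
    exact ⟨g + h, hg.add hh, rfl⟩
  zero_mem' := ⟨0, analyticAt_const, rfl⟩
  neg_mem' := by
    rintro _ ⟨g, hg, rfl⟩
    exact ⟨-g, hg.neg, rfl⟩

/-- The local ring `𝒪_{ℂⁿ,p}`. -/
abbrev Hol {n : ℕ} (p : Cn n) : Type := holGerms p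

variable {n : ℕ} {p : Cn n}

/-- A function representing the germ `φ`; two representatives agree near `p`. -/
def rep (φ : Hol p) : Cn n → ℂ := φ.2.choose

theorem rep_analyticAt (φ : Hol p) : AnalyticAt ℂ (rep φ) p := φ.2.choose_spec.1

theorem coe_rep (φ : Hol p) : ((rep φ : Cn n → ℂ) : Germ (𝓝 p) ℂ) = φ := φ.2.choose_spec.2

/-- The germ at `p` of a function that is holomorphic near `p`. -/
def toGerm (g : Cn n → ℂ) (hg : AnalyticAt ℂ g p) : Hol p := ⟨(g : Germ (𝓝 p) ℂ), g, hg, rfl⟩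

/-- The partial derivative `∂_j φ` of a germ. -/
def partialDeriv (j : Fin n) (φ : Hol p) : Hol p :=
  toGerm (fun x => fderiv ℂ (rep φ) x (Pi.single j 1))
    (((ContinuousLinearMap.apply ℂ ℂ (Pi.single j (1 : ℂ) : Cn n)).analyticAt _).comp
      (rep_analyticAt φ).fderiv)

/-- The action `δ(φ) = ∑ a_j ∂_j φ` of the germ of vector field `δ = ∑ a_j ∂_j`, given by its
coefficients. (The derivations of `𝒪_{ℂⁿ,p}` form the free module on `∂_1, …, ∂_n`.) -/
def applyField (a : Fin n → Hol p) (φ : Hol p) : Hol p := ∑ j, a j * partialDeriv j φ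

/-- `g` is a reduced local equation at `p` of the set `D`: near `p` the set `D` is the zero set
of `g`, and `g` is a nonzero germ that generates a radical ideal, i.e. `𝒪_{ℂⁿ,p}/(g)` is
reduced. -/
def IsReducedEquation (D : Set (Cn n)) (p : Cn n) (g : Hol p) : Prop :=
  g ≠ 0 ∧ (Ideal.span {g}).IsRadical ∧ ∀ᶠ x in 𝓝 p, x ∈ D ↔ rep g x = 0

/-- The sets `S` and `T` have the same germ at `0`. -/
def SameGerm (S T : Set (Cn n)) : Prop := ∀ᶠ x in 𝓝 (0 : Cn n), x ∈ S ↔ x ∈ T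

/-- `D` is strongly Euler-homogeneous at `p`: some reduced local equation `g` of `D` at `p`
satisfies `δ(g) = g` for a germ of vector field `δ` that vanishes at `p`. -/
def IsStronglyEulerAt (D : Set (Cn n)) (p : Cn n) : Prop :=
  ∃ g : Hol p, IsReducedEquation D p g ∧
    ∃ a : Fin n → Hol p, (∀ j, rep (a j) p = 0) ∧ applyField a g = g

/-- The germ at `0` of `D` is strongly Euler-homogeneous on the germ at `0` of the set `S`. -/
def IsStronglyEulerOn (D S : Set (Cn n)) : Prop :=
  ∀ᶠ p in 𝓝 (0 : Cn n), p ∈ S → IsStronglyEulerAt D p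

/-- The singular locus of `D`: the points of `D` at which the reduced local equations of `D` have
zero differential. -/
def singularLocus (D : Set (Cn n)) : Set (Cn n) :=
  {p | p ∈ D ∧ ∀ g : Hol p, IsReducedEquation D p g → fderiv ℂ (rep g) p = 0}

open Classical in
/-- A set representing the germ at `0` of the zero locus `V(I)` of an ideal `I` of `𝒪_{ℂⁿ,0}`:
the common zeros of representatives of finitely many generators of `I`. Its germ at `0` depends
neither on the generators nor on the representatives. (The ring is Noetherian, so the second case
never occurs.) -/
def zeroLocus (I : Ideal (Hol (0 : Cn n))) : Set (Cn n) :=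
  if h : I.FG then {x | ∀ φ ∈ h.choose, rep φ x = 0} else ∅

/-- The Jacobian ideal `𝒥_f = (∂_1 f, …, ∂_n f, f)`. -/
def jacobianIdeal (f : Hol p) : Ideal (Hol p) :=
  Ideal.span (Set.range (fun j => partialDeriv j f) ∪ {f})

/-- The module `𝒥_f / (f)`. -/
abbrev JacobianQuotient (f : Hol p) : Type :=
  jacobianIdeal f ⧸ (Submodule.comap (jacobianIdeal f).subtype (Ideal.span {f}))

/-- `I_i = Fitt_{n-i}(𝒥_f / (f))`. -/
def idealI (f : Hol p) (i : ℤ) : Ideal (Hol p) :=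
  fittingIdeal (Hol p) (JacobianQuotient f) (n - i)

/-- `Ĩ_i = Fitt_{n+1-i}(𝒥_f)`. -/
def idealItilde (f : Hol p) (i : ℤ) : Ideal (Hol p) :=
  fittingIdeal (Hol p) (jacobianIdeal f) (n + 1 - i)

/-- `D_i = V(I_{i+1})`. -/
def locusD (f : Hol (0 : Cn n)) (i : ℤ) : Set (Cn n) := zeroLocus (idealI f (i + 1))

/-- `D̃_i = V(Ĩ_{i+1})`. -/
def locusDtilde (f : Hol (0 : Cn n)) (i : ℤ) : Set (Cn n) := zeroLocus (idealItilde f (i + 1))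

/-- `D_E`, the union of the sets `D_i \ D̃_i` for `0 ≤ i ≤ n - 2`. -/
def locusE (f : Hol (0 : Cn n)) : Set (Cn n) :=
  ⋃ i ∈ Set.Icc (0 : ℤ) (n - 2), locusD f i \ locusDtilde f i

/-- `D_NE`, the union of the sets `D̃_i \ D_{i-1}` for `0 ≤ i ≤ n - 2`. -/
def locusNE (f : Hol (0 : Cn n)) : Set (Cn n) :=
  ⋃ i ∈ Set.Icc (0 : ℤ) (n - 2), locusDtilde f i \ locusD f (i - 1)

/-- `δ` and `α` are a finite generating family `δ_1, …, δ_m` of the module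
`Der_f = {δ | δ(f) ∈ (f)}` of logarithmic vector fields and the germs with `δ_k(f) = α_k f`. -/
def IsLogGenerating (f : Hol p) {m : ℕ} (δ : Fin m → Fin n → Hol p) (α : Fin m → Hol p) : Prop :=
  (∀ a : Fin n → Hol p,
    a ∈ Submodule.span (Hol p) (Set.range δ) ↔ applyField a f ∈ Ideal.span {f}) ∧
  ∀ k, applyField (δ k) f = α k * f

/-- The Saito matrix `A = (δ_k(x_j))`. -/
def saitoMatrix {m : ℕ} (δ : Fin m → Fin n → Hol p) : Matrix (Fin m) (Fin n) (Hol p) :=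
  Matrix.of δ

/-- The extended Saito matrix `Ã = (A | -α)`. -/
def extendedSaitoMatrix {m : ℕ} (δ : Fin m → Fin n → Hol p) (α : Fin m → Hol p) :
    Matrix (Fin m) (Fin n ⊕ Unit) (Hol p) :=
  Matrix.fromCols (saitoMatrix δ) (Matrix.of fun k _ => -α k)

/-- The rank at the point `x` of a matrix of germs. -/
def rankAt {ι κ : Type*} [Fintype κ] (A : Matrix ι κ (Hol p)) (x : Cn n) : ℕ :=
  (A.map fun φ => rep φ x).rank

end DivisorGerm

end

open DivisorGerm

/-!
Near `0` every set in the theorem is described by two integers attached to a point `x`: the rank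
`r(x)` of the Saito matrix and the rank `s(x)` of the extended Saito matrix, for which
`r(x) ≤ s(x) ≤ r(x) + 1`.

* The rows of the extended Saito matrix generate the relations between `∂_1 f, …, ∂_n f, f`, and
  those of the Saito matrix the relations between the `∂_j f` modulo `f`. At each prime, the minors
  of any matrix of relations and the Fitting ideal both express the dimension of the fibre, so that
  a Fitting ideal and the ideal of minors have the same radical (`radical_fittingIdeal`). Hence
  `D_i = {r ≤ i}` and `D̃_i = {s ≤ i}` (`sameGerm_locusD`, `sameGerm_locusDtilde`).
* Off the divisor the fields `f ∂_j` give `r = n`; at its smooth points the fields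
  `∂_j f ∂_i - ∂_i f ∂_j` give `r = n - 1`. Conversely, if logarithmic fields take `n - 1`
  independent values at a point of the divisor, the divisor is smooth there
  (`exists_ev_partialDeriv_ne_zero`). This is proved without integrating vector fields: the ring of
  germs has no proper nonzero ideal stable under differentiation (`eq_top_of_dirDeriv_stable`), and
  after elimination the fields show that the functions of `n - 1` coordinates contained in the ideal
  of `f` and its derivative in the remaining direction form such a stable ideal. It contains the
  discriminant of `f`, hence `1`, so that this derivative does not vanish at the point.
* At a point `x` of the divisor, strong Euler-homogeneity means that `s(x) = r(x) + 1`: some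
  combination of the logarithmic fields vanishes at `x` while its factor does not
  (`eventually_isStronglyEulerAt_iff`). It matters here that generators of the logarithmic fields at
  `0` generate them at the nearby points (Oka's coherence theorem `oka`), that reducedness is an
  open condition (`eventually_isRadical`), and that two reduced equations differ by a unit
  (`associated_of_isRadical`, a consequence of the Nullstellensatz).

With these facts, collected in `eventually_local_structure`, the statements about sets are
statements about the integers `r ≤ s ≤ r + 1`. Rückert's Nullstellensatz turns them into statements
about radicals of ideals (`radical_eq_radical_iff`, `sameGerm_zeroLocus_empty_iff`).

The local theory of analytic functions rests on Weierstrass division. Division by a function `f` of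
order `d` in the last variable amounts to inverting the operator
`h ↦ f · T^d h + (h_0 + ⋯ + h_{d-1} t^{d-1})`, where `T` shifts the Taylor coefficients of `h`. The
Taylor coefficients are modelled by bounded sequences, and the multiplication by `f` is `f` applied
to commuting operators (`exists_operatorCalculus`). At the centre the operator is invertible
(`isUnit_division_operator`), hence it is so at the nearby points, with an inverse that depends
analytically on the point. Division and preparation for germs (`exists_division`,
`exists_preparation`) give that the ring of germs is Noetherian and, by induction on the number of
variables, Oka's theorem; the Nullstellensatz follows by elimination of a variable.
-/

noncomputable section

namespace DivisorGerm

/-! ### Germs of holomorphic functions -/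

section Basic

variable {n : ℕ} {p : Cn n}

theorem rep_toGerm (g : Cn n → ℂ) (hg : AnalyticAt ℂ g p) : rep (toGerm g hg) =ᶠ[𝓝 p] g :=
  Germ.coe_eq.1 (coe_rep (toGerm g hg))

theorem hol_ext_iff {φ ψ : Hol p} : φ = ψ ↔ rep φ =ᶠ[𝓝 p] rep ψ := by
  rw [← Germ.coe_eq, coe_rep, coe_rep, Subtype.ext_iff]

theorem hol_ext {φ ψ : Hol p} (h : rep φ =ᶠ[𝓝 p] rep ψ) : φ = ψ := hol_ext_iff.2 h

theorem rep_eq_of_coe {φ : Hol p} {g : Cn n → ℂ} (h : (φ : Germ (𝓝 p) ℂ) = g) :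
    rep φ =ᶠ[𝓝 p] g := Germ.coe_eq.1 ((coe_rep φ).trans h)

theorem toGerm_eq_of {φ : Hol p} {g : Cn n → ℂ} (hg : AnalyticAt ℂ g p) (h : rep φ =ᶠ[𝓝 p] g) :
    toGerm g hg = φ := hol_ext ((rep_toGerm g hg).trans h.symm)

theorem rep_add (φ ψ : Hol p) : rep (φ + ψ) =ᶠ[𝓝 p] fun x => rep φ x + rep ψ x :=
  rep_eq_of_coe <| by
    have : ((φ + ψ : Hol p) : Germ (𝓝 p) ℂ) = φ + ψ := rfl
    rw [this, ← coe_rep φ, ← coe_rep ψ]; rfl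

theorem rep_mul (φ ψ : Hol p) : rep (φ * ψ) =ᶠ[𝓝 p] fun x => rep φ x * rep ψ x :=
  rep_eq_of_coe <| by
    have : ((φ * ψ : Hol p) : Germ (𝓝 p) ℂ) = φ * ψ := rfl
    rw [this, ← coe_rep φ, ← coe_rep ψ]; rfl

theorem rep_neg (φ : Hol p) : rep (-φ) =ᶠ[𝓝 p] fun x => -rep φ x :=
  rep_eq_of_coe <| by
    have : ((-φ : Hol p) : Germ (𝓝 p) ℂ) = -φ := rfl
    rw [this, ← coe_rep φ]; rfl

theorem rep_zero : rep (0 : Hol p) =ᶠ[𝓝 p] fun _ => 0 := rep_eq_of_coe rfl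

theorem rep_one : rep (1 : Hol p) =ᶠ[𝓝 p] fun _ => 1 := rep_eq_of_coe rfl

theorem rep_sub (φ ψ : Hol p) : rep (φ - ψ) =ᶠ[𝓝 p] fun x => rep φ x - rep ψ x := by
  filter_upwards [rep_add φ (-ψ), rep_neg ψ] with x h1 h2
  rw [sub_eq_add_neg, h1, h2, ← sub_eq_add_neg]

theorem rep_pow (φ : Hol p) (k : ℕ) : rep (φ ^ k) =ᶠ[𝓝 p] fun x => rep φ x ^ k := by
  induction k with
  | zero => simpa using rep_one
  | succ k ih =>
    filter_upwards [ih, rep_mul (φ ^ k) φ] with x h1 h2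
    rw [pow_succ, h2, h1, pow_succ]

theorem rep_sum {ι : Type*} (s : Finset ι) (φ : ι → Hol p) :
    rep (∑ i ∈ s, φ i) =ᶠ[𝓝 p] fun x => ∑ i ∈ s, rep (φ i) x := by
  classical
  induction s using Finset.induction_on with
  | empty => simpa using rep_zero
  | insert a s ha ih =>
    filter_upwards [ih, rep_add (φ a) (∑ i ∈ s, φ i)] with x h1 h2
    rw [Finset.sum_insert ha, Finset.sum_insert ha, h2, h1]

theorem rep_prod {ι : Type*} (s : Finset ι) (φ : ι → Hol p) :
    rep (∏ i ∈ s, φ i) =ᶠ[𝓝 p] fun x => ∏ i ∈ s, rep (φ i) x := by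
  classical
  induction s using Finset.induction_on with
  | empty => simpa using rep_one
  | insert a s ha ih =>
    filter_upwards [ih, rep_mul (φ a) (∏ i ∈ s, φ i)] with x h1 h2
    rw [Finset.prod_insert ha, Finset.prod_insert ha, h2, h1]

theorem rep_det {ι : Type*} [Fintype ι] [DecidableEq ι] (M : Matrix ι ι (Hol p)) :
    ∀ᶠ x in 𝓝 p, rep M.det x = (M.map fun φ => rep φ x).det := by
  rw [Matrix.det_apply]
  have h : ∀ σ : Equiv.Perm ι, rep (Equiv.Perm.sign σ • ∏ i, M (σ i) i) =ᶠ[𝓝 p]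
      fun x => Equiv.Perm.sign σ • ∏ i, rep (M (σ i) i) x := by
    intro σ
    rcases Int.units_eq_one_or (Equiv.Perm.sign σ) with h | h
    · rw [h]; simpa using rep_prod _ _
    · rw [h]
      filter_upwards [rep_neg (∏ i, M (σ i) i), rep_prod Finset.univ fun i => M (σ i) i]
        with x h1 h2
      simp only [Units.neg_smul, one_smul, h1, h2]
  filter_upwards [rep_sum Finset.univ fun σ : Equiv.Perm ι => Equiv.Perm.sign σ • ∏ i, M (σ i) i,
    eventually_all.2 h] with x h1 h2
  rw [h1, Matrix.det_apply]
  exact Finset.sum_congr rfl fun σ _ => h2 σ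

/-- The value of a germ at its base point. -/
def ev (p : Cn n) : Hol p →+* ℂ where
  toFun φ := rep φ p
  map_one' := rep_one.self_of_nhds
  map_zero' := rep_zero.self_of_nhds
  map_add' φ ψ := (rep_add φ ψ).self_of_nhds
  map_mul' φ ψ := (rep_mul φ ψ).self_of_nhds

theorem ev_apply (φ : Hol p) : ev p φ = rep φ p := rfl

/-- The germ of a constant function. -/
def constGerm (p : Cn n) : ℂ →+* Hol p where
  toFun c := toGerm (fun _ => c) analyticAt_const
  map_one' := rfl
  map_zero' := rfl
  map_add' _ _ := rfl
  map_mul' _ _ := rfl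

theorem rep_const (c : ℂ) : rep (constGerm p c) =ᶠ[𝓝 p] fun _ => c :=
  rep_toGerm _ analyticAt_const

@[simp] theorem ev_const (c : ℂ) : ev p (constGerm p c) = c := (rep_const c).self_of_nhds

theorem isUnit_iff_ev {φ : Hol p} : IsUnit φ ↔ ev p φ ≠ 0 := by
  constructor
  · exact fun h => (h.map (ev p)).ne_zero
  · intro h
    have ha : AnalyticAt ℂ (fun x => (rep φ x)⁻¹) p := (rep_analyticAt φ).inv h
    refine IsUnit.of_mul_eq_one (toGerm _ ha) (hol_ext ?_)
    have hne : ∀ᶠ x in 𝓝 p, rep φ x ≠ 0 := (rep_analyticAt φ).continuousAt.eventually_ne h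
    filter_upwards [rep_mul φ (toGerm _ ha), rep_toGerm _ ha, rep_one (p := p), hne]
      with x h1 h2 h3 h4
    rw [h1, h2, h3, mul_inv_cancel₀ h4]

instance : Nontrivial (Hol p) :=
  ⟨0, 1, fun h => by simpa using congrArg (ev p) h⟩

theorem ideal_eq_top_of_ev {I : Ideal (Hol p)} {φ : Hol p} (h : φ ∈ I) (h0 : ev p φ ≠ 0) : I = ⊤ :=
  Ideal.eq_top_of_isUnit_mem _ h (isUnit_iff_ev.2 h0)

theorem ev_eq_zero_of_mem {I : Ideal (Hol p)} (hI : I ≠ ⊤) {φ : Hol p} (h : φ ∈ I) :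
    ev p φ = 0 := by
  by_contra h0; exact hI (ideal_eq_top_of_ev h h0)

/-- The germ at `x` of a representative of `φ`; the value is junk when the chosen
representative is not analytic at `x`, which does not happen for `x` near `p`. -/
def germAt (φ : Hol p) (x : Cn n) : Hol x :=
  open Classical in if h : AnalyticAt ℂ (rep φ) x then toGerm (rep φ) h else 0

theorem eventually_rep_germAt (φ : Hol p) : ∀ᶠ x in 𝓝 p, rep (germAt φ x) =ᶠ[𝓝 x] rep φ := by
  filter_upwards [(rep_analyticAt φ).eventually_analyticAt] with x hx
  rw [germAt, dif_pos hx]; exact rep_toGerm _ hx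

theorem germAt_self (φ : Hol p) : germAt φ p = φ := hol_ext (eventually_rep_germAt φ).self_of_nhds

theorem ev_germAt (φ : Hol p) : ∀ᶠ x in 𝓝 p, ev x (germAt φ x) = rep φ x :=
  (eventually_rep_germAt φ).mono fun _ h => h.self_of_nhds

theorem germAt_eq_of_eventuallyEq {φ : Hol p} {F : ∀ x : Cn n, Hol x} {g : Cn n → ℂ}
    (hφ : rep φ =ᶠ[𝓝 p] g) (hF : ∀ᶠ x in 𝓝 p, rep (F x) =ᶠ[𝓝 x] g) :
    ∀ᶠ x in 𝓝 p, germAt φ x = F x := by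
  filter_upwards [hφ.eventually_nhds, hF, eventually_rep_germAt φ] with x h1 h2 h3
  exact hol_ext (h3.trans (EventuallyEq.trans h1 h2.symm))

theorem germAt_add (φ ψ : Hol p) : ∀ᶠ x in 𝓝 p, germAt (φ + ψ) x = germAt φ x + germAt ψ x := by
  refine germAt_eq_of_eventuallyEq (rep_add φ ψ) ?_
  filter_upwards [eventually_rep_germAt φ, eventually_rep_germAt ψ] with x h1 h2
  filter_upwards [rep_add (germAt φ x) (germAt ψ x), h1, h2] with y a b c
  rw [a, b, c]

theorem germAt_mul (φ ψ : Hol p) : ∀ᶠ x in 𝓝 p, germAt (φ * ψ) x = germAt φ x * germAt ψ x := by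
  refine germAt_eq_of_eventuallyEq (rep_mul φ ψ) ?_
  filter_upwards [eventually_rep_germAt φ, eventually_rep_germAt ψ] with x h1 h2
  filter_upwards [rep_mul (germAt φ x) (germAt ψ x), h1, h2] with y a b c
  rw [a, b, c]

theorem germAt_const (c : ℂ) : ∀ᶠ x in 𝓝 p, germAt (constGerm p c) x = constGerm x c :=
  germAt_eq_of_eventuallyEq (rep_const c) (Eventually.of_forall fun _ => rep_const c)

theorem germAt_zero : ∀ᶠ x in 𝓝 p, germAt (0 : Hol p) x = 0 := by
  simpa using germAt_const (p := p) 0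

theorem germAt_one : ∀ᶠ x in 𝓝 p, germAt (1 : Hol p) x = 1 := by
  simpa using germAt_const (p := p) 1

theorem germAt_neg (φ : Hol p) : ∀ᶠ x in 𝓝 p, germAt (-φ) x = -germAt φ x := by
  filter_upwards [germAt_add φ (-φ), germAt_zero (p := p)] with x h1 h2
  rw [add_neg_cancel, h2] at h1
  exact eq_neg_of_add_eq_zero_right h1.symm

theorem germAt_sub (φ ψ : Hol p) : ∀ᶠ x in 𝓝 p, germAt (φ - ψ) x = germAt φ x - germAt ψ x := by
  filter_upwards [germAt_add φ (-ψ), germAt_neg ψ] with x h1 h2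
  rw [sub_eq_add_neg, h1, h2, sub_eq_add_neg]

theorem germAt_pow (φ : Hol p) (k : ℕ) : ∀ᶠ x in 𝓝 p, germAt (φ ^ k) x = germAt φ x ^ k := by
  induction k with
  | zero => simpa using germAt_one
  | succ k ih =>
    filter_upwards [ih, germAt_mul (φ ^ k) φ] with x h1 h2
    rw [pow_succ, h2, h1, pow_succ]

theorem germAt_sum {ι : Type*} (s : Finset ι) (φ : ι → Hol p) :
    ∀ᶠ x in 𝓝 p, germAt (∑ i ∈ s, φ i) x = ∑ i ∈ s, germAt (φ i) x := by
  classical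
  induction s using Finset.induction_on with
  | empty => simpa using germAt_zero
  | insert a s ha ih =>
    filter_upwards [ih, germAt_add (φ a) (∑ i ∈ s, φ i)] with x h1 h2
    rw [Finset.sum_insert ha, Finset.sum_insert ha, h2, h1]

theorem germAt_sum_mul {ι : Type*} [Fintype ι] (φ ψ : ι → Hol p) :
    ∀ᶠ x in 𝓝 p, germAt (∑ i, φ i * ψ i) x = ∑ i, germAt (φ i) x * germAt (ψ i) x := by
  filter_upwards [germAt_sum Finset.univ fun i => φ i * ψ i,
    eventually_all.2 fun i => germAt_mul (φ i) (ψ i)] with x h1 h2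
  rw [h1]; exact Finset.sum_congr rfl fun i _ => h2 i

/-- By the identity theorem, on a suitable ball around `p` a germ of `φ` vanishes at one point
only if `φ = 0`. -/
theorem germAt_ne_zero {φ : Hol p} (h : φ ≠ 0) : ∀ᶠ x in 𝓝 p, germAt φ x ≠ 0 := by
  obtain ⟨r, hr, hb⟩ := Metric.eventually_nhds_iff_ball.1
    ((rep_analyticAt φ).eventually_analyticAt.and (eventually_rep_germAt φ))
  filter_upwards [Metric.ball_mem_nhds p hr] with x hx h0
  refine h (hol_ext ?_)
  have h1 : rep φ =ᶠ[𝓝 x] 0 := by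
    have := (hb x hx).2
    rw [h0] at this
    exact this.symm.trans rep_zero
  have h2 := AnalyticOnNhd.eqOn_zero_of_preconnected_of_eventuallyEq_zero
    (fun y hy => (hb y hy).1) (convex_ball p r).isPreconnected hx h1
  filter_upwards [Metric.ball_mem_nhds p hr, rep_zero (p := p)] with y hy h3
  rw [h2 hy, h3]; rfl

theorem frequently_rep_ne_zero {φ : Hol p} (h : φ ≠ 0) : ∃ᶠ x in 𝓝 p, rep φ x ≠ 0 := by
  intro h0
  refine h (hol_ext ?_)
  filter_upwards [h0, rep_zero (p := p)] with x h1 h2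
  rw [h2]; exact not_not.1 h1

instance : NoZeroDivisors (Hol p) where
  eq_zero_or_eq_zero_of_mul_eq_zero {φ ψ} h := by
    by_contra! hne
    -- at a nearby point where `φ` does not vanish it is a unit, so that the germ of `ψ` is zero
    have h1 : ∀ᶠ x in 𝓝 p, germAt φ x * germAt ψ x = 0 := by
      filter_upwards [germAt_mul φ ψ, germAt_zero (p := p)] with x h2 h3
      rw [← h2, h, h3]
    obtain ⟨x, hx, h2, h3, h4, h5⟩ := ((frequently_rep_ne_zero hne.1).and_eventually
      (h1.and ((ev_germAt φ).and ((germAt_ne_zero hne.2).and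
        (germAt_ne_zero hne.1))))).exists
    have hu : IsUnit (germAt φ x) := isUnit_iff_ev.2 (by rwa [h3])
    exact h4 ((hu.mul_right_eq_zero).1 h2)

instance : IsDomain (Hol p) := NoZeroDivisors.to_isDomain _

end Basic

/-! ### Analytic functions of commuting operators -/

section Calculus

open scoped NNReal ENNReal

variable {N : ℕ} {B : Type*} [NormedRing B] [NormedAlgebra ℂ B] [NormOneClass B]

/-- The form `∑_w Q(e_w) y_w` in (possibly non-commuting) variables `y_1, …, y_N` of a Banach
algebra, the sum running over the words `w` of length `m` in the basis vectors. -/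
def wordForm (B : Type*) [NormedRing B] [NormedAlgebra ℂ B] {m : ℕ}
    (Q : ContinuousMultilinearMap ℂ (fun _ : Fin m => Fin N → ℂ) ℂ) :
    ContinuousMultilinearMap ℂ (fun _ : Fin m => Fin N → B) B :=
  ∑ i : Fin m → Fin N, Q (fun j => Pi.single (i j) (1 : ℂ)) •
    (ContinuousMultilinearMap.mkPiAlgebraFin ℂ m B).compContinuousLinearMap
      (fun j => ContinuousLinearMap.proj (R := ℂ) (φ := fun _ : Fin N => B) (i j))

theorem norm_wordForm_le {m : ℕ} (Q : ContinuousMultilinearMap ℂ (fun _ : Fin m => Fin N → ℂ) ℂ) :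
    ‖wordForm B Q‖ ≤ (N : ℝ) ^ m * ‖Q‖ := by
  refine ContinuousMultilinearMap.opNorm_le_bound (by positivity) fun v => ?_
  have h : ∀ i : Fin m → Fin N, ‖Q (fun j => Pi.single (i j) (1 : ℂ)) •
      (ContinuousMultilinearMap.mkPiAlgebraFin ℂ m B) fun j => v j (i j)‖ ≤ ‖Q‖ * ∏ j, ‖v j‖ := by
    intro i
    rw [norm_smul]
    have h1 : ‖Q (fun j => Pi.single (i j) (1 : ℂ))‖ ≤ ‖Q‖ := by
      refine (Q.le_opNorm _).trans ?_
      have : ∏ j, ‖(Pi.single (i j) (1 : ℂ) : Fin N → ℂ)‖ ≤ 1 :=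
        Finset.prod_le_one (fun _ _ => norm_nonneg _) fun j _ => by
          rw [Pi.norm_single]; simp
      exact mul_le_of_le_one_right (norm_nonneg _) this
    refine mul_le_mul h1 ?_ (norm_nonneg _) (norm_nonneg _)
    refine ((ContinuousMultilinearMap.mkPiAlgebraFin ℂ m B).le_opNorm _).trans ?_
    rw [ContinuousMultilinearMap.norm_mkPiAlgebraFin, one_mul]
    exact Finset.prod_le_prod (fun _ _ => norm_nonneg _) fun j _ => norm_le_pi_norm _ _
  have h0 : wordForm B Q v = ∑ i : Fin m → Fin N, Q (fun j => Pi.single (i j) (1 : ℂ)) •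
      (ContinuousMultilinearMap.mkPiAlgebraFin ℂ m B) fun j => v j (i j) := by
    simp only [wordForm, sum_apply, smul_apply,
      ContinuousMultilinearMap.compContinuousLinearMap_apply, ContinuousLinearMap.proj_apply]
  rw [h0]
  refine (norm_sum_le _ _).trans ((Finset.sum_le_sum fun i _ => h i).trans ?_)
  simp [mul_assoc]

/-- The extension of a scalar power series on `ℂᴺ` to `N`-tuples in a Banach algebra. -/
def wordSeries (B : Type*) [NormedRing B] [NormedAlgebra ℂ B]
    (P : FormalMultilinearSeries ℂ (Fin N → ℂ) ℂ) :
    FormalMultilinearSeries ℂ (Fin N → B) B := fun m => wordForm B (P m)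

theorem wordSeries_radius_pos {P : FormalMultilinearSeries ℂ (Fin N → ℂ) ℂ} (hP : 0 < P.radius) :
    0 < (wordSeries B P).radius := by
  obtain ⟨r, hr0, hr⟩ := ENNReal.lt_iff_exists_nnreal_btwn.1 hP
  obtain ⟨C, hC, hb⟩ := P.norm_mul_pow_le_of_lt_radius hr
  have hr0' : 0 < r := by exact_mod_cast hr0
  have hs : 0 < r / (N + 1 : ℝ≥0) := by positivity
  refine lt_of_lt_of_le (b := ((r / (N + 1 : ℝ≥0) : ℝ≥0) : ℝ≥0∞)) (by exact_mod_cast hs) ?_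
  refine (wordSeries B P).le_radius_of_bound C fun m => ?_
  refine le_trans ?_ (hb m)
  refine (mul_le_mul_of_nonneg_right (norm_wordForm_le (B := B) (P m)) (by positivity)).trans ?_
  have h1 : (N : ℝ) ^ m * ((r / (N + 1 : ℝ≥0) : ℝ≥0) : ℝ) ^ m ≤ (r : ℝ) ^ m := by
    rw [← mul_pow]
    refine pow_le_pow_left₀ (by positivity) ?_ m
    push_cast
    rw [mul_div_assoc', div_le_iff₀ (by positivity)]
    nlinarith [r.coe_nonneg]
  calc _ = ‖P m‖ * ((N : ℝ) ^ m * ((r / (N + 1 : ℝ≥0) : ℝ≥0) : ℝ) ^ m) := by ring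
    _ ≤ _ := mul_le_mul_of_nonneg_left h1 (norm_nonneg _)

end Calculus

section Operators

variable {N : ℕ} {H : Type*} [NormedAddCommGroup H] [NormedSpace ℂ H]

/-- A common eigenfunctional of finitely many operators is an eigenfunctional of their product. -/
theorem comp_list_prod_eigen (lam : H →L[ℂ] ℂ) {m : ℕ} (y : Fin m → H →L[ℂ] H) (c : Fin m → ℂ)
    (h : ∀ i, lam ∘L y i = c i • lam) : lam ∘L (List.ofFn y).prod = (∏ i, c i) • lam := by
  induction m with
  | zero => ext; simp
  | succ m ih =>
    rw [List.ofFn_succ, List.prod_cons, Fin.prod_univ_succ, ContinuousLinearMap.mul_def,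
      ← ContinuousLinearMap.comp_assoc, h 0, ContinuousLinearMap.smul_comp,
      ih _ (fun i => c i.succ) fun i => h i.succ, smul_smul]

/-- On a common eigenfunctional of the operators `y_i`, the form acts by its value at the tuple of
eigenvalues. -/
theorem comp_wordForm_eigen {m : ℕ}
    (Q : ContinuousMultilinearMap ℂ (fun _ : Fin m => Fin N → ℂ) ℂ) (lam : H →L[ℂ] ℂ)
    (y : Fin N → H →L[ℂ] H) (c : Fin N → ℂ) (h : ∀ i, lam ∘L y i = c i • lam) :
    lam ∘L (wordForm (H →L[ℂ] H) Q fun _ => y) = (Q fun _ => c) • lam := by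
  have hc : (fun _ : Fin m => c) = fun _ => ∑ i, c i • (Pi.single i (1 : ℂ) : Fin N → ℂ) := by
    funext _; ext j; simp [Finset.sum_apply, Pi.single_apply]
  rw [hc, ContinuousMultilinearMap.map_sum]
  ext x
  simp only [ContinuousMultilinearMap.map_smul_univ, wordForm, sum_apply, smul_apply,
    ContinuousMultilinearMap.compContinuousLinearMap_apply, ContinuousLinearMap.proj_apply,
    ContinuousMultilinearMap.mkPiAlgebraFin_apply, ContinuousLinearMap.comp_apply, map_sum,
    map_smul, smul_eq_mul, Finset.sum_mul]
  refine Finset.sum_congr rfl fun i _ => ?_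
  have := congrArg (fun u => u x)
    (comp_list_prod_eigen lam (fun j => y (i j)) (fun j => c (i j)) fun j => h (i j))
  simp only [ContinuousLinearMap.comp_apply, smul_apply, smul_eq_mul] at this
  rw [this]
  ring

/-- A function of `N` complex variables that is analytic at `0` extends to `N`-tuples of small
bounded operators, in such a way that common eigenfunctionals of the operators are
eigenfunctionals of the result. -/
theorem exists_operatorCalculus [CompleteSpace H] [Nontrivial H] {f : (Fin N → ℂ) → ℂ}
    (hf : AnalyticAt ℂ f 0) :
    ∃ F : (Fin N → H →L[ℂ] H) → (H →L[ℂ] H), AnalyticAt ℂ F 0 ∧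
      ∀ᶠ y in 𝓝 (0 : Fin N → H →L[ℂ] H), ∀ (lam : H →L[ℂ] ℂ) (c : Fin N → ℂ),
        (∀ i, lam ∘L y i = c i • lam) → lam ∘L F y = f c • lam := by
  obtain ⟨P, r, hP⟩ := hf
  have hrad : 0 < P.radius := lt_of_lt_of_le hP.r_pos hP.r_le
  have hW := (wordSeries (H →L[ℂ] H) P).hasFPowerSeriesOnBall (wordSeries_radius_pos hrad)
  refine ⟨_, hW.analyticAt, ?_⟩
  filter_upwards [hW.eventually_hasSum_sub, Metric.eball_mem_nhds (0 : Fin N → H →L[ℂ] H) hP.r_pos]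
    with y hy hyr lam c hc
  by_cases hl : lam = 0
  · subst hl; ext; simp
  -- eigenvalues are bounded by operator norms, so that the scalar series converges at `c` as well
  have hcn : ∀ i, ‖c i‖ ≤ ‖y i‖ := by
    intro i
    have h1 : ‖c i • lam‖ ≤ ‖lam‖ * ‖y i‖ := by
      rw [← hc i]; exact ContinuousLinearMap.opNorm_comp_le _ _
    rw [norm_smul, mul_comm] at h1
    exact le_of_mul_le_mul_left h1 (norm_pos_iff.2 hl)
  have hcr : c ∈ Metric.eball (0 : Fin N → ℂ) r := by
    rw [mem_eball_zero_iff] at hyr ⊢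
    refine lt_of_le_of_lt ?_ hyr
    refine enorm_le_iff_norm_le.2 ?_
    exact (pi_norm_le_iff_of_nonneg (norm_nonneg _)).2 fun i =>
      (hcn i).trans (norm_le_pi_norm y i)
  have h1 := hP.hasSum hcr
  rw [zero_add] at h1
  simp only [sub_zero] at hy
  have h2 : HasSum (fun m => lam ∘L (wordSeries (H →L[ℂ] H) P m fun _ => y))
      (lam ∘L (wordSeries (H →L[ℂ] H) P).sum y) :=
    hy.mapL (ContinuousLinearMap.compL ℂ H H ℂ lam)
  have h3 : HasSum (fun m => (P m fun _ => c) • lam) (f c • lam) := h1.smul_const lam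
  refine h2.unique ?_
  simpa only [wordSeries, comp_wordForm_eigen _ lam y c hc] using h3

end Operators

/-! ### Shift operators on bounded sequences -/

section Shift

/-- A model of the Banach space of Taylor coefficients of functions of one variable on the unit
disc, with the operators `L : (h_0, h_1, …) ↦ (h_1, h_2, …)`, `R : (h_0, h_1, …) ↦ (0, h_0, …)`
(the multiplication by the variable), the constant term `c` and the constant function `e`. A vector
is determined by its coefficients `c (L ^ k h)`. -/
structure ShiftSystem (H : Type*) [NormedAddCommGroup H] [NormedSpace ℂ H] where
  L : H →L[ℂ] H
  R : H →L[ℂ] H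
  c : H →L[ℂ] ℂ
  e : H
  L_mul_R : L * R = 1
  c_R : ∀ h, c (R h) = 0
  c_e : c e = 1
  L_e : L e = 0
  norm_L_le : ‖L‖ ≤ 1
  eq_zero : ∀ h, (∀ k : ℕ, c ((L ^ k) h) = 0) → h = 0

/-- The shift operators on the space of bounded sequences. -/
def boundedShift : ShiftSystem (BoundedContinuousFunction ℕ ℂ) where
  L := LinearMap.mkContinuous
    { toFun := fun h => h.compContinuous ⟨Nat.succ, continuous_of_discreteTopology⟩
      map_add' := fun _ _ => rfl
      map_smul' := fun _ _ => rfl } 1 fun h => by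
    rw [one_mul]
    exact (BoundedContinuousFunction.norm_le (norm_nonneg _)).2 fun k => h.norm_coe_le_norm _
  R := LinearMap.mkContinuous
    { toFun := fun h => BoundedContinuousFunction.ofNormedAddCommGroupDiscrete
        (fun k => Nat.casesOn k 0 fun k => h k) ‖h‖ fun k => by
          cases k with
          | zero => simp
          | succ k => exact h.norm_coe_le_norm _
      map_add' := fun a b => by ext k; cases k <;> simp
      map_smul' := fun a b => by ext k; cases k <;> simp } 1 fun h => by
    rw [one_mul]
    exact (BoundedContinuousFunction.norm_le (norm_nonneg _)).2 fun k => by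
      cases k with
      | zero => simp
      | succ k => exact h.norm_coe_le_norm _
  c := BoundedContinuousFunction.evalCLM ℂ 0
  e := BoundedContinuousFunction.ofNormedAddCommGroupDiscrete
    (fun k => if k = 0 then 1 else 0) 1 fun k => by split_ifs <;> simp
  L_mul_R := rfl
  c_R _ := rfl
  c_e := rfl
  L_e := rfl
  norm_L_le := LinearMap.mkContinuous_norm_le _ zero_le_one _
  eq_zero h hk := by
    set T : BoundedContinuousFunction ℕ ℂ →L[ℂ] BoundedContinuousFunction ℕ ℂ :=
      LinearMap.mkContinuous
        { toFun := fun h => h.compContinuous ⟨Nat.succ, continuous_of_discreteTopology⟩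
          map_add' := fun _ _ => rfl
          map_smul' := fun _ _ => rfl } 1 _
    have key : ∀ d k : ℕ, (T ^ d) h k = h (k + d) := by
      intro d
      induction d with
      | zero => intro k; rfl
      | succ d ih =>
        intro k
        rw [pow_succ']
        change (T ^ d) h (k + 1) = _
        rw [ih]; congr 1; ring
    ext k
    have h1 := key k 0
    rw [zero_add] at h1
    rw [← h1]
    exact hk k

namespace ShiftSystem

variable {H : Type*} [NormedAddCommGroup H] [NormedSpace ℂ H] (s : ShiftSystem H)

theorem L_R (h : H) : s.L (s.R h) = h := congrArg (fun u => u h) s.L_mul_R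

theorem L_pow_mul_R_pow (d : ℕ) : s.L ^ d * s.R ^ d = 1 := by
  induction d with
  | zero => simp
  | succ d ih =>
    rw [pow_succ, pow_succ', mul_assoc, ← mul_assoc s.L, s.L_mul_R, one_mul, ih]

/-- The functional `h ↦ ∑ h_k z^k`, for `|z| < 1`. -/
def eval (z : ℂ) : H →L[ℂ] ℂ := s.c ∘L Ring.inverse (1 - z • s.L)

theorem coeff_R_pow_e (j k : ℕ) : s.c ((s.L ^ k) ((s.R ^ j) s.e)) = if j = k then 1 else 0 := by
  rcases lt_trichotomy j k with h | h | h
  · obtain ⟨m, rfl⟩ := Nat.exists_eq_add_of_lt h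
    have h1 : s.L ^ (j + m + 1) * s.R ^ j = s.L ^ (m + 1) := by
      rw [show j + m + 1 = (m + 1) + j by ring, pow_add, mul_assoc, s.L_pow_mul_R_pow, mul_one]
    have h2 := congrArg (fun u => u s.e) h1
    simp only [mul_apply_eq_comp] at h2
    rw [h2, pow_succ, mul_apply_eq_comp, s.L_e, map_zero, map_zero, if_neg h.ne]
  · subst h
    have h2 := congrArg (fun u => u s.e) (s.L_pow_mul_R_pow j)
    simp only [mul_apply_eq_comp, one_apply_eq_self] at h2
    rw [h2, s.c_e, if_pos rfl]
  · obtain ⟨m, rfl⟩ := Nat.exists_eq_add_of_lt h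
    have h1 : s.L ^ k * s.R ^ (k + m + 1) = s.R ^ (m + 1) := by
      rw [add_assoc, pow_add, ← mul_assoc, s.L_pow_mul_R_pow, one_mul]
    have h2 := congrArg (fun u => u s.e) h1
    simp only [mul_apply_eq_comp] at h2
    rw [h2, pow_succ', mul_apply_eq_comp, s.c_R, if_neg h.ne']

variable [CompleteSpace H]

theorem isUnit_one_sub_L {z : ℂ} (hz : ‖z‖ < 1) : IsUnit (1 - z • s.L) := by
  refine isUnit_one_sub_of_norm_lt_one ?_
  rw [norm_smul]
  exact (mul_le_of_le_one_right (norm_nonneg _) s.norm_L_le).trans_lt hz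

/-- Evaluation at `z` satisfies `h(z) - z (L h)(z) = h_0`. -/
theorem eval_comp {z : ℂ} (hz : ‖z‖ < 1) : s.eval z ∘L (1 - z • s.L) = s.c := by
  rw [eval, ContinuousLinearMap.comp_assoc, ← ContinuousLinearMap.mul_def,
    Ring.inverse_mul_cancel _ (s.isUnit_one_sub_L hz)]
  rfl

theorem eval_eq {z : ℂ} (hz : ‖z‖ < 1) (h : H) :
    s.eval z h = s.c h + z * s.eval z (s.L h) := by
  have := congrArg (fun u => u h) (s.eval_comp hz)
  simp only [ContinuousLinearMap.comp_apply, sub_apply, one_apply_eq_self, map_sub,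
    smul_apply, map_smul, smul_eq_mul] at this
  rw [← this]; ring

theorem eval_R {z : ℂ} (hz : ‖z‖ < 1) (h : H) :
    s.eval z (s.R h) = z * s.eval z h := by
  rw [s.eval_eq hz (s.R h), s.c_R, zero_add, s.L_R]

theorem eval_R_pow {z : ℂ} (hz : ‖z‖ < 1) (d : ℕ) (h : H) :
    s.eval z ((s.R ^ d) h) = z ^ d * s.eval z h := by
  induction d with
  | zero => simp
  | succ d ih => rw [pow_succ', mul_apply_eq_comp, s.eval_R hz, ih]; ring

theorem eval_e {z : ℂ} (hz : ‖z‖ < 1) : s.eval z s.e = 1 := by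
  rw [s.eval_eq hz, s.L_e, s.c_e]; simp

theorem eval_eq_sum {z : ℂ} (hz : ‖z‖ < 1) (d : ℕ) (h : H) :
    s.eval z h = ∑ k ∈ Finset.range d, s.c ((s.L ^ k) h) * z ^ k +
      z ^ d * s.eval z ((s.L ^ d) h) := by
  induction d with
  | zero => simp
  | succ d ih =>
    rw [ih, Finset.sum_range_succ, s.eval_eq hz ((s.L ^ d) h), pow_succ', pow_succ' s.L,
      mul_apply_eq_comp]
    ring

theorem analyticAt_eval {z : ℂ} (hz : ‖z‖ < 1) : AnalyticAt ℂ s.eval z := by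
  have h1 : AnalyticAt ℂ (fun z : ℂ => (1 : H →L[ℂ] H) - z • s.L) z :=
    analyticAt_const.sub (analyticAt_id.smul analyticAt_const)
  have h2 : AnalyticAt ℂ (Ring.inverse : (H →L[ℂ] H) → _) (1 - z • s.L) :=
    analyticAt_inverse (s.isUnit_one_sub_L hz).unit
  exact ((ContinuousLinearMap.compL ℂ H H ℂ s.c).analyticAt _).comp
    (AnalyticAt.comp (g := Ring.inverse) (f := fun z : ℂ => (1 : H →L[ℂ] H) - z • s.L) h2 h1)

/-- A vector is determined by its values on the unit disc. The functions `h` and `L h` are related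
by `h(z) = h_0 + z (L h)(z)`, so the vanishing of `h` passes to `h_0` and to `L h`, hence to all
coefficients. -/
theorem eq_zero_of_eval {h : H} (h0 : ∀ z : ℂ, ‖z‖ < 1 → s.eval z h = 0) : h = 0 := by
  have key : ∀ g : H, (∀ z : ℂ, ‖z‖ < 1 → s.eval z g = 0) →
      s.c g = 0 ∧ ∀ z : ℂ, ‖z‖ < 1 → s.eval z (s.L g) = 0 := by
    intro g hg
    have hg0 : s.c g = 0 := by
      have := s.eval_eq (z := 0) (by simp) g
      rw [hg 0 (by simp)] at this
      simpa using this.symm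
    have hne : ∀ z : ℂ, ‖z‖ < 1 → z ≠ 0 → s.eval z (s.L g) = 0 := by
      intro z hz hz0
      have := s.eval_eq hz g
      rw [hg z hz, hg0, zero_add] at this
      exact (mul_eq_zero.1 this.symm).resolve_left hz0
    refine ⟨hg0, fun z hz => ?_⟩
    by_cases hz0 : z = 0
    · subst hz0
      have hc : ContinuousAt (fun z => s.eval z (s.L g)) 0 :=
        ((ContinuousLinearMap.apply ℂ ℂ (s.L g)).continuous.continuousAt).comp
          (s.analyticAt_eval (by simp)).continuousAt
      have h1 : Tendsto (fun z => s.eval z (s.L g)) (𝓝[≠] 0) (𝓝 (s.eval 0 (s.L g))) :=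
        hc.tendsto.mono_left nhdsWithin_le_nhds
      refine tendsto_nhds_unique h1 (tendsto_const_nhds.congr' ?_)
      have hb : ∀ᶠ z : ℂ in 𝓝[≠] 0, ‖z‖ < 1 :=
        nhdsWithin_le_nhds ((continuous_norm.tendsto' (0 : ℂ) 0 norm_zero).eventually
          (gt_mem_nhds one_pos))
      filter_upwards [hb, self_mem_nhdsWithin] with z hz hz0
      exact (hne z hz hz0).symm
    · exact hne z hz hz0
  have h2 : ∀ k, ∀ z : ℂ, ‖z‖ < 1 → s.eval z ((s.L ^ k) h) = 0 := by
    intro k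
    induction k with
    | zero => simpa using h0
    | succ k ih => rw [pow_succ']; exact (key _ ih).2
  exact s.eq_zero h fun k => (key _ (h2 k)).1

theorem operator_eq_of_eval {M M' : H →L[ℂ] H}
    (h : ∀ z : ℂ, ‖z‖ < 1 → s.eval z ∘L M = s.eval z ∘L M') : M = M' := by
  ext1 x
  refine sub_eq_zero.1 (s.eq_zero_of_eval fun z hz => ?_)
  have := congrArg (fun u => u x) (h z hz)
  simp only [ContinuousLinearMap.comp_apply] at this
  rw [map_sub, this, sub_self]

end ShiftSystem

end Shift

/-! ### Weierstrass division for analytic functions -/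

/-- If `b a = 1`, then `a b` is idempotent, and the element `a v b + (1 - a b)` acts as `v` on the
image of `a b` and as the identity on a complement. -/
theorem isUnit_conj_add_one_sub {R : Type*} [Ring R] {a b v : R} (hba : b * a = 1) (hv : IsUnit v) :
    IsUnit (a * v * b + (1 - a * b)) := by
  have key : ∀ v w : R, v * w = 1 → (a * v * b + (1 - a * b)) * (a * w * b + (1 - a * b)) = 1 := by
    intro v w h
    have e : (a * v * b + (1 - a * b)) * (a * w * b + (1 - a * b)) =
        a * v * (b * a) * w * b + a * v * b - a * v * (b * a) * b + a * w * b - a * (b * a) * w * b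
        + 1 - a * b - a * b + a * (b * a) * b := by noncomm_ring
    rw [e, hba]
    have : a * v * 1 * w * b = a * (v * w) * b := by noncomm_ring
    rw [this, h]; noncomm_ring
  obtain ⟨u, rfl⟩ := hv
  exact ⟨⟨_, _, key _ _ u.mul_inv, key _ _ u.inv_mul⟩, rfl⟩

theorem analyticAt_clm_apply {X E F : Type*} [NormedAddCommGroup X] [NormedSpace ℂ X]
    [NormedAddCommGroup E] [NormedSpace ℂ E] [NormedAddCommGroup F] [NormedSpace ℂ F]
    {A : X → E →L[ℂ] F} {b : X → E} {x : X} (hA : AnalyticAt ℂ A x) (hb : AnalyticAt ℂ b x) :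
    AnalyticAt ℂ (fun y => A y (b y)) x :=
  AnalyticAt.comp (g := fun y : (E →L[ℂ] F) × E => y.1 y.2) (f := fun y => (A y, b y))
    ((ContinuousLinearMap.id ℂ (E →L[ℂ] F)).analyticAt_bilinear (A x, b x)) (hA.prod hb)

section Division

variable {n N : ℕ} {H : Type*} [NormedAddCommGroup H] [NormedSpace ℂ H] (s : ShiftSystem H)

/-- The tuple of operators `ψ(x) + ρ v S`, with `S` the multiplication by the variable: the point
`ψ(x) + ρ z v` of `ℂᴺ`, as a function of `z`. -/
def opPoint (ψ : Cn n →L[ℂ] Cn N) (v : Cn N) (ρ : ℂ) (x : Cn n) :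
    Fin N → H →L[ℂ] H :=
  fun i => ψ x i • 1 + (ρ * v i) • s.R

theorem eval_comp_opPoint [CompleteSpace H] (ψ : Cn n →L[ℂ] Cn N) (v : Cn N) (ρ : ℂ) (x : Cn n)
    {z : ℂ} (hz : ‖z‖ < 1) (i : Fin N) :
    s.eval z ∘L opPoint s ψ v ρ x i = (ψ x + (ρ * z) • v) i • s.eval z := by
  ext h
  simp only [opPoint, ContinuousLinearMap.comp_apply, add_apply, smul_apply, map_add, map_smul,
    one_apply_eq_self, s.eval_R hz, smul_eq_mul, Pi.add_apply, Pi.smul_apply]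
  ring

theorem continuous_opPoint (ψ : Cn n →L[ℂ] Cn N) (v : Cn N) :
    Continuous fun y : ℂ × Cn n => opPoint s ψ v y.1 y.2 := by
  refine continuous_pi fun i => ?_
  have h1 : Continuous fun y : ℂ × Cn n => ψ y.2 i :=
    (continuous_apply i).comp (ψ.continuous.comp continuous_snd)
  exact (h1.smul continuous_const).add ((continuous_fst.mul continuous_const).smul continuous_const)

theorem analyticAt_opPoint (ψ : Cn n →L[ℂ] Cn N) (v : Cn N) (ρ : ℂ) (x : Cn n) :
    AnalyticAt ℂ (opPoint s ψ v ρ) x := by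
  refine analyticAt_pi_iff.2 fun i => ?_
  have h1 : AnalyticAt ℂ (fun x => ψ x i) x :=
    ((ContinuousLinearMap.proj (R := ℂ) (φ := fun _ : Fin N => ℂ) i).comp ψ).analyticAt x
  exact (h1.smul analyticAt_const).add analyticAt_const

variable [CompleteSpace H] [Nontrivial H]

/-- `M` is an analytic family of operators that represents the multiplication by
`z ↦ f(ψ(x) + ρ z v)`. -/
structure IsMulFamily (ψ : Cn n →L[ℂ] Cn N) (v : Cn N) (f : Cn N → ℂ) (ρ : ℂ)
    (M : Cn n → H →L[ℂ] H) : Prop where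
  analytic : AnalyticAt ℂ M 0
  eigen : ∀ᶠ x in 𝓝 0, ∀ z : ℂ, ‖z‖ < 1 →
    s.eval z ∘L M x = f (ψ x + (ρ * z) • v) • s.eval z

theorem exists_mulFamily (ψ : Cn n →L[ℂ] Cn N) (v : Cn N) {f : Cn N → ℂ}
    (hf : AnalyticAt ℂ f 0) : ∀ᶠ ρ in 𝓝 (0 : ℂ), ∃ M, IsMulFamily s ψ v f ρ M := by
  obtain ⟨F, hF, hev⟩ := exists_operatorCalculus (H := H) hf
  have h0 : opPoint s ψ v 0 0 = 0 := by funext i; simp [opPoint]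
  have hc : Tendsto (fun y : ℂ × Cn n => opPoint s ψ v y.1 y.2) (𝓝 0 ×ˢ 𝓝 0) (𝓝 0) := by
    rw [← nhds_prod_eq]
    exact (continuous_opPoint s ψ v).tendsto' (0, 0) 0 h0
  have hall := (hc.eventually (hF.eventually_analyticAt.and hev)).curry
  filter_upwards [hall] with ρ hρ
  refine ⟨fun x => F (opPoint s ψ v ρ x), ?_, ?_⟩
  · exact hρ.self_of_nhds.1.comp (analyticAt_opPoint s ψ v ρ 0)
  · filter_upwards [hρ] with x hx z hz
    exact hx.2 _ _ fun i => eval_comp_opPoint s ψ v ρ x hz i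

/-- If the restriction of `f` to the line through `v` has order `d`, then the operator
`h ↦ f · T^d h + (1 - S^d T^d) h`, which collects quotient and remainder of a division by `f`, is
invertible at the centre. -/
theorem isUnit_division_operator (ψ : Cn n →L[ℂ] Cn N) (v : Cn N) {f : Cn N → ℂ}
    (hf : AnalyticAt ℂ f 0) {d : ℕ} (hd : analyticOrderAt (fun t : ℂ => f (t • v)) 0 = d) :
    ∀ᶠ ρ in 𝓝[≠] (0 : ℂ), ∀ M, IsMulFamily s ψ v f ρ M →
      IsUnit (M 0 * s.L ^ d + (1 - s.R ^ d * s.L ^ d)) := by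
  have hline : AnalyticAt ℂ (fun t : ℂ => f (t • v)) 0 := by
    refine AnalyticAt.comp (g := f) (by simpa using hf) ?_
    exact analyticAt_id.smul analyticAt_const
  obtain ⟨u, hu, hu0, hfu⟩ := hline.analyticOrderAt_eq_natCast.1 hd
  have hu' : AnalyticAt ℂ (fun y : Cn 1 => u (y 0)) 0 :=
    AnalyticAt.comp (g := u) (by simpa using hu)
      ((ContinuousLinearMap.proj (R := ℂ) (φ := fun _ : Fin 1 => ℂ) 0).analyticAt 0)
  obtain ⟨F, hF, hev⟩ := exists_operatorCalculus (H := H) hu'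
  have hF0 : F 0 = u 0 • 1 := by
    refine s.operator_eq_of_eval fun z hz => ?_
    rw [hev.self_of_nhds (s.eval z) 0 fun i => by ext; simp]
    ext; simp
  have hcont : Tendsto (fun ρ : ℂ => (fun _ : Fin 1 => ρ • s.R)) (𝓝 0) (𝓝 0) := by
    refine Continuous.tendsto' ?_ _ _ (by funext; simp)
    exact continuous_pi fun _ => continuous_id.smul continuous_const
  have hunit : ∀ᶠ y in 𝓝 (0 : Fin 1 → H →L[ℂ] H), IsUnit (F y) := by
    refine hF.continuousAt.eventually (Units.isOpen.mem_nhds ?_)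
    change IsUnit (F 0)
    rw [hF0]
    exact isUnit_one.smul (Units.mk0 _ hu0)
  obtain ⟨ε, hε, hb⟩ := Metric.eventually_nhds_iff.1 hfu
  have hsmall : ∀ᶠ ρ : ℂ in 𝓝 0, ‖ρ‖ < ε :=
    (continuous_norm.tendsto' (0 : ℂ) 0 norm_zero).eventually (gt_mem_nhds hε)
  filter_upwards [nhdsWithin_le_nhds (hcont.eventually (hev.and hunit)),
    nhdsWithin_le_nhds hsmall, self_mem_nhdsWithin] with ρ hρ hρs hρ0 M hM
  set U := F fun _ : Fin 1 => ρ • s.R with hU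
  -- on the line, `f = t ^ d u` with `u` a unit, and the variable is scaled by `ρ`
  have hM0 : M 0 = s.R ^ d * (ρ ^ d • U) := by
    refine s.operator_eq_of_eval fun z hz => ?_
    have hz1 : ‖ρ * z‖ < ε := by
      rw [norm_mul]
      exact (mul_le_of_le_one_right (norm_nonneg _) hz.le).trans_lt hρs
    rw [hM.eigen.self_of_nhds z hz, map_zero, zero_add, hb (by simpa using hz1)]
    have h1 := hρ.1 (s.eval z) (fun _ => ρ * z) fun i => by
      ext h; simp [s.eval_R hz, mul_assoc]
    ext h
    have h2 := congrArg (fun w => w h) h1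
    simp only [ContinuousLinearMap.comp_apply, smul_apply, smul_eq_mul, sub_zero,
      mul_apply_eq_comp, map_smul, s.eval_R_pow hz] at h2 ⊢
    rw [h2]; ring
  rw [hM0]
  refine isUnit_conj_add_one_sub (s.L_pow_mul_R_pow d) ?_
  exact hρ.2.smul (Units.mk0 _ (pow_ne_zero d hρ0))

/-- Existence in Weierstrass division. The operator `h ↦ f · T^d h + (1 - S^d T^d) h` is invertible
at the centre, hence at the nearby points, with an inverse depending analytically on the point. Its
preimage `h` of `g` gives the quotient `T^d h`, and the first `d` coefficients of `h` are those of
the remainder. Shrinking the variable by a small `ρ` places the functions on the unit disc. -/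
theorem exists_division_functions_of_shiftSystem (s : ShiftSystem H) (ψ : Cn n →L[ℂ] Cn N)
    (v : Cn N) {f g : Cn N → ℂ} (hf : AnalyticAt ℂ f 0) (hg : AnalyticAt ℂ g 0) {d : ℕ}
    (hd : analyticOrderAt (fun t : ℂ => f (t • v)) 0 = d) :
    ∃ (q : Cn n × ℂ → ℂ) (r : ℕ → Cn n → ℂ), AnalyticAt ℂ q 0 ∧ (∀ k, AnalyticAt ℂ (r k) 0) ∧
      ∀ᶠ y in 𝓝 (0 : Cn n × ℂ), g (ψ y.1 + y.2 • v) =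
        q y * f (ψ y.1 + y.2 • v) + ∑ k ∈ Finset.range d, r k y.1 * y.2 ^ k := by
  obtain ⟨ρ, hρ, hρ0, ⟨M, hM⟩, ⟨G, hG⟩⟩ := ((isUnit_division_operator s ψ v hf hd).and
    (eventually_mem_nhdsWithin.and (nhdsWithin_le_nhds
      ((exists_mulFamily s ψ v hf).and (exists_mulFamily s ψ v hg))))).exists
  have hρ0 : ρ ≠ 0 := hρ0
  set L : Cn n → H →L[ℂ] H :=
    fun x => M x * s.L ^ d + (1 - s.R ^ d * s.L ^ d) with hLdef
  have hL : AnalyticAt ℂ L 0 := (hM.analytic.mul analyticAt_const).add analyticAt_const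
  have hL0 : IsUnit (L 0) := hρ M hM
  have hLinv : AnalyticAt ℂ (fun x => Ring.inverse (L x)) 0 :=
    AnalyticAt.comp (g := Ring.inverse) (analyticAt_inverse hL0.unit) hL
  set h : Cn n → H := fun x => Ring.inverse (L x) (G x s.e) with hh
  have hha : AnalyticAt ℂ h 0 := by
    refine analyticAt_clm_apply hLinv ?_
    exact ((ContinuousLinearMap.apply ℂ H s.e).analyticAt _).comp hG.analytic
  have hLunit : ∀ᶠ x in 𝓝 0, IsUnit (L x) := hL.continuousAt.eventually (Units.isOpen.mem_nhds hL0)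
  refine ⟨fun y => s.eval (ρ⁻¹ * y.2) ((s.L ^ d) (h y.1)),
    fun k x => s.c ((s.L ^ k) (h x)) * ρ⁻¹ ^ k, ?_, ?_, ?_⟩
  · refine analyticAt_clm_apply ?_ ?_
    · refine AnalyticAt.comp (g := s.eval) (s.analyticAt_eval (by simp)) ?_
      exact analyticAt_const.mul analyticAt_snd
    · refine ((s.L ^ d).analyticAt _).comp (AnalyticAt.comp (g := h) hha analyticAt_fst)
  · intro k
    refine AnalyticAt.mul ?_ analyticAt_const
    exact ((s.c ∘L s.L ^ k).analyticAt _).comp hha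
  · have h1 : ∀ᶠ y in 𝓝 (0 : Cn n × ℂ), IsUnit (L y.1) ∧
        (∀ z : ℂ, ‖z‖ < 1 → s.eval z ∘L M y.1 = f (ψ y.1 + (ρ * z) • v) • s.eval z) ∧
        (∀ z : ℂ, ‖z‖ < 1 → s.eval z ∘L G y.1 = g (ψ y.1 + (ρ * z) • v) • s.eval z) :=
      (continuous_fst.tendsto' (0 : Cn n × ℂ) 0 rfl).eventually
        (hLunit.and (hM.eigen.and hG.eigen))
    have h2 : ∀ᶠ y in 𝓝 (0 : Cn n × ℂ), ‖ρ⁻¹ * y.2‖ < 1 :=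
      ((continuous_norm.comp (continuous_const.mul continuous_snd)).tendsto'
        (0 : Cn n × ℂ) 0 (by simp)).eventually (gt_mem_nhds one_pos)
    filter_upwards [h1, h2] with y ⟨hu, hMy, hGy⟩ hy
    have e1 : L y.1 (h y.1) = G y.1 s.e := by
      rw [hh]
      exact congrArg (fun w => w (G y.1 s.e)) (Ring.mul_inverse_cancel _ hu)
    have e2 := congrArg (s.eval (ρ⁻¹ * y.2)) e1
    have e3 := congrArg (fun w => w ((s.L ^ d) (h y.1))) (hMy _ hy)
    have e4 := congrArg (fun w => w s.e) (hGy _ hy)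
    have e5 := s.eval_eq_sum hy d (h y.1)
    simp only [hLdef, add_apply, sub_apply, mul_apply_eq_comp,
      one_apply_eq_self, map_add, map_sub, s.eval_R_pow hy,
      ContinuousLinearMap.comp_apply, smul_apply, smul_eq_mul, s.eval_e hy,
      mul_inv_cancel_left₀ hρ0, mul_one] at e2 e3 e4
    rw [e3, e4, e5] at e2
    rw [← e2, mul_comm (s.eval _ _)]
    simp only [mul_pow, mul_assoc]
    ring

/-- Uniqueness in Weierstrass division: if `q f + ∑ r_k t^k = 0`, then `S^d q + ∑ r_k t^k` is in the
kernel of the invertible operator `h ↦ f · T^d h + (1 - S^d T^d) h`. -/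
theorem division_functions_unique_of_shiftSystem (s : ShiftSystem H) (ψ : Cn n →L[ℂ] Cn N)
    (v : Cn N) {f q : Cn N → ℂ} (hf : AnalyticAt ℂ f 0) (hq : AnalyticAt ℂ q 0) {d : ℕ}
    (hd : analyticOrderAt (fun t : ℂ => f (t • v)) 0 = d) (r : ℕ → Cn n → ℂ)
    (h0 : ∀ᶠ y in 𝓝 (0 : Cn n × ℂ),
      q (ψ y.1 + y.2 • v) * f (ψ y.1 + y.2 • v) + ∑ k ∈ Finset.range d, r k y.1 * y.2 ^ k = 0) :
    (∀ᶠ y in 𝓝 (0 : Cn n × ℂ), q (ψ y.1 + y.2 • v) = 0) ∧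
      ∀ᶠ x in 𝓝 (0 : Cn n), ∀ k < d, r k x = 0 := by
  have h0' := h0
  rw [show (0 : Cn n × ℂ) = (0, 0) from rfl, nhds_prod_eq] at h0'
  obtain ⟨pa, hpa, pb, hpb, hab⟩ := eventually_prod_iff.1 h0'
  obtain ⟨ε, hε, hb⟩ := Metric.eventually_nhds_iff.1 hpb
  have hsmall : ∀ᶠ ρ : ℂ in 𝓝 0, ‖ρ‖ < ε :=
    (continuous_norm.tendsto' (0 : ℂ) 0 norm_zero).eventually (gt_mem_nhds hε)
  obtain ⟨ρ, hρ, hρ0, ⟨⟨M, hM⟩, ⟨Q, hQ⟩⟩, hρs⟩ := ((isUnit_division_operator s ψ v hf hd).and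
    (eventually_mem_nhdsWithin.and (nhdsWithin_le_nhds
      (((exists_mulFamily s ψ v hf).and (exists_mulFamily s ψ v hq)).and hsmall)))).exists
  have hρ0 : ρ ≠ 0 := hρ0
  set L : Cn n → H →L[ℂ] H :=
    fun x => M x * s.L ^ d + (1 - s.R ^ d * s.L ^ d) with hLdef
  have hL : AnalyticAt ℂ L 0 := (hM.analytic.mul analyticAt_const).add analyticAt_const
  have hLunit : ∀ᶠ x in 𝓝 0, IsUnit (L x) :=
    hL.continuousAt.eventually (Units.isOpen.mem_nhds (hρ M hM))
  have hTS : ∀ h : H, (s.L ^ d) ((s.R ^ d) h) = h := fun h =>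
    congrArg (fun u => u h) (s.L_pow_mul_R_pow d)
  have main : ∀ᶠ x in 𝓝 (0 : Cn n), Q x s.e = 0 ∧ ∀ k < d, r k x = 0 := by
    filter_upwards [hLunit, hM.eigen, hQ.eigen, hpa] with x hu hMx hQx hx
    set R : H := ∑ k ∈ Finset.range d, (r k x * ρ ^ k) • (s.R ^ k) s.e with hR
    have hTR : (s.L ^ d) R = 0 := by
      rw [hR, map_sum]
      refine Finset.sum_eq_zero fun k hk => ?_
      obtain ⟨j, rfl⟩ := Nat.exists_eq_add_of_lt (Finset.mem_range.1 hk)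
      have : s.L ^ (k + j + 1) * s.R ^ k = s.L ^ (j + 1) := by
        rw [show k + j + 1 = (j + 1) + k by ring, pow_add, mul_assoc, s.L_pow_mul_R_pow,
          mul_one]
      have h2 := congrArg (fun u => u s.e) this
      simp only [mul_apply_eq_comp] at h2
      rw [map_smul, h2, pow_succ, mul_apply_eq_comp, s.L_e, map_zero,
        smul_zero]
    have hevR : ∀ z : ℂ, ‖z‖ < 1 → s.eval z R = ∑ k ∈ Finset.range d, r k x * (ρ * z) ^ k := by
      intro z hz
      rw [hR, map_sum]
      refine Finset.sum_congr rfl fun k _ => ?_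
      rw [map_smul, s.eval_R_pow hz, s.eval_e hz, mul_pow, smul_eq_mul]; ring
    set w : H := (s.R ^ d) (Q x s.e) + R with hw
    have hTw : (s.L ^ d) w = Q x s.e := by rw [hw, map_add, hTS, hTR, add_zero]
    have hLw : L x w = M x (Q x s.e) + R := by
      simp only [hLdef, add_apply, sub_apply, mul_apply_eq_comp,
        one_apply_eq_self, hTw]
      rw [hw]; abel
    have hLw0 : L x w = 0 := by
      rw [hLw]
      refine s.eq_zero_of_eval fun z hz => ?_
      have hz1 : ‖ρ * z‖ < ε := by
        rw [norm_mul]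
        exact (mul_le_of_le_one_right (norm_nonneg _) hz.le).trans_lt hρs
      have e1 := congrArg (fun u => u (Q x s.e)) (hMx z hz)
      have e2 := congrArg (fun u => u s.e) (hQx z hz)
      simp only [ContinuousLinearMap.comp_apply, smul_apply, smul_eq_mul, s.eval_e hz,
        mul_one] at e1 e2
      have e3 := hab hx (hb (y := ρ * z) (by simpa using hz1))
      rw [map_add, e1, e2, hevR z hz, ← e3, mul_comm]
    have hw0 : w = 0 := by
      have := congrArg (fun u => u w) (Ring.inverse_mul_cancel _ hu)
      simp only [mul_apply_eq_comp, hLw0, map_zero,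
        one_apply_eq_self] at this
      exact this.symm
    have hQ0 : Q x s.e = 0 := by rw [← hTw, hw0, map_zero]
    refine ⟨hQ0, fun k hk => ?_⟩
    have hR0 : R = 0 := by rw [hw, hQ0, map_zero, zero_add] at hw0; exact hw0
    have h3 := congrArg (fun u => s.c ((s.L ^ k) u)) hR0
    simp only [hR, map_sum, map_smul, s.coeff_R_pow_e, smul_eq_mul, map_zero, mul_ite, mul_one,
      mul_zero] at h3
    rw [Finset.sum_ite_eq' _ k, if_pos (Finset.mem_range.2 hk)] at h3
    exact (mul_eq_zero.1 h3).resolve_right (pow_ne_zero _ hρ0)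
  refine ⟨?_, main.mono fun _ h => h.2⟩
  have h1 : ∀ᶠ y in 𝓝 (0 : Cn n × ℂ), Q y.1 s.e = 0 ∧
      (∀ z : ℂ, ‖z‖ < 1 → s.eval z ∘L Q y.1 = q (ψ y.1 + (ρ * z) • v) • s.eval z) :=
    (continuous_fst.tendsto' (0 : Cn n × ℂ) 0 rfl).eventually
      ((main.mono fun _ h => h.1).and hQ.eigen)
  have h2 : ∀ᶠ y in 𝓝 (0 : Cn n × ℂ), ‖ρ⁻¹ * y.2‖ < 1 :=
    ((continuous_norm.comp (continuous_const.mul continuous_snd)).tendsto'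
      (0 : Cn n × ℂ) 0 (by simp)).eventually (gt_mem_nhds one_pos)
  filter_upwards [h1, h2] with y ⟨hy1, hy2⟩ hy
  have e2 := congrArg (fun u => u s.e) (hy2 _ hy)
  simp only [ContinuousLinearMap.comp_apply, smul_apply, smul_eq_mul, s.eval_e hy,
    mul_one, hy1, map_zero, mul_inv_cancel_left₀ hρ0] at e2
  exact e2.symm

end Division

section Unconditional

variable {n N : ℕ}

instance : Nontrivial (BoundedContinuousFunction ℕ ℂ) :=
  ⟨boundedShift.e, 0, fun h => by simpa [h] using boundedShift.c_e⟩

theorem exists_division_functions (ψ : Cn n →L[ℂ] Cn N) (v : Cn N) {f g : Cn N → ℂ}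
    (hf : AnalyticAt ℂ f 0) (hg : AnalyticAt ℂ g 0) {d : ℕ}
    (hd : analyticOrderAt (fun t : ℂ => f (t • v)) 0 = d) :
    ∃ (q : Cn n × ℂ → ℂ) (r : ℕ → Cn n → ℂ), AnalyticAt ℂ q 0 ∧ (∀ k, AnalyticAt ℂ (r k) 0) ∧
      ∀ᶠ y in 𝓝 (0 : Cn n × ℂ), g (ψ y.1 + y.2 • v) =
        q y * f (ψ y.1 + y.2 • v) + ∑ k ∈ Finset.range d, r k y.1 * y.2 ^ k :=
  exists_division_functions_of_shiftSystem boundedShift ψ v hf hg hd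

theorem division_functions_unique (ψ : Cn n →L[ℂ] Cn N) (v : Cn N) {f q : Cn N → ℂ}
    (hf : AnalyticAt ℂ f 0) (hq : AnalyticAt ℂ q 0) {d : ℕ}
    (hd : analyticOrderAt (fun t : ℂ => f (t • v)) 0 = d) (r : ℕ → Cn n → ℂ)
    (h0 : ∀ᶠ y in 𝓝 (0 : Cn n × ℂ),
      q (ψ y.1 + y.2 • v) * f (ψ y.1 + y.2 • v) + ∑ k ∈ Finset.range d, r k y.1 * y.2 ^ k = 0) :
    (∀ᶠ y in 𝓝 (0 : Cn n × ℂ), q (ψ y.1 + y.2 • v) = 0) ∧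
      ∀ᶠ x in 𝓝 (0 : Cn n), ∀ k < d, r k x = 0 :=
  division_functions_unique_of_shiftSystem boundedShift ψ v hf hq hd r h0

end Unconditional

/-! ### Weierstrass division and preparation for germs -/

open Polynomial

section Weierstrass

variable {n : ℕ}

/-- A linear splitting `ℂⁿ⁺¹ ≃ ℂⁿ × ℂ`; the last factor carries the distinguished variable. -/
abbrev Splitting (n : ℕ) : Type := Cn (n + 1) ≃L[ℂ] Cn n × ℂ

/-- The direction in `ℂⁿ⁺¹` of the distinguished variable. -/
def Splitting.dir (Φ : Splitting n) : Cn (n + 1) := Φ.symm (0, 1)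

theorem exists_splitting {v : Cn (n + 1)} (hv : v ≠ 0) : ∃ Φ : Splitting n, Φ.dir = v := by
  have hfr : Module.finrank ℂ (Cn n × ℂ) = Module.finrank ℂ (Cn (n + 1)) := by simp
  let e : (Cn n × ℂ) ≃L[ℂ] Cn (n + 1) := ContinuousLinearEquiv.ofFinrankEq hfr
  have h0 : e (0, 1) ≠ 0 := by simp
  obtain ⟨A, hA⟩ := SeparatingDual.exists_continuousLinearEquiv_apply_eq (R := ℂ) h0 hv
  exact ⟨(e.trans A).symm, by simpa [Splitting.dir] using hA⟩

variable (Φ : Splitting n) (p : Cn (n + 1))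

theorem tendsto_proj : Tendsto (fun x => (Φ x).1) (𝓝 p) (𝓝 (Φ p).1) :=
  (continuous_fst.comp Φ.continuous).tendsto p

theorem analyticAt_proj : AnalyticAt ℂ (fun x => (Φ x).1) p :=
  ((ContinuousLinearMap.fst ℂ (Cn n) ℂ).comp (Φ : Cn (n + 1) →L[ℂ] Cn n × ℂ)).analyticAt p

theorem analyticAt_coord : AnalyticAt ℂ (fun x => (Φ x).2) p :=
  ((ContinuousLinearMap.snd ℂ (Cn n) ℂ).comp (Φ : Cn (n + 1) →L[ℂ] Cn n × ℂ)).analyticAt p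

theorem analyticAt_comp_proj {g : Cn n → ℂ} (hg : AnalyticAt ℂ g (Φ p).1) :
    AnalyticAt ℂ (fun x => g (Φ x).1) p := AnalyticAt.comp (g := g) hg (analyticAt_proj Φ p)

/-- The pull-back of germs along the projection `ℂⁿ⁺¹ → ℂⁿ`. -/
def pullback : Hol (Φ p).1 →+* Hol p where
  toFun φ := toGerm (fun x => rep φ (Φ x).1) (analyticAt_comp_proj Φ p (rep_analyticAt φ))
  map_one' := toGerm_eq_of _ (rep_one.trans
    (EventuallyEq.symm ((tendsto_proj Φ p).eventually rep_one)))
  map_zero' := toGerm_eq_of _ (rep_zero.trans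
    (EventuallyEq.symm ((tendsto_proj Φ p).eventually rep_zero)))
  map_add' a b := toGerm_eq_of _ <| by
    filter_upwards [rep_add (toGerm _ (analyticAt_comp_proj Φ p (rep_analyticAt a)))
      (toGerm _ (analyticAt_comp_proj Φ p (rep_analyticAt b))),
      rep_toGerm _ (analyticAt_comp_proj Φ p (rep_analyticAt a)),
      rep_toGerm _ (analyticAt_comp_proj Φ p (rep_analyticAt b)),
      (tendsto_proj Φ p).eventually (rep_add a b)] with x h1 h2 h3 h4
    rw [h1, h2, h3, h4]
  map_mul' a b := toGerm_eq_of _ <| by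
    filter_upwards [rep_mul (toGerm _ (analyticAt_comp_proj Φ p (rep_analyticAt a)))
      (toGerm _ (analyticAt_comp_proj Φ p (rep_analyticAt b))),
      rep_toGerm _ (analyticAt_comp_proj Φ p (rep_analyticAt a)),
      rep_toGerm _ (analyticAt_comp_proj Φ p (rep_analyticAt b)),
      (tendsto_proj Φ p).eventually (rep_mul a b)] with x h1 h2 h3 h4
    rw [h1, h2, h3, h4]

theorem rep_pullback (φ : Hol (Φ p).1) : rep (pullback Φ p φ) =ᶠ[𝓝 p] fun x => rep φ (Φ x).1 :=
  rep_toGerm _ (analyticAt_comp_proj Φ p (rep_analyticAt φ))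

theorem pullback_const (c : ℂ) : pullback Φ p (constGerm _ c) = constGerm p c :=
  hol_ext <| (rep_pullback Φ p _).trans
    (EventuallyEq.trans ((tendsto_proj Φ p).eventually (rep_const c)) (rep_const c).symm)

theorem ev_pullback (φ : Hol (Φ p).1) : ev p (pullback Φ p φ) = ev _ φ :=
  (rep_pullback Φ p φ).self_of_nhds

/-- The distinguished variable, as a germ. -/
def coordGerm : Hol p := toGerm (fun x => (Φ x).2) (analyticAt_coord Φ p)

theorem rep_coordGerm : rep (coordGerm Φ p) =ᶠ[𝓝 p] fun x => (Φ x).2 :=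
  rep_toGerm _ (analyticAt_coord Φ p)

theorem ev_coordGerm : ev p (coordGerm Φ p) = (Φ p).2 := (rep_coordGerm Φ p).self_of_nhds

/-- The germ on `ℂⁿ⁺¹` of a polynomial in the distinguished variable whose coefficients are germs
on `ℂⁿ`. -/
def polyGerm : (Hol (Φ p).1)[X] →+* Hol p := eval₂RingHom (pullback Φ p) (coordGerm Φ p)

theorem polyGerm_apply (r : (Hol (Φ p).1)[X]) :
    polyGerm Φ p r = r.eval₂ (pullback Φ p) (coordGerm Φ p) := rfl

@[simp] theorem polyGerm_C (a : Hol (Φ p).1) : polyGerm Φ p (C a) = pullback Φ p a := by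
  simp [polyGerm]

@[simp] theorem polyGerm_X : polyGerm Φ p X = coordGerm Φ p := by simp [polyGerm]

/-- The polynomial whose coefficients are the germs at `y` of the coefficients of `r`. -/
def germPolyAt {q : Cn n} (r : (Hol q)[X]) (y : Cn n) : (Hol y)[X] :=
  ∑ k ∈ Finset.range (r.natDegree + 1), monomial k (germAt (r.coeff k) y)

theorem coeff_germPolyAt {q : Cn n} (r : (Hol q)[X]) :
    ∀ᶠ y in 𝓝 q, ∀ k, (germPolyAt r y).coeff k = germAt (r.coeff k) y := by
  filter_upwards [germAt_zero (p := q)] with y hy k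
  simp only [germPolyAt, finsetSum_coeff, coeff_monomial]
  rw [Finset.sum_ite_eq' _ k]
  split_ifs with h
  · rfl
  · rw [coeff_eq_zero_of_natDegree_lt (by simpa using h), hy]

theorem germPolyAt_self {q : Cn n} (r : (Hol q)[X]) : germPolyAt r q = r := by
  ext1 k; rw [(coeff_germPolyAt r).self_of_nhds k, germAt_self]

theorem natDegree_germPolyAt_le {q : Cn n} (r : (Hol q)[X]) (y : Cn n) :
    (germPolyAt r y).natDegree ≤ r.natDegree :=
  natDegree_sum_le_of_forall_le _ _ fun _ hk =>
    (natDegree_monomial_le _).trans (Finset.mem_range_succ_iff.1 hk)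

theorem germPolyAt_monic {q : Cn n} {r : (Hol q)[X]} (hr : r.Monic) :
    ∀ᶠ y in 𝓝 q, (germPolyAt r y).Monic ∧ (germPolyAt r y).natDegree = r.natDegree := by
  filter_upwards [coeff_germPolyAt r, germAt_one (p := q)] with y hy h1
  have hc : (germPolyAt r y).coeff r.natDegree = 1 := by
    rw [hy, coeff_natDegree, hr.leadingCoeff, h1]
  have hd : (germPolyAt r y).natDegree = r.natDegree :=
    le_antisymm (natDegree_germPolyAt_le r y)
      (le_natDegree_of_ne_zero (by rw [hc]; exact one_ne_zero))
  exact ⟨by rw [Monic, leadingCoeff, hd, hc], hd⟩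

variable {p}

theorem germAt_pullback (φ : Hol (Φ p).1) :
    ∀ᶠ x in 𝓝 p, germAt (pullback Φ p φ) x = pullback Φ x (germAt φ (Φ x).1) := by
  refine germAt_eq_of_eventuallyEq (rep_pullback Φ p φ) ?_
  filter_upwards [(tendsto_proj Φ p).eventually (eventually_rep_germAt φ)] with x hx
  exact (rep_pullback Φ x _).trans ((tendsto_proj Φ x).eventually hx)

theorem germAt_coordGerm : ∀ᶠ x in 𝓝 p, germAt (coordGerm Φ p) x = coordGerm Φ x :=
  germAt_eq_of_eventuallyEq (rep_coordGerm Φ p) (Eventually.of_forall fun x => rep_coordGerm Φ x)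

theorem germAt_polyGerm (r : (Hol (Φ p).1)[X]) :
    ∀ᶠ x in 𝓝 p, germAt (polyGerm Φ p r) x = polyGerm Φ x (germPolyAt r (Φ x).1) := by
  have hr : polyGerm Φ p r = ∑ k ∈ Finset.range (r.natDegree + 1),
      pullback Φ p (r.coeff k) * coordGerm Φ p ^ k := by
    rw [polyGerm_apply, eval₂_eq_sum_range]
  rw [hr]
  have h : ∀ k ∈ Finset.range (r.natDegree + 1), ∀ᶠ x in 𝓝 p,
      germAt (pullback Φ p (r.coeff k) * coordGerm Φ p ^ k) x =
        pullback Φ x (germAt (r.coeff k) (Φ x).1) * coordGerm Φ x ^ k := by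
    intro k _
    filter_upwards [germAt_mul (pullback Φ p (r.coeff k)) (coordGerm Φ p ^ k),
      germAt_pow (coordGerm Φ p) k, germAt_coordGerm Φ (p := p), germAt_pullback Φ (r.coeff k)]
      with x h1 h2 h3 h4
    rw [h1, h2, h3, h4]
  filter_upwards [germAt_sum (Finset.range (r.natDegree + 1)) fun k =>
      pullback Φ p (r.coeff k) * coordGerm Φ p ^ k,
    (eventually_all_finset _).2 h] with x h1 h2
  rw [h1, germPolyAt, map_sum]
  refine Finset.sum_congr rfl fun k hk => ?_
  rw [h2 k hk, ← C_mul_X_pow_eq_monomial]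
  simp

theorem ev_polyGerm (r : (Hol (Φ p).1)[X]) :
    ev p (polyGerm Φ p r) = (r.map (ev _)).eval (Φ p).2 := by
  rw [polyGerm_apply, hom_eval₂, ev_coordGerm, eval_map]
  congr 1
  ext φ; exact ev_pullback Φ p φ

/-- The values near `p` of the germ of a polynomial. -/
theorem rep_polyGerm (r : (Hol (Φ p).1)[X]) :
    ∀ᶠ x in 𝓝 p, rep (polyGerm Φ p r) x =
      ((germPolyAt r (Φ x).1).map (ev _)).eval (Φ x).2 := by
  filter_upwards [germAt_polyGerm Φ r, ev_germAt (polyGerm Φ p r)] with x h1 h2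
  rw [← h2, h1, ev_polyGerm]

/-- The order at `p` of the restriction of a germ to the line through `p` in the direction of the
distinguished variable. -/
def orderAlong (f : Hol p) : ℕ∞ := analyticOrderAt (fun t : ℂ => rep f (p + t • Φ.dir)) 0

theorem tendsto_line (p : Cn (n + 1)) (v : Cn (n + 1)) :
    Tendsto (fun t : ℂ => p + t • v) (𝓝 0) (𝓝 p) :=
  (continuous_const.add (continuous_id.smul continuous_const)).tendsto' _ _ (by simp)

theorem analyticAt_line (f : Hol p) (v : Cn (n + 1)) :
    AnalyticAt ℂ (fun t : ℂ => rep f (p + t • v)) 0 := by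
  refine AnalyticAt.comp (g := rep f) (by simpa using rep_analyticAt f) ?_
  exact analyticAt_const.add (analyticAt_id.smul analyticAt_const)

theorem map_add_dir (x : Cn (n + 1)) (t : ℂ) : Φ (x + t • Φ.dir) = ((Φ x).1, (Φ x).2 + t) := by
  simp [Splitting.dir, map_add, Prod.ext_iff]

theorem orderAlong_mul (f g : Hol p) : orderAlong Φ (f * g) = orderAlong Φ f + orderAlong Φ g := by
  rw [orderAlong, orderAlong, orderAlong, ← analyticOrderAt_mul (analyticAt_line f _)
    (analyticAt_line g _)]
  exact analyticOrderAt_congr ((tendsto_line p _).eventually (rep_mul f g))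

theorem orderAlong_eq_zero_iff {f : Hol p} : orderAlong Φ f = 0 ↔ ev p f ≠ 0 := by
  rw [orderAlong, (analyticAt_line f _).analyticOrderAt_eq_zero]
  simp [ev_apply]

theorem rep_polyGerm_line (r : (Hol (Φ p).1)[X]) :
    ∀ᶠ t : ℂ in 𝓝 0, rep (polyGerm Φ p r) (p + t • Φ.dir) =
      (r.map (ev _)).eval ((Φ p).2 + t) := by
  filter_upwards [(tendsto_line p Φ.dir).eventually (rep_polyGerm Φ r)] with t ht
  rw [ht, map_add_dir]
  simp only [germPolyAt_self]

/-- A complex polynomial with zeros accumulating at a point is zero. -/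
theorem eq_zero_of_frequently_eval {P : ℂ[X]} {c : ℂ}
    (h : ∃ᶠ t : ℂ in 𝓝[≠] 0, P.eval (c + t) = 0) : P = 0 := by
  by_contra hP
  have h1 : ∀ᶠ t : ℂ in 𝓝[≠] 0, P.eval (c + t) ≠ 0 := by
    have hf : {t : ℂ | P.eval (c + t) = 0}.Finite := by
      refine Set.Finite.of_finite_image (f := fun t => c + t) ?_ (add_right_injective c).injOn
      refine (P.roots.toFinset.finite_toSet).subset ?_
      rintro _ ⟨t, ht, rfl⟩
      simpa [hP] using ht
    have h2 : ({t : ℂ | P.eval (c + t) = 0} \ {0})ᶜ ∈ 𝓝 (0 : ℂ) :=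
      (hf.subset Set.sdiff_subset).isClosed.isOpen_compl.mem_nhds (by simp)
    filter_upwards [nhdsWithin_le_nhds h2, self_mem_nhdsWithin] with t ht ht0 h3
    exact ht ⟨h3, ht0⟩
  exact h h1

theorem orderAlong_polyGerm_ne_top {w : (Hol (Φ p).1)[X]} (hw : w.map (ev _) ≠ 0) :
    orderAlong Φ (polyGerm Φ p w) ≠ ⊤ := by
  intro h
  rw [orderAlong, analyticOrderAt_eq_top] at h
  refine hw (eq_zero_of_frequently_eval (c := (Φ p).2) ?_)
  refine Eventually.frequently (nhdsWithin_le_nhds ?_)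
  filter_upwards [h, rep_polyGerm_line Φ w] with t h1 h2
  rw [← h2, h1]

/-- Every nonzero germ has finite order along the distinguished variable of some splitting. -/
theorem exists_orderAlong_ne_top {f : Hol p} (hf : f ≠ 0) :
    ∃ Φ : Splitting n, orderAlong Φ f ≠ ⊤ := by
  by_cases h0 : ev p f ≠ 0
  · obtain ⟨Φ, -⟩ := exists_splitting (n := n) (v := fun _ => 1)
      (fun h => one_ne_zero (congrFun h 0))
    exact ⟨Φ, by rw [orderAlong_eq_zero_iff Φ |>.2 h0]; simp⟩
  push Not at h0
  obtain ⟨r, hr, hb⟩ := Metric.eventually_nhds_iff_ball.1 (rep_analyticAt f).eventually_analyticAt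
  obtain ⟨x, hx0, hx⟩ := ((frequently_rep_ne_zero hf).and_eventually
    (Metric.ball_mem_nhds p hr)).exists
  have hv : x - p ≠ 0 := fun h => hx0 (by rw [sub_eq_zero.1 h]; exact h0)
  obtain ⟨Φ, hΦ⟩ := exists_splitting hv
  refine ⟨Φ, fun h => hx0 ?_⟩
  rw [orderAlong, analyticOrderAt_eq_top, hΦ] at h
  have hv' : 0 < ‖x - p‖ := norm_pos_iff.2 hv
  have hmem : ∀ t : ℂ, t ∈ Metric.ball (0 : ℂ) (r / ‖x - p‖) →
      p + t • (x - p) ∈ Metric.ball p r := by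
    intro t ht
    rw [mem_ball_zero_iff, lt_div_iff₀ hv'] at ht
    rwa [mem_ball_iff_norm, add_sub_cancel_left, norm_smul]
  have han : AnalyticOnNhd ℂ (fun t : ℂ => rep f (p + t • (x - p)))
      (Metric.ball (0 : ℂ) (r / ‖x - p‖)) := by
    intro t ht
    refine AnalyticAt.comp (g := rep f) (hb _ (hmem t ht)) ?_
    exact analyticAt_const.add (analyticAt_id.smul analyticAt_const)
  have h1 := han.eqOn_zero_of_preconnected_of_eventuallyEq_zero
    (convex_ball _ _).isPreconnected (z₀ := 0) (by simp; positivity) h (x := 1) (by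
      rw [mem_ball_zero_iff, lt_div_iff₀ hv', norm_one, one_mul]
      rwa [← dist_eq_norm])
  simpa using h1

theorem analyticAt_translate (f : Hol p) : AnalyticAt ℂ (fun y => rep f (p + y)) 0 :=
  AnalyticAt.comp (g := rep f) (by simpa using rep_analyticAt f)
    (analyticAt_const.add analyticAt_id)

theorem eval₂_eq_sum_of_degree_lt {R S : Type*} [CommSemiring R] [CommSemiring S] (i : R →+* S)
    (x : S) {r : R[X]} {d : ℕ} (hr : r.degree < d) :
    r.eval₂ i x = ∑ k ∈ Finset.range d, i (r.coeff k) * x ^ k := by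
  by_cases h0 : r = 0
  · simp [h0]
  · exact eval₂_eq_sum_range' i ((natDegree_lt_iff_degree_lt h0).2 hr) x

variable {Φ}

/-- Weierstrass division: modulo a germ of order `d` in the distinguished variable, every germ is
a polynomial of degree `< d` in this variable. -/
theorem exists_division {f : Hol p} {d : ℕ} (hf : orderAlong Φ f = d) (g : Hol p) :
    ∃ (q : Hol p) (r : (Hol (Φ p).1)[X]), r.degree < d ∧ g = q * f + polyGerm Φ p r := by
  set ψ : Cn n →L[ℂ] Cn (n + 1) :=
    (Φ.symm : Cn n × ℂ →L[ℂ] Cn (n + 1)).comp (ContinuousLinearMap.inl ℂ (Cn n) ℂ) with hψ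
  have hsum : ∀ y : Cn n × ℂ, ψ y.1 + y.2 • Φ.dir = Φ.symm y := by
    intro y
    rw [Splitting.dir, hψ, ← map_smul]
    simp only [ContinuousLinearMap.comp_apply, ContinuousLinearMap.inl_apply]
    rw [ContinuousLinearEquiv.coe_coe, ← map_add]
    simp
  obtain ⟨q, r, hq, hr, h⟩ := exists_division_functions ψ Φ.dir (analyticAt_translate f)
    (analyticAt_translate g) hf
  simp only [hsum] at h
  have hsub : Tendsto (fun x => Φ (x - p)) (𝓝 p) (𝓝 0) :=
    (Φ.continuous.comp (continuous_id.sub continuous_const)).tendsto' _ _ (by simp)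
  have hqa : AnalyticAt ℂ (fun x => q (Φ (x - p))) p := by
    refine AnalyticAt.comp (g := q) (by simpa using hq) ?_
    exact ((Φ : Cn (n + 1) →L[ℂ] Cn n × ℂ).analyticAt _).comp
      (analyticAt_id.sub analyticAt_const)
  have hra : ∀ k, AnalyticAt ℂ (fun y => r k (y - (Φ p).1)) (Φ p).1 := fun k =>
    AnalyticAt.comp (g := r k) (by simpa using hr k) (analyticAt_id.sub analyticAt_const)
  set P : (Hol (Φ p).1)[X] := ∑ k ∈ Finset.range d,
    C (toGerm _ (hra k)) * (X - C (constGerm _ (Φ p).2)) ^ k with hP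
  refine ⟨toGerm _ hqa, P, ?_, hol_ext ?_⟩
  · refine (degree_sum_le _ _).trans_lt ((Finset.sup_lt_iff (WithBot.bot_lt_coe d)).2 ?_)
    intro k hk
    refine (degree_mul_le _ _).trans_lt ((add_le_add_left degree_C_le _).trans_lt ?_)
    rw [zero_add, degree_pow, degree_X_sub_C, nsmul_one]
    exact WithBot.coe_lt_coe.2 (Finset.mem_range.1 hk)
  · have hPg : rep (polyGerm Φ p P) =ᶠ[𝓝 p] fun x =>
        ∑ k ∈ Finset.range d, r k ((Φ x).1 - (Φ p).1) * ((Φ x).2 - (Φ p).2) ^ k := by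
      rw [hP, map_sum]
      refine (rep_sum _ _).trans ?_
      have hk : ∀ k ∈ Finset.range d, ∀ᶠ x in 𝓝 p, rep (polyGerm Φ p (C (toGerm _ (hra k)) *
          (X - C (constGerm _ (Φ p).2)) ^ k)) x =
          r k ((Φ x).1 - (Φ p).1) * ((Φ x).2 - (Φ p).2) ^ k := by
        intro k _
        simp only [map_mul, map_pow, map_sub, polyGerm_C, polyGerm_X, pullback_const]
        filter_upwards [rep_mul (pullback Φ p (toGerm _ (hra k)))
          ((coordGerm Φ p - constGerm p (Φ p).2) ^ k),
          rep_pow (coordGerm Φ p - constGerm p (Φ p).2) k,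
          rep_sub (coordGerm Φ p) (constGerm p (Φ p).2), rep_coordGerm Φ p,
          rep_const (p := p) (Φ p).2, rep_pullback Φ p (toGerm _ (hra k)),
          (tendsto_proj Φ p).eventually (rep_toGerm _ (hra k))] with x h1 h2 h3 h4 h5 h6 h7
        rw [h1, h2, h3, h4, h5, h6, h7]
      filter_upwards [(eventually_all_finset _).2 hk] with x hx
      exact Finset.sum_congr rfl hx
    filter_upwards [hsub.eventually h, rep_add (toGerm _ hqa * f) (polyGerm Φ p P),
      rep_mul (toGerm _ hqa) f, rep_toGerm _ hqa, hPg] with x h1 h2 h3 h4 h5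
    rw [h2, h3, h4, h5]
    simpa using h1

/-- Uniqueness in Weierstrass division. -/
theorem division_unique {f q : Hol p} {d : ℕ} (hf : orderAlong Φ f = d)
    {r : (Hol (Φ p).1)[X]} (hr : r.degree < d) (h : q * f + polyGerm Φ p r = 0) :
    q = 0 ∧ r = 0 := by
  set ψ : Cn n →L[ℂ] Cn (n + 1) :=
    (Φ.symm : Cn n × ℂ →L[ℂ] Cn (n + 1)).comp (ContinuousLinearMap.inl ℂ (Cn n) ℂ) with hψ
  have hsum : ∀ y : Cn n × ℂ, ψ y.1 + y.2 • Φ.dir = Φ.symm y := by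
    intro y
    rw [Splitting.dir, hψ, ← map_smul]
    simp only [ContinuousLinearMap.comp_apply, ContinuousLinearMap.inl_apply]
    rw [ContinuousLinearEquiv.coe_coe, ← map_add]
    simp
  set c := constGerm (Φ p).1 (Φ p).2 with hc
  -- the polynomial is re-expanded in powers of the variable centred at `p`
  set s := taylor c r with hs
  have hsr : polyGerm Φ p r = s.eval₂ (pullback Φ p) (coordGerm Φ p - constGerm p (Φ p).2) := by
    rw [hs, taylor_apply, eval₂_comp, polyGerm_apply]
    simp [hc, pullback_const]
  have hsd : s.degree < d := by rwa [hs, degree_taylor]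
  rw [hsr, eval₂_eq_sum_of_degree_lt _ _ hsd] at h
  have hev : ∀ᶠ x in 𝓝 p, rep q x * rep f x + ∑ k ∈ Finset.range d,
      rep (s.coeff k) (Φ x).1 * ((Φ x).2 - (Φ p).2) ^ k = 0 := by
    have hk : ∀ k ∈ Finset.range d, ∀ᶠ x in 𝓝 p, rep (pullback Φ p (s.coeff k) *
        (coordGerm Φ p - constGerm p (Φ p).2) ^ k) x =
        rep (s.coeff k) (Φ x).1 * ((Φ x).2 - (Φ p).2) ^ k := by
      intro k _
      filter_upwards [rep_mul (pullback Φ p (s.coeff k))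
        ((coordGerm Φ p - constGerm p (Φ p).2) ^ k),
        rep_pow (coordGerm Φ p - constGerm p (Φ p).2) k,
        rep_sub (coordGerm Φ p) (constGerm p (Φ p).2), rep_coordGerm Φ p,
        rep_const (p := p) (Φ p).2, rep_pullback Φ p (s.coeff k)] with x h1 h2 h3 h4 h5 h6
      rw [h1, h2, h3, h4, h5, h6]
    filter_upwards [rep_add (q * f) (∑ k ∈ Finset.range d, pullback Φ p (s.coeff k) *
        (coordGerm Φ p - constGerm p (Φ p).2) ^ k), rep_mul q f, rep_sum (Finset.range d)
        fun k => pullback Φ p (s.coeff k) * (coordGerm Φ p - constGerm p (Φ p).2) ^ k,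
      (eventually_all_finset _).2 hk, rep_zero (p := p)] with x h1 h2 h3 h4 h5
    rw [← Finset.sum_congr rfl h4, ← h3, ← h2, ← h1, h, h5]
  have htr : Tendsto (fun y : Cn n × ℂ => p + Φ.symm y) (𝓝 0) (𝓝 p) :=
    (continuous_const.add Φ.symm.continuous).tendsto' _ _ (by simp)
  obtain ⟨h1, h2⟩ := division_functions_unique ψ Φ.dir (analyticAt_translate f)
    (analyticAt_translate q) hf (fun k y => rep (s.coeff k) ((Φ p).1 + y)) <| by
      filter_upwards [htr.eventually hev] with y hy
      rw [hsum]
      simpa using hy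
  constructor
  · refine hol_ext ?_
    have hsub : Tendsto (fun x => Φ (x - p)) (𝓝 p) (𝓝 0) :=
      (Φ.continuous.comp (continuous_id.sub continuous_const)).tendsto' _ _ (by simp)
    filter_upwards [hsub.eventually h1, rep_zero (p := p)] with x hx h0
    rw [hsum] at hx
    rw [h0]; simpa using hx
  · have hs0 : s = 0 := by
      ext1 k
      by_cases hk : k < d
      · refine hol_ext ?_
        have hsub : Tendsto (fun y => y - (Φ p).1) (𝓝 (Φ p).1) (𝓝 0) :=
          (continuous_id.sub continuous_const).tendsto' _ _ (by simp)
        filter_upwards [hsub.eventually h2, rep_zero (p := (Φ p).1)] with y hy h0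
        rw [coeff_zero, h0]; simpa using hy k hk
      · rw [coeff_zero]
        exact coeff_eq_zero_of_degree_lt (hsd.trans_le (by exact_mod_cast not_lt.1 hk))
    exact (taylor_injective c) (by rw [← hs, hs0, map_zero])

/-- Weierstrass preparation: a germ of order `d` in the distinguished variable is a unit times a
monic polynomial of degree `d`, obtained by dividing the `d`-th power of the variable by the germ.
The last conjunct says that at the base point all roots of this polynomial coincide. -/
theorem exists_preparation {f : Hol p} {d : ℕ} (hf : orderAlong Φ f = d) :
    ∃ (w : (Hol (Φ p).1)[X]) (u : (Hol p)ˣ), w.Monic ∧ w.natDegree = d ∧ f = u * polyGerm Φ p w ∧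
      w.map (ev _) = (X - C (Φ p).2) ^ d := by
  obtain ⟨q, r, hr, h⟩ := exists_division hf ((coordGerm Φ p - constGerm p (Φ p).2) ^ d)
  set c := constGerm (Φ p).1 (Φ p).2 with hc
  have hmon : ((X - C c) ^ d : (Hol (Φ p).1)[X]).Monic := (monic_X_sub_C c).pow d
  have hdeg : ((X - C c) ^ d : (Hol (Φ p).1)[X]).degree = d := by
    rw [degree_pow, degree_X_sub_C, nsmul_one]
  set w := (X - C c) ^ d - r with hw
  have hwm : w.Monic := hmon.sub_of_left (by rwa [hdeg])
  have hwd : w.natDegree = d := natDegree_eq_of_degree_eq_some (by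
    rw [hw, degree_sub_eq_left_of_degree_lt (by rwa [hdeg]), hdeg])
  have hpw : polyGerm Φ p w = q * f := by
    rw [hw, map_sub, map_pow, map_sub, polyGerm_X, polyGerm_C, hc, pullback_const, h]; ring
  have hwc : w.map (ev _) = (X - C (Φ p).2) ^ d - r.map (ev _) := by
    rw [hw]; simp [hc]
  -- on the line through `p` the remainder has order at least `d`, hence vanishes
  have hline : ∀ᶠ t : ℂ in 𝓝 0, t ^ d - (r.map (ev _)).eval ((Φ p).2 + t) =
      rep (q * f) (p + t • Φ.dir) := by
    filter_upwards [rep_polyGerm_line Φ w] with t ht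
    rw [← hpw, ht, hwc]; simp
  have hr0 : r.map (ev _) = 0 := by
    by_contra hne
    have h1 : (d : ℕ∞) ≤ orderAlong Φ (q * f) := by rw [orderAlong_mul, hf]; exact le_add_self
    obtain ⟨g, hg, hge⟩ := (natCast_le_analyticOrderAt (analyticAt_line (q * f) Φ.dir)).1 h1
    set s := taylor (Φ p).2 (r.map (ev (Φ p).1)) with hs
    have hsd : s.degree < d := by
      rw [hs, degree_taylor]; exact (degree_map_le).trans_lt hr
    have hs0 : s ≠ 0 := fun h => hne (taylor_injective (Φ p).2 (by rw [← hs, h, map_zero]))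
    have h2 : ∀ᶠ t : ℂ in 𝓝 0, s.eval t = t ^ d * (1 - g t) := by
      filter_upwards [hline, hge] with t h3 h4
      rw [hs, taylor_eval, add_comm t, mul_sub, mul_one]
      rw [sub_zero, smul_eq_mul] at h4
      rw [← h4, ← h3]; ring
    have h5 : (d : ℕ∞) ≤ analyticOrderAt (fun t => s.eval t) 0 := by
      refine (natCast_le_analyticOrderAt (AnalyticOnNhd.eval_polynomial s 0 trivial)).2
        ⟨fun t => 1 - g t, analyticAt_const.sub hg, ?_⟩
      filter_upwards [h2] with t ht
      simpa using ht
    obtain ⟨s', hs', hnd⟩ := exists_eq_pow_rootMultiplicity_mul_and_not_dvd s hs0 0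
    set m := rootMultiplicity 0 s
    have h6 : analyticOrderAt (fun t => s.eval t) 0 = m := by
      refine (AnalyticAt.analyticOrderAt_eq_natCast (AnalyticOnNhd.eval_polynomial s 0 trivial)).2
        ⟨fun t => s'.eval t, AnalyticOnNhd.eval_polynomial s' 0 trivial, ?_, ?_⟩
      · rwa [dvd_iff_isRoot] at hnd
      · filter_upwards with t
        rw [hs']; simp
    have h7 : s'.degree ≠ ⊥ := fun h => hnd (by rw [degree_eq_bot.1 h]; exact dvd_zero _)
    have h8 : (m : WithBot ℕ) ≤ s.degree := by
      rw [hs', degree_mul, degree_pow, degree_X_sub_C, nsmul_one]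
      exact le_add_of_nonneg_right (zero_le_degree_iff.2 (fun h => h7 (by rw [h, degree_zero])))
    rw [h6] at h5
    have h9 : d ≤ m := by exact_mod_cast h5
    have h10 := h8.trans_lt hsd
    exact absurd h9 (not_le.2 (by exact_mod_cast h10))
  have hwev : w.map (ev _) = (X - C (Φ p).2) ^ d := by rw [hwc, hr0, sub_zero]
  have hq : orderAlong Φ q = 0 := by
    have h1 : orderAlong Φ (q * f) = d := by
      rw [orderAlong, ← analyticOrderAt_congr hline, hr0]
      simp only [eval_zero, sub_zero]
      have := analyticOrderAt_centeredMonomial (𝕜 := ℂ) (z₀ := 0) (n := d)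
      simp only [sub_zero] at this
      exact this
    rw [orderAlong_mul, hf] at h1
    have h2 : orderAlong Φ q + d = 0 + d := by rw [h1, zero_add]
    exact (WithTop.add_right_inj (ENat.natCast_ne_top d)).1 h2
  have hu : IsUnit q := isUnit_iff_ev.2 ((orderAlong_eq_zero_iff Φ).1 hq)
  obtain ⟨u, rfl⟩ := hu
  exact ⟨w, u⁻¹, hwm, hwd, by rw [hpw, Units.inv_mul_cancel_left], hwev⟩

end Weierstrass

/-! ### The ring of germs is Noetherian -/

/-- In dimension zero the ring of germs is the field of complex numbers. -/
theorem ev_ne_zero_of_dim_zero {p : Cn 0} {φ : Hol p} (h : φ ≠ 0) : ev p φ ≠ 0 := by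
  obtain ⟨x, hx⟩ := (frequently_rep_ne_zero h).exists
  rwa [Subsingleton.elim x p] at hx

/-- Rückert's basis theorem, by induction on the dimension: after division by one nonzero element of
an ideal, only the remainders matter, and they lie in a finite free module over the germs in one
variable fewer. -/
theorem isNoetherianRing_hol : ∀ (n : ℕ) (p : Cn n), IsNoetherianRing (Hol p) := by
  intro n
  induction n with
  | zero =>
    refine fun p => (isNoetherianRing_iff_ideal_fg _).2 fun I => ?_
    by_cases hI : I = ⊥
    · subst hI; exact Submodule.fg_bot
    · obtain ⟨φ, hφ, h0⟩ := Submodule.exists_mem_ne_zero_of_ne_bot hI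
      rw [ideal_eq_top_of_ev hφ (ev_ne_zero_of_dim_zero h0)]
      exact Ideal.fg_top _
  | succ n ih =>
    refine fun p => (isNoetherianRing_iff_ideal_fg _).2 fun I => ?_
    by_cases hI : I = ⊥
    · subst hI; exact Submodule.fg_bot
    obtain ⟨f, hf, h0⟩ := Submodule.exists_mem_ne_zero_of_ne_bot hI
    obtain ⟨Φ, hΦ⟩ := exists_orderAlong_ne_top h0
    obtain ⟨d, hd⟩ := ENat.ne_top_iff_exists.1 hΦ
    have := ih (Φ p).1
    have hN : IsNoetherian (Hol (Φ p).1) (degreeLT (Hol (Φ p).1) d) :=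
      isNoetherian_of_linearEquiv (degreeLTEquiv (Hol (Φ p).1) d).symm
    -- the remainders of the elements of `I` form a submodule of a Noetherian module
    obtain ⟨s, hs⟩ := isNoetherian_submodule.1 hN
      (degreeLT (Hol (Φ p).1) d ⊓ (I.comap (polyGerm Φ p)).restrictScalars (Hol (Φ p).1))
      inf_le_left
    classical
    refine ⟨insert f (s.image (polyGerm Φ p)), le_antisymm ?_ ?_⟩
    · refine Ideal.span_le.2 fun g hg => ?_
      rw [Finset.coe_insert, Finset.coe_image] at hg
      rcases hg with rfl | ⟨r, hr, rfl⟩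
      · exact hf
      · have : r ∈ degreeLT (Hol (Φ p).1) d ⊓
            (I.comap (polyGerm Φ p)).restrictScalars (Hol (Φ p).1) := by
          rw [← hs]; exact Submodule.subset_span hr
        exact this.2
    · intro g hg
      obtain ⟨q, r, hr, rfl⟩ := exists_division hd.symm g
      have hfJ : f ∈ Ideal.span (↑(insert f (s.image (polyGerm Φ p))) : Set (Hol p)) :=
        Ideal.subset_span (by simp)
      refine Ideal.add_mem _ (Ideal.mul_mem_left _ _ hfJ) ?_
      have hrN : r ∈ Submodule.span (Hol (Φ p).1) (s : Set (Hol (Φ p).1)[X]) := by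
        rw [hs]
        refine ⟨mem_degreeLT.2 hr, ?_⟩
        have h1 : polyGerm Φ p r = (q * f + polyGerm Φ p r) - q * f := by ring
        change polyGerm Φ p r ∈ I
        rw [h1]
        exact I.sub_mem hg (I.mul_mem_left _ hf)
      have hle : Submodule.span (Hol (Φ p).1) (s : Set (Hol (Φ p).1)[X]) ≤
          ((Ideal.span (↑(insert f (s.image (polyGerm Φ p))) : Set (Hol p))).comap
            (polyGerm Φ p)).restrictScalars (Hol (Φ p).1) := by
        refine Submodule.span_le.2 fun a ha => ?_
        exact Ideal.subset_span (by
          rw [Finset.coe_insert, Finset.coe_image]; exact Or.inr ⟨a, ha, rfl⟩)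
      exact hle hrN

instance {n : ℕ} (p : Cn n) : IsNoetherianRing (Hol p) := isNoetherianRing_hol n p

/-! ### Coherence of the sheaf of relations -/

section Oka

/-- The relations between the columns of the matrix of germs `F` at the points near `p` are
generated by finitely many relations at `p`. -/
def RelationsCoherent {n : ℕ} {p : Cn n} {σ τ : Type} [Fintype τ] (F : σ → τ → Hol p) : Prop :=
  ∃ (κ : Type) (_ : Fintype κ) (G : κ → τ → Hol p), (∀ k i, ∑ j, G k j * F i j = 0) ∧
    ∀ᶠ x in 𝓝 p, ∀ r : τ → Hol x, (∀ i, ∑ j, r j * germAt (F i j) x = 0) →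
      ∃ c : κ → Hol x, ∀ j, r j = ∑ k, c k * germAt (G k j) x

variable {n : ℕ} {p : Cn n}

theorem germAt_ite (P : Prop) [Decidable P] (φ ψ : Hol p) (x : Cn n) :
    germAt (if P then φ else ψ) x = if P then germAt φ x else germAt ψ x := by
  split_ifs <;> rfl

/-- All relations between zero columns are combinations of the coordinate vectors. -/
theorem relationsCoherent_of_forall_eq_zero {σ τ : Type} [Finite σ] [Fintype τ] {F : σ → τ → Hol p}
    (hF : ∀ i j, F i j = 0) : RelationsCoherent F := by
  classical
  refine ⟨τ, inferInstance, fun k j => if k = j then 1 else 0, by simp [hF], ?_⟩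
  filter_upwards [germAt_zero (p := p), germAt_one (p := p)] with x h0 h1 r _
  exact ⟨r, fun j => by simp [germAt_ite, h0, h1]⟩

/-- It suffices to treat relations given by one equation. -/
theorem relationsCoherent_of_scalar
    (h : ∀ (τ : Type) [Fintype τ] (F : τ → Hol p), RelationsCoherent fun _ : Unit => F)
    {σ τ : Type} [Fintype σ] [Fintype τ] (F : σ → τ → Hol p) : RelationsCoherent F := by
  classical
  suffices H : ∀ s : Finset σ, RelationsCoherent fun i : s => F i by
    obtain ⟨κ, hκ, G, h1, h2⟩ := H Finset.univ
    exact ⟨κ, hκ, G, fun k i => h1 k ⟨i, Finset.mem_univ i⟩,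
      h2.mono fun x hx r hr => hx r fun i => hr i⟩
  intro s
  induction s using Finset.induction_on with
  | empty => exact relationsCoherent_of_forall_eq_zero fun i => absurd i.2 (Finset.notMem_empty _)
  | insert a s ha ih =>
    obtain ⟨κ, hκ, G, h1, h2⟩ := ih
    obtain ⟨κ', hκ', G', h3, h4⟩ := h κ fun k => ∑ j, G k j * F a j
    refine ⟨κ', hκ', fun l j => ∑ k, G' l k * G k j, ?_, ?_⟩
    · rintro l ⟨i, hi⟩
      have e : ∀ i, ∑ j, (∑ k, G' l k * G k j) * F i j = ∑ k, G' l k * ∑ j, G k j * F i j := by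
        intro i
        simp only [Finset.sum_mul, Finset.mul_sum]
        rw [Finset.sum_comm]
        exact Finset.sum_congr rfl fun _ _ => Finset.sum_congr rfl fun _ _ => by ring
      simp only [e]
      rcases Finset.mem_insert.1 hi with rfl | hi
      · exact h3 l ()
      · exact Finset.sum_eq_zero fun k _ => by rw [h1 k ⟨i, hi⟩, mul_zero]
    · filter_upwards [h2, h4, eventually_all.2 fun k => germAt_sum_mul (G k) (F a),
        eventually_all.2 fun l => eventually_all.2 fun j => germAt_sum_mul (G' l) fun k => G k j]
        with x hx2 hx4 hs hs' r hr
      obtain ⟨c, hc⟩ := hx2 r fun i => hr ⟨i, Finset.mem_insert_of_mem i.2⟩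
      obtain ⟨d, hd⟩ := hx4 c fun _ => by
        have := hr ⟨a, Finset.mem_insert_self _ _⟩
        simp only [hc, Finset.sum_mul] at this
        rw [Finset.sum_comm] at this
        rw [← this]
        refine Finset.sum_congr rfl fun k _ => ?_
        rw [hs, Finset.mul_sum]
        exact Finset.sum_congr rfl fun _ _ => by ring
      refine ⟨d, fun j => ?_⟩
      rw [hc j]
      simp only [hd, hs', Finset.sum_mul, Finset.mul_sum]
      rw [Finset.sum_comm]
      exact Finset.sum_congr rfl fun _ _ => Finset.sum_congr rfl fun _ _ => by ring

/-- Coherence of relations depends only on the ideal generated by the entries. -/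
theorem RelationsCoherent.of_mutual {τ τ' : Type} [Fintype τ] [Fintype τ'] {F : τ → Hol p}
    {F' : τ' → Hol p} (T : τ → τ' → Hol p) (S : τ' → τ → Hol p)
    (hT : ∀ j, F j = ∑ l, T j l * F' l) (hS : ∀ l, F' l = ∑ j, S l j * F j)
    (h : RelationsCoherent fun _ : Unit => F') : RelationsCoherent fun _ : Unit => F := by
  classical
  obtain ⟨κ, hκ, G, h1, h2⟩ := h
  have hTS : ∀ j0, ∑ j, (∑ l, T j0 l * S l j) * F j = F j0 := by
    intro j0
    rw [hT j0]
    simp only [hS, Finset.sum_mul, Finset.mul_sum]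
    rw [Finset.sum_comm]
    exact Finset.sum_congr rfl fun _ _ => Finset.sum_congr rfl fun _ _ => by ring
  refine ⟨κ ⊕ τ, inferInstance, Sum.elim (fun k j => ∑ l, G k l * S l j)
    (fun j0 j => (if j0 = j then 1 else 0) - ∑ l, T j0 l * S l j), ?_, ?_⟩
  · rintro (k | j0) -
    · simp only [Sum.elim_inl]
      have := h1 k ()
      simp only [hS] at this
      rw [← this]
      simp only [Finset.sum_mul, Finset.mul_sum]
      rw [Finset.sum_comm]
      exact Finset.sum_congr rfl fun _ _ => Finset.sum_congr rfl fun _ _ => by ring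
    · simp only [Sum.elim_inr, sub_mul, Finset.sum_sub_distrib, hTS]
      simp
  · filter_upwards [h2, germAt_zero (p := p), germAt_one (p := p),
      eventually_all.2 fun j => germAt_sum_mul (T j) F',
      eventually_all.2 fun k => eventually_all.2 fun j => germAt_sum_mul (G k) fun l => S l j,
      eventually_all.2 fun k => eventually_all.2 fun j => germAt_sum_mul (T k) fun l => S l j,
      eventually_all.2 fun j0 => eventually_all.2 fun j =>
        germAt_sub (if j0 = j then 1 else 0) (∑ l, T j0 l * S l j)]
      with x hx h0 hone hTx hGx hTSx hsub r hr
    obtain ⟨c, hc⟩ := hx (fun l => ∑ j, r j * germAt (T j l) x) fun _ => by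
      have := hr ()
      simp only [hT, hTx] at this
      rw [← this]
      simp only [Finset.sum_mul, Finset.mul_sum]
      rw [Finset.sum_comm]
      exact Finset.sum_congr rfl fun _ _ => Finset.sum_congr rfl fun _ _ => by ring
    refine ⟨Sum.elim c r, fun j => ?_⟩
    rw [Fintype.sum_sum_type]
    simp only [Sum.elim_inl, Sum.elim_inr, hGx, hsub, hTSx, germAt_ite, h0, hone, mul_sub,
      Finset.sum_sub_distrib, mul_ite, mul_one, mul_zero, Finset.sum_ite_eq', Finset.mem_univ,
      if_true]
    have e1 : ∑ k, c k * ∑ l, germAt (G k l) x * germAt (S l j) x =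
        ∑ l, (∑ j', r j' * germAt (T j' l) x) * germAt (S l j) x := by
      simp only [hc, Finset.sum_mul, Finset.mul_sum]
      rw [Finset.sum_comm]
      exact Finset.sum_congr rfl fun _ _ => Finset.sum_congr rfl fun _ _ => by ring
    have e2 : ∑ j', r j' * ∑ l, germAt (T j' l) x * germAt (S l j) x =
        ∑ l, (∑ j', r j' * germAt (T j' l) x) * germAt (S l j) x := by
      simp only [Finset.sum_mul, Finset.mul_sum]
      rw [Finset.sum_comm]
      exact Finset.sum_congr rfl fun _ _ => Finset.sum_congr rfl fun _ _ => by ring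
    rw [e1, e2]; ring

theorem relationsCoherent_one : RelationsCoherent fun (_ : Unit) (_ : Unit) => (1 : Hol p) := by
  refine ⟨Empty, inferInstance, fun k => k.elim, fun k => k.elim, ?_⟩
  filter_upwards [germAt_one (p := p)] with x hx r hr
  refine ⟨fun k => k.elim, fun j => ?_⟩
  simpa [hx] using hr ()

theorem relationsCoherent_dim_zero {p : Cn 0} {τ : Type} [Fintype τ] (F : τ → Hol p) :
    RelationsCoherent fun _ : Unit => F := by
  classical
  by_cases h : ∀ j, F j = 0
  · exact relationsCoherent_of_forall_eq_zero fun _ => h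
  push Not at h
  obtain ⟨j0, h0⟩ := h
  obtain ⟨u, hu⟩ := isUnit_iff_ev.2 (ev_ne_zero_of_dim_zero h0)
  refine RelationsCoherent.of_mutual (F' := fun _ : Unit => 1) (fun j _ => F j)
    (fun _ j => if j = j0 then ((u⁻¹ : (Hol p)ˣ) : Hol p) else 0) (by simp) ?_ relationsCoherent_one
  simp [← hu]

end Oka

section OkaStep

variable {n : ℕ} {p : Cn (n + 1)} {Φ : Splitting n}

theorem degree_mul_lt' {R : Type*} [CommRing R] {a b : R[X]} {d e : ℕ} (ha : a.degree < d)
    (hb : b.degree < e) : (a * b).degree < ((d + e : ℕ) : WithBot ℕ) := by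
  by_cases h0 : a = 0
  · rw [h0, zero_mul, degree_zero]; exact WithBot.bot_lt_coe _
  by_cases h1 : b = 0
  · rw [h1, mul_zero, degree_zero]; exact WithBot.bot_lt_coe _
  have ha' := (natDegree_lt_iff_degree_lt h0).2 ha
  have hb' := (natDegree_lt_iff_degree_lt h1).2 hb
  refine degree_le_natDegree.trans_lt (Nat.cast_lt.2 ?_)
  exact natDegree_mul_le.trans_lt (by omega)

theorem degree_germPolyAt_lt {q : Cn n} {r : (Hol q)[X]} {d : ℕ} (hr : r.degree < d) :
    ∀ᶠ y in 𝓝 q, (germPolyAt r y).degree < d := by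
  filter_upwards [coeff_germPolyAt r, germAt_zero (p := q)] with y hy h0
  rw [degree_lt_iff_coeff_zero] at hr ⊢
  intro k hk
  rw [hy, hr k hk, h0]

theorem germAt_polyGerm_sum {d : ℕ} (h : Fin d → Hol (Φ p).1) :
    ∀ᶠ x in 𝓝 p, germAt (polyGerm Φ p (∑ k : Fin d, C (h k) * X ^ (k : ℕ))) x =
      polyGerm Φ x (∑ k : Fin d, C (germAt (h k) (Φ x).1) * X ^ (k : ℕ)) := by
  simp only [map_sum, map_mul, map_pow, polyGerm_C, polyGerm_X]
  filter_upwards [germAt_sum_mul (fun k : Fin d => pullback Φ p (h k))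
    (fun k => coordGerm Φ p ^ (k : ℕ)), eventually_all.2 fun k => germAt_pullback Φ (p := p) (h k),
    eventually_all.2 fun k : Fin d => germAt_pow (coordGerm Φ p) (k : ℕ),
    germAt_coordGerm Φ (p := p)] with x h1 h2 h3 h4
  rw [h1]
  exact Finset.sum_congr rfl fun k _ => by rw [h2, h3, h4]

theorem eq_sum_of_degree_lt {R : Type*} [CommRing R] {r : R[X]} {d : ℕ} (hr : r.degree < d) :
    r = ∑ k : Fin d, C (r.coeff k) * X ^ (k : ℕ) := by
  rw [Fin.sum_univ_eq_sum_range fun k => C (r.coeff k) * X ^ k]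
  have := eval₂_eq_sum_of_degree_lt (C : R →+* R[X]) X hr
  rwa [eval₂_C_X] at this

/-- Relations of degree `< d` between polynomials of degree `≤ d` are the solutions of a linear
system of `2 d` equations: this lemma and the next one express the two implications. -/
theorem coeff_sum_mul_eq_zero {R : Type*} [CommRing R] {o : Type} [Fintype o] {d : ℕ}
    (h : o × Fin d → R) (P : o → R[X]) (hP : ∀ j, (P j).natDegree ≤ d)
    (heq : ∀ m : Fin (2 * d), ∑ y : o × Fin d, h y * (X ^ (y.2 : ℕ) * P y.1).coeff m = 0) :
    ∑ j, (∑ k : Fin d, C (h (j, k)) * X ^ (k : ℕ)) * P j = 0 := by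
  ext m
  have e : (∑ j, (∑ k : Fin d, C (h (j, k)) * X ^ (k : ℕ)) * P j).coeff m =
      ∑ y : o × Fin d, h y * (X ^ (y.2 : ℕ) * P y.1).coeff m := by
    rw [Fintype.sum_prod_type, finsetSum_coeff]
    refine Finset.sum_congr rfl fun j _ => ?_
    rw [Finset.sum_mul, finsetSum_coeff]
    exact Finset.sum_congr rfl fun k _ => by rw [mul_assoc, coeff_C_mul]
  rw [e, coeff_zero]
  by_cases hm : m < 2 * d
  · exact heq ⟨m, hm⟩
  · refine Finset.sum_eq_zero fun y _ => ?_
    have := y.2.2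
    rw [coeff_X_pow_mul', if_pos (by omega), coeff_eq_zero_of_natDegree_lt, mul_zero]
    exact (hP y.1).trans_lt (by omega)

theorem coeff_eq_of_sum_mul_eq_zero {R : Type*} [CommRing R] {o : Type} [Fintype o] {d : ℕ}
    (Q P : o → R[X]) (hQ : ∀ j, (Q j).degree < d) (h : ∑ j, Q j * P j = 0) (m : ℕ) :
    ∑ y : o × Fin d, (Q y.1).coeff y.2 * (X ^ (y.2 : ℕ) * P y.1).coeff m = 0 := by
  have h1 := congrArg (fun r => r.coeff m) h
  simp only [coeff_zero, finsetSum_coeff] at h1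
  rw [Fintype.sum_prod_type, ← h1]
  refine Finset.sum_congr rfl fun j _ => ?_
  conv_rhs => rw [eq_sum_of_degree_lt (hQ j), Finset.sum_mul, finsetSum_coeff]
  exact Finset.sum_congr rfl fun k _ => by rw [mul_assoc, coeff_C_mul]

/-- At a point, a relation between a monic polynomial `w` and polynomials `r_j` of smaller degree
is a combination of Koszul relations and of polynomial relations of degree `< deg w`. At this point
`w` need not be a Weierstrass polynomial: one splits off its Weierstrass factor `w'`, divides by
it, and absorbs the complementary factor `w / w'`, a unit, into the coefficients. -/
theorem exists_polynomial_relation {τ : Type} [Fintype τ] {w : (Hol (Φ p).1)[X]}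
    (hw : w.Monic) {d : ℕ} (hd : w.natDegree = d) (r : τ → (Hol (Φ p).1)[X])
    (hr : ∀ j, (r j).degree < d) (b₀ : Hol p) (b : τ → Hol p)
    (hb : b₀ * polyGerm Φ p w + ∑ j, b j * polyGerm Φ p (r j) = 0) :
    ∃ (Q₀ : (Hol (Φ p).1)[X]) (Q : τ → (Hol (Φ p).1)[X]) (u : Hol p) (β : τ → Hol p),
      Q₀.degree < d ∧ (∀ j, (Q j).degree < d) ∧ Q₀ * w + ∑ j, Q j * r j = 0 ∧
      b₀ = u * polyGerm Φ p Q₀ - ∑ j, β j * polyGerm Φ p (r j) ∧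
      ∀ j, b j = u * polyGerm Φ p (Q j) + β j * polyGerm Φ p w := by
  have hw0 : w.map (ev (Φ p).1) ≠ 0 := (hw.map _).ne_zero
  obtain ⟨d', hd'⟩ := ENat.ne_top_iff_exists.1 (orderAlong_polyGerm_ne_top Φ hw0)
  obtain ⟨w', u, hw'm, hw'd, hu, -⟩ := exists_preparation hd'.symm
  have hw'deg : w'.degree = d' := by rw [degree_eq_natDegree hw'm.ne_zero, hw'd]
  set f := polyGerm Φ p w with hf
  -- the division of `w` by the Weierstrass polynomial `w'` is exact
  have key : ∀ (a : Hol p) (N : (Hol (Φ p).1)[X]), a * f = polyGerm Φ p N →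
      N = w' * (N /ₘ w') ∧ a * u = polyGerm Φ p (N /ₘ w') := by
    intro a N haN
    have h1 := modByMonic_add_div N w'
    have h2 : (polyGerm Φ p (N /ₘ w') * (u⁻¹ : (Hol p)ˣ) - a) * f + polyGerm Φ p (N %ₘ w') = 0 := by
      have h3 : ((u⁻¹ : (Hol p)ˣ) : Hol p) * f = polyGerm Φ p w' := by
        rw [hu, Units.inv_mul_cancel_left]
      rw [sub_mul, mul_assoc, h3, haN]
      conv_lhs => enter [1, 2]; rw [← h1]
      rw [map_add, map_mul]; ring
    obtain ⟨h4, h5⟩ := division_unique hd'.symm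
      (by rw [← hw'deg]; exact degree_modByMonic_lt N hw'm) h2
    refine ⟨by conv_lhs => rw [← h1, h5, zero_add], ?_⟩
    rw [← sub_eq_zero.1 h4, mul_assoc, Units.inv_mul, mul_one]
  obtain ⟨hw1, hw2⟩ := key 1 w (by rw [one_mul])
  set w'' := w /ₘ w' with hw''
  rw [one_mul] at hw2
  have hw''m : w''.Monic := hw'm.of_mul_monic_left (by rwa [← hw1])
  have hdd : d' + w''.natDegree = d := by
    rw [← hd, hw1, hw'm.natDegree_mul hw''m, hw'd]
  choose β c hc hbc using fun j => exists_division hd'.symm (b j)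
  obtain ⟨hN1, hN2⟩ := key (b₀ + ∑ j, β j * polyGerm Φ p (r j)) (-∑ j, c j * r j) (by
    have h1 : ∑ j, b j * polyGerm Φ p (r j) =
        (∑ j, β j * polyGerm Φ p (r j)) * f + ∑ j, polyGerm Φ p (c j * r j) := by
      rw [Finset.sum_mul, ← Finset.sum_add_distrib]
      exact Finset.sum_congr rfl fun j _ => by rw [hbc j, map_mul]; ring
    rw [h1] at hb
    rw [map_neg, map_sum]
    linear_combination hb)
  set Q₀ := (-∑ j, c j * r j) /ₘ w' with hQ₀
  have hNdeg : (-∑ j, c j * r j).degree < ((d' + d : ℕ) : WithBot ℕ) := by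
    rw [degree_neg]
    refine (degree_sum_le _ _).trans_lt ((Finset.sup_lt_iff (WithBot.bot_lt_coe _)).2 ?_)
    exact fun j _ => degree_mul_lt' (hc j) (hr j)
  refine ⟨Q₀, fun j => w'' * c j, ((u⁻¹ : (Hol p)ˣ) : Hol p), β, ?_, ?_, ?_, ?_, ?_⟩
  · by_cases h0 : Q₀ = 0
    · rw [h0, degree_zero]; exact WithBot.bot_lt_coe _
    · rw [hN1, hw'm.degree_mul_comm, hw'm.degree_mul, hw'deg, degree_eq_natDegree h0] at hNdeg
      rw [degree_eq_natDegree h0]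
      have : Q₀.natDegree + d' < d' + d := by exact_mod_cast hNdeg
      exact Nat.cast_lt.2 (by omega)
  · intro j
    change (w'' * c j).degree < d
    by_cases h0 : c j = 0
    · rw [h0, mul_zero, degree_zero]; exact WithBot.bot_lt_coe _
    · rw [hw''m.degree_mul_comm, hw''m.degree_mul, degree_eq_natDegree h0,
        degree_eq_natDegree hw''m.ne_zero]
      have h1 := (natDegree_lt_iff_degree_lt h0).2 (hc j)
      have : (c j).natDegree + w''.natDegree < d := by omega
      exact_mod_cast this
  · have h1 : ∑ j, w'' * c j * r j = w'' * ∑ j, c j * r j := by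
      rw [Finset.mul_sum]; exact Finset.sum_congr rfl fun _ _ => by ring
    rw [h1]
    conv_lhs => enter [1, 2]; rw [hw1]
    linear_combination (-w'') * hN1
  · rw [← hN2, mul_comm _ (u : Hol p), Units.inv_mul_cancel_left]; ring
  · intro j
    rw [map_mul, ← hw2, Units.inv_mul_cancel_left, hbc j]; ring

/-- The induction step of Oka's theorem for a monic polynomial `w` and polynomials of smaller
degree. Their relations at nearby points are generated by Koszul relations and polynomial
relations of bounded degree (`exists_polynomial_relation`). The latter are the solutions of a linear
system over the germs in one variable fewer, to which the induction hypothesis applies. -/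
theorem relationsCoherent_polynomial
    (ih : ∀ (q : Cn n) (σ τ : Type) [Fintype σ] [Fintype τ] (F : σ → τ → Hol q),
      RelationsCoherent F)
    {τ : Type} [Fintype τ] {w : (Hol (Φ p).1)[X]} (hw : w.Monic) {d : ℕ} (hd : w.natDegree = d)
    (r : τ → (Hol (Φ p).1)[X]) (hr : ∀ j, (r j).degree < d) :
    RelationsCoherent fun (_ : Unit) (o : Option τ) => polyGerm Φ p (o.elim w r) := by
  classical
  set P : Option τ → (Hol (Φ p).1)[X] := fun o => o.elim w r with hP
  have hPd : ∀ o, (P o).natDegree ≤ d := by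
    rintro (_ | j)
    · exact hd.le
    · exact natDegree_le_of_degree_le (hr j).le
  obtain ⟨κ, hκ, H, h1, h2⟩ := ih (Φ p).1 (Fin (2 * d)) (Option τ × Fin d)
    fun m y => (X ^ (y.2 : ℕ) * P y.1).coeff m
  refine ⟨κ ⊕ τ, inferInstance, Sum.elim
    (fun k o => polyGerm Φ p (∑ i : Fin d, C (H k (o, i)) * X ^ (i : ℕ)))
    (fun j o => o.elim (-polyGerm Φ p (r j)) fun j' => if j = j' then polyGerm Φ p w else 0),
    ?_, ?_⟩
  · rintro (k | j) -
    · have := congrArg (polyGerm Φ p) (coeff_sum_mul_eq_zero (H k) P hPd (h1 k))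
      simpa only [map_sum, map_mul, map_zero, Sum.elim_inl, hP] using this
    · simp [Fintype.sum_option]; ring
  · have hE : ∀ᶠ x in 𝓝 p, ∀ (m : Fin (2 * d)) (y : Option τ × Fin d),
        germAt ((X ^ (y.2 : ℕ) * P y.1).coeff m) (Φ x).1 =
          (X ^ (y.2 : ℕ) * germPolyAt (P y.1) (Φ x).1).coeff m := by
      refine (tendsto_proj Φ p).eventually (p := fun z => ∀ (m : Fin (2 * d))
        (y : Option τ × Fin d), germAt ((X ^ (y.2 : ℕ) * P y.1).coeff m) z =
          (X ^ (y.2 : ℕ) * germPolyAt (P y.1) z).coeff m) ?_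
      filter_upwards [eventually_all.2 fun o => coeff_germPolyAt (P o),
        germAt_zero (p := (Φ p).1)] with y hy h0 m z
      rw [coeff_X_pow_mul', coeff_X_pow_mul', germAt_ite, h0, hy]
    filter_upwards [hE, (tendsto_proj Φ p).eventually h2,
      eventually_all.2 fun o => germAt_polyGerm Φ (p := p) (P o),
      (tendsto_proj Φ p).eventually (germPolyAt_monic hw),
      (tendsto_proj Φ p).eventually (eventually_all.2 fun j => degree_germPolyAt_lt (hr j)),
      eventually_all.2 fun k => eventually_all.2 fun o =>
        germAt_polyGerm_sum (p := p) fun i : Fin d => H k (o, i),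
      eventually_all.2 fun j => germAt_neg (polyGerm Φ p (r j)), germAt_zero (p := p)]
      with x hEx hHx hPx hwx hrx hGx hneg h0 b hb
    have hb' : ∑ o, b o * germAt (polyGerm Φ p (P o)) x = 0 := hb ()
    simp only [hPx] at hb'
    rw [Fintype.sum_option] at hb'
    obtain ⟨Q₀, Q, u, β, hQ₀, hQ, hQr, hb0, hbj⟩ := exists_polynomial_relation hwx.1
      (hwx.2.trans hd) (fun j => germPolyAt (r j) (Φ x).1) hrx (b none) (fun j => b (some j)) hb'
    set Q' : Option τ → (Hol (Φ x).1)[X] := fun o => o.elim Q₀ Q with hQ'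
    have hQ'd : ∀ o, (Q' o).degree < d := by
      rintro (_ | j)
      · exact hQ₀
      · exact hQ j
    have hQ'r : ∑ o, Q' o * germPolyAt (P o) (Φ x).1 = 0 := by
      rw [Fintype.sum_option]; exact hQr
    obtain ⟨c, hc⟩ := hHx (fun y => (Q' y.1).coeff y.2) fun m => by
      have := coeff_eq_of_sum_mul_eq_zero Q' _ hQ'd hQ'r m
      simpa only [hEx] using this
    have hQ's : ∀ o, polyGerm Φ x (Q' o) = ∑ k, pullback Φ x (c k) *
        polyGerm Φ x (∑ i : Fin d, C (germAt (H k (o, i)) (Φ x).1) * X ^ (i : ℕ)) := by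
      intro o
      have h3 : Q' o = ∑ k, C (c k) *
          ∑ i : Fin d, C (germAt (H k (o, i)) (Φ x).1) * X ^ (i : ℕ) := by
        conv_lhs => rw [eq_sum_of_degree_lt (hQ'd o)]
        simp only [Finset.mul_sum]
        rw [Finset.sum_comm]
        refine Finset.sum_congr rfl fun i _ => ?_
        rw [hc (o, i), map_sum, Finset.sum_mul]
        exact Finset.sum_congr rfl fun k _ => by rw [C_mul]; ring
      rw [h3, map_sum]
      exact Finset.sum_congr rfl fun k _ => by rw [map_mul, polyGerm_C]
    refine ⟨Sum.elim (fun k => u * pullback Φ x (c k)) β, ?_⟩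
    have hrx' : ∀ j, germAt (polyGerm Φ p (r j)) x = polyGerm Φ x (germPolyAt (r j) (Φ x).1) :=
      fun j => hPx (some j)
    have hwx' : germAt (polyGerm Φ p w) x = polyGerm Φ x (germPolyAt w (Φ x).1) := hPx none
    rintro (_ | j)
    · rw [Fintype.sum_sum_type, hb0]
      simp only [Sum.elim_inl, Sum.elim_inr, hGx, Option.elim_none, hneg, hrx', mul_neg,
        Finset.sum_neg_distrib]
      have := hQ's none
      simp only [hQ', Option.elim_none] at this
      rw [this, Finset.mul_sum, sub_eq_add_neg]
      congr 1
      exact Finset.sum_congr rfl fun _ _ => by ring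
    · rw [Fintype.sum_sum_type, hbj]
      simp only [Sum.elim_inl, Sum.elim_inr, hGx, Option.elim_some, germAt_ite, h0, hwx',
        mul_ite, mul_zero, Finset.sum_ite_eq', Finset.mem_univ, if_true]
      have := hQ's (some j)
      simp only [hQ', Option.elim_some] at this
      rw [this, Finset.mul_sum]
      congr 1
      exact Finset.sum_congr rfl fun _ _ => by ring

end OkaStep

/-- Oka's coherence theorem, by induction on the dimension. Preparation of one nonzero entry and
division of the others by it reduce a single equation to the case of polynomials. -/
theorem oka : ∀ (n : ℕ) (p : Cn n) (σ τ : Type) [Fintype σ] [Fintype τ] (F : σ → τ → Hol p),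
    RelationsCoherent F := by
  classical
  intro n
  induction n with
  | zero =>
    intro p σ τ _ _ F
    exact relationsCoherent_of_scalar (fun τ _ F => relationsCoherent_dim_zero F) F
  | succ n ih =>
    intro p σ τ _ _ F
    refine relationsCoherent_of_scalar (fun τ _ F => ?_) F
    by_cases h : ∀ j, F j = 0
    · exact relationsCoherent_of_forall_eq_zero fun _ => h
    push Not at h
    obtain ⟨j0, h0⟩ := h
    obtain ⟨Φ, hΦ⟩ := exists_orderAlong_ne_top h0
    obtain ⟨d, hd⟩ := ENat.ne_top_iff_exists.1 hΦ
    obtain ⟨w, u, hwm, hwd, hu, -⟩ := exists_preparation hd.symm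
    have hd' : orderAlong Φ (polyGerm Φ p w) = d := by
      have h1 : orderAlong Φ (u : Hol p) = 0 :=
        (orderAlong_eq_zero_iff Φ).2 (isUnit_iff_ev.1 u.isUnit)
      have h2 := hd.symm
      rwa [hu, orderAlong_mul, h1, zero_add] at h2
    choose q r hr hF using fun j => exists_division hd' (F j)
    refine RelationsCoherent.of_mutual (F' := fun o : Option τ => polyGerm Φ p (o.elim w r))
      (fun j o => o.elim (q j) fun j' => if j = j' then 1 else 0)
      (fun o j => o.elim (if j = j0 then ((u⁻¹ : (Hol p)ˣ) : Hol p) else 0) fun j' =>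
        (if j = j' then 1 else 0) - if j = j0 then q j' * ((u⁻¹ : (Hol p)ˣ) : Hol p) else 0)
      ?_ ?_ (relationsCoherent_polynomial ih hwm hwd r hr)
    · intro j
      rw [Fintype.sum_option]
      simpa using hF j
    · rintro (_ | j)
      · simp [hu]
      · simp only [Option.elim_some, sub_mul, Finset.sum_sub_distrib, ite_mul, one_mul, zero_mul,
          Finset.sum_ite_eq', Finset.mem_univ, if_true]
        conv_rhs => rw [hF j, hu, mul_assoc, Units.inv_mul_cancel_left]
        ring

/-! ### Derivatives of germs -/

section Derivative

variable {n : ℕ} {p : Cn n}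

/-- The derivative of a germ in the direction of a constant vector. -/
def dirDeriv (v : Cn n) (φ : Hol p) : Hol p :=
  toGerm (fun x => fderiv ℂ (rep φ) x v)
    (((ContinuousLinearMap.apply ℂ ℂ v).analyticAt _).comp (rep_analyticAt φ).fderiv)

theorem partialDeriv_eq_dirDeriv (j : Fin n) (φ : Hol p) :
    partialDeriv j φ = dirDeriv (Pi.single j 1) φ := rfl

theorem rep_dirDeriv_of_eventuallyEq (v : Cn n) {φ : Hol p} {g : Cn n → ℂ}
    (h : rep φ =ᶠ[𝓝 p] g) : rep (dirDeriv v φ) =ᶠ[𝓝 p] fun x => fderiv ℂ g x v := by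
  refine (rep_toGerm _ (((ContinuousLinearMap.apply ℂ ℂ v).analyticAt _).comp
    (rep_analyticAt φ).fderiv)).trans ?_
  filter_upwards [h.fderiv (𝕜 := ℂ)] with x hx
  change fderiv ℂ (rep φ) x v = _
  rw [hx]

theorem rep_dirDeriv (v : Cn n) (φ : Hol p) :
    rep (dirDeriv v φ) =ᶠ[𝓝 p] fun x => fderiv ℂ (rep φ) x v :=
  rep_dirDeriv_of_eventuallyEq v EventuallyEq.rfl

theorem ev_dirDeriv (v : Cn n) (φ : Hol p) : ev p (dirDeriv v φ) = fderiv ℂ (rep φ) p v :=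
  (rep_dirDeriv v φ).self_of_nhds

theorem eventually_differentiableAt (φ : Hol p) : ∀ᶠ x in 𝓝 p, DifferentiableAt ℂ (rep φ) x :=
  (rep_analyticAt φ).eventually_analyticAt.mono fun _ h => h.differentiableAt

theorem dirDeriv_add (v : Cn n) (φ ψ : Hol p) :
    dirDeriv v (φ + ψ) = dirDeriv v φ + dirDeriv v ψ := by
  refine hol_ext ?_
  filter_upwards [rep_dirDeriv_of_eventuallyEq v (rep_add φ ψ),
    rep_add (dirDeriv v φ) (dirDeriv v ψ), rep_dirDeriv v φ, rep_dirDeriv v ψ,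
    eventually_differentiableAt φ, eventually_differentiableAt ψ] with x h1 h2 h3 h4 h5 h6
  rw [h1, h2, h3, h4, fderiv_fun_add h5 h6]; rfl

theorem dirDeriv_mul (v : Cn n) (φ ψ : Hol p) :
    dirDeriv v (φ * ψ) = dirDeriv v φ * ψ + φ * dirDeriv v ψ := by
  refine hol_ext ?_
  filter_upwards [rep_dirDeriv_of_eventuallyEq v (rep_mul φ ψ),
    rep_add (dirDeriv v φ * ψ) (φ * dirDeriv v ψ), rep_mul (dirDeriv v φ) ψ,
    rep_mul φ (dirDeriv v ψ), rep_dirDeriv v φ, rep_dirDeriv v ψ,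
    eventually_differentiableAt φ, eventually_differentiableAt ψ] with x h1 h2 h3 h4 h5 h6 h7 h8
  rw [h1, h2, h3, h4, h5, h6, fderiv_fun_mul h7 h8]
  simp only [add_apply, smul_apply, smul_eq_mul]
  ring

theorem dirDeriv_const (v : Cn n) (c : ℂ) : dirDeriv v (constGerm p c) = 0 := by
  refine hol_ext ?_
  filter_upwards [rep_dirDeriv_of_eventuallyEq v (rep_const (p := p) c), rep_zero (p := p)]
    with x h1 h2
  rw [h1, h2]; simp

theorem dirDeriv_zero (v : Cn n) : dirDeriv v (0 : Hol p) = 0 := by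
  simpa using dirDeriv_const (p := p) v 0

theorem germAt_dirDeriv (v : Cn n) (φ : Hol p) :
    ∀ᶠ x in 𝓝 p, germAt (dirDeriv v φ) x = dirDeriv v (germAt φ x) := by
  refine germAt_eq_of_eventuallyEq (rep_dirDeriv v φ) ?_
  filter_upwards [eventually_rep_germAt φ] with x hx
  exact rep_dirDeriv_of_eventuallyEq v hx

theorem dirDeriv_eq_applyField (v : Cn n) (φ : Hol p) :
    dirDeriv v φ = applyField (fun j => constGerm p (v j)) φ := by
  refine hol_ext ?_
  have h : ∀ j, ∀ᶠ x in 𝓝 p, rep (constGerm p (v j) * partialDeriv j φ) x =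
      v j * fderiv ℂ (rep φ) x (Pi.single j 1) := by
    intro j
    filter_upwards [rep_mul (constGerm p (v j)) (partialDeriv j φ), rep_const (p := p) (v j),
      rep_dirDeriv (Pi.single j 1) φ] with x h1 h2 h3
    rw [h1, h2, partialDeriv_eq_dirDeriv, h3]
  filter_upwards [rep_dirDeriv v φ, rep_sum Finset.univ fun j =>
    constGerm p (v j) * partialDeriv j φ, eventually_all.2 h] with x h1 h2 h3
  rw [h1, applyField, h2]
  simp only [h3]
  conv_lhs => rw [← Finset.univ_sum_single v, map_sum]
  refine Finset.sum_congr rfl fun j _ => ?_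
  have : (Pi.single j (v j) : Cn n) = v j • Pi.single j 1 := by
    rw [← Pi.single_smul, smul_eq_mul, mul_one]
  rw [this, map_smul, smul_eq_mul]

theorem dirDeriv_comm (v w : Cn n) (φ : Hol p) :
    dirDeriv v (dirDeriv w φ) = dirDeriv w (dirDeriv v φ) := by
  refine hol_ext ?_
  have key : ∀ v w : Cn n, ∀ᶠ x in 𝓝 p,
      rep (dirDeriv v (dirDeriv w φ)) x = fderiv ℂ (fderiv ℂ (rep φ)) x v w := by
    intro v w
    filter_upwards [rep_dirDeriv_of_eventuallyEq v (rep_dirDeriv w φ),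
      (rep_analyticAt φ).eventually_analyticAt] with x h1 h2
    rw [h1]
    have h3 : HasFDerivAt (fun y => fderiv ℂ (rep φ) y w)
        ((ContinuousLinearMap.apply ℂ ℂ w).comp (fderiv ℂ (fderiv ℂ (rep φ)) x)) x :=
      (ContinuousLinearMap.apply ℂ ℂ w).hasFDerivAt.comp x h2.fderiv.differentiableAt.hasFDerivAt
    rw [h3.fderiv]; rfl
  filter_upwards [key v w, key w v, (rep_analyticAt φ).eventually_analyticAt] with x h1 h2 h3
  rw [h1, h2]
  exact second_derivative_symmetric_of_eventually
    (h3.eventually_analyticAt.mono fun y hy => hy.differentiableAt.hasFDerivAt)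
    h3.fderiv.differentiableAt.hasFDerivAt v w

theorem applyField_mul (a : Fin n → Hol p) (φ ψ : Hol p) :
    applyField a (φ * ψ) = applyField a φ * ψ + φ * applyField a ψ := by
  simp only [applyField, partialDeriv_eq_dirDeriv, dirDeriv_mul, mul_add, Finset.sum_add_distrib,
    Finset.sum_mul, Finset.mul_sum]
  congr 1 <;> exact Finset.sum_congr rfl fun _ _ => by ring

theorem applyField_sum_smul {ι : Type*} [Fintype ι] (c : ι → Hol p) (a : ι → Fin n → Hol p)
    (φ : Hol p) : applyField (∑ i, c i • a i) φ = ∑ i, c i * applyField (a i) φ := by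
  simp only [applyField, Finset.sum_apply, Pi.smul_apply, smul_eq_mul, Finset.sum_mul,
    Finset.mul_sum]
  rw [Finset.sum_comm]
  exact Finset.sum_congr rfl fun _ _ => Finset.sum_congr rfl fun _ _ => by ring

theorem applyField_smul (c : Hol p) (a : Fin n → Hol p) (φ : Hol p) :
    applyField (c • a) φ = c * applyField a φ := by
  simp only [applyField, Pi.smul_apply, smul_eq_mul, Finset.mul_sum, mul_assoc]

theorem applyField_add_left (a b : Fin n → Hol p) (φ : Hol p) :
    applyField (a + b) φ = applyField a φ + applyField b φ := by
  simp only [applyField, Pi.add_apply, add_mul, Finset.sum_add_distrib]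

end Derivative

section DerivativeSplitting

variable {n : ℕ} {p : Cn (n + 1)} (Φ : Splitting n)

theorem dirDeriv_pullback (v : Cn (n + 1)) (a : Hol (Φ p).1) :
    dirDeriv v (pullback Φ p a) = pullback Φ p (dirDeriv (Φ v).1 a) := by
  refine hol_ext ?_
  filter_upwards [rep_dirDeriv_of_eventuallyEq v (rep_pullback Φ p a),
    rep_pullback Φ p (dirDeriv (Φ v).1 a),
    (tendsto_proj Φ p).eventually (rep_dirDeriv (Φ v).1 a),
    (tendsto_proj Φ p).eventually (eventually_differentiableAt a)] with x h1 h2 h3 h4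
  rw [h1, h2, h3]
  have h5 : HasFDerivAt (fun x => (Φ x).1) ((ContinuousLinearMap.fst ℂ (Cn n) ℂ).comp
      (Φ : Cn (n + 1) →L[ℂ] Cn n × ℂ)) x :=
    ((ContinuousLinearMap.fst ℂ (Cn n) ℂ).comp (Φ : Cn (n + 1) →L[ℂ] Cn n × ℂ)).hasFDerivAt
  have h6 : HasFDerivAt (fun x => rep a (Φ x).1) _ x :=
    HasFDerivAt.comp (g := rep a) x h4.hasFDerivAt h5
  rw [h6.fderiv]; rfl

theorem dirDeriv_coordGerm (v : Cn (n + 1)) :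
    dirDeriv v (coordGerm Φ p) = constGerm p (Φ v).2 := by
  refine hol_ext ?_
  filter_upwards [rep_dirDeriv_of_eventuallyEq v (rep_coordGerm Φ p),
    rep_const (p := p) (Φ v).2] with x h1 h2
  rw [h1, h2]
  have h5 : HasFDerivAt (fun x => (Φ x).2) ((ContinuousLinearMap.snd ℂ (Cn n) ℂ).comp
      (Φ : Cn (n + 1) →L[ℂ] Cn n × ℂ)) x :=
    ((ContinuousLinearMap.snd ℂ (Cn n) ℂ).comp (Φ : Cn (n + 1) →L[ℂ] Cn n × ℂ)).hasFDerivAt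
  rw [h5.fderiv]; rfl

theorem dirDeriv_polyGerm (g : (Hol (Φ p).1)[X]) :
    dirDeriv Φ.dir (polyGerm Φ p g) = polyGerm Φ p (derivative g) := by
  have hdir : Φ Φ.dir = (0, 1) := by simp [Splitting.dir]
  have hC : ∀ a : Hol (Φ p).1, dirDeriv Φ.dir (pullback Φ p a) = 0 := by
    intro a
    rw [dirDeriv_pullback, hdir, dirDeriv_eq_applyField]
    simp [applyField]
  have hX : dirDeriv Φ.dir (coordGerm Φ p) = 1 := by rw [dirDeriv_coordGerm, hdir]; simp
  induction g using Polynomial.induction_on with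
  | C a => rw [polyGerm_C, hC, derivative_C, map_zero]
  | add a b ha hb => rw [map_add, dirDeriv_add, ha, hb, derivative_add, map_add]
  | monomial k a ih =>
    rw [pow_succ, ← mul_assoc, derivative_mul (f := C a * X ^ k), derivative_X, mul_one,
      map_mul (polyGerm Φ p) (C a * X ^ k) X, dirDeriv_mul, ih, polyGerm_X, hX, mul_one, map_add,
      map_mul (polyGerm Φ p) _ X, polyGerm_X]

end DerivativeSplitting

/-! ### Reducedness is an open condition -/

section Reduced

variable {n : ℕ} {p : Cn (n + 1)} {Φ : Splitting n}

/-- By uniqueness of division, divisibility of germs by a Weierstrass polynomial is divisibility of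
polynomials. -/
theorem polyGerm_dvd_polyGerm_iff {w : (Hol (Φ p).1)[X]} (hw : w.Monic)
    (hd : orderAlong Φ (polyGerm Φ p w) = w.natDegree) (g : (Hol (Φ p).1)[X]) :
    polyGerm Φ p w ∣ polyGerm Φ p g ↔ w ∣ g := by
  refine ⟨fun ⟨a, ha⟩ => ?_, fun h => map_dvd _ h⟩
  have h1 := modByMonic_add_div g w
  rw [← modByMonic_eq_zero_iff_dvd hw]
  refine (division_unique hd (q := polyGerm Φ p (g /ₘ w) - a)
    (by rw [← degree_eq_natDegree hw.ne_zero]; exact degree_modByMonic_lt g hw) ?_).2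
  have h2 := congrArg (polyGerm Φ p) h1
  rw [map_add, map_mul, ha] at h2
  linear_combination h2

theorem isRadical_polyGerm_iff {w : (Hol (Φ p).1)[X]} (hw : w.Monic)
    (hd : orderAlong Φ (polyGerm Φ p w) = w.natDegree) :
    IsRadical (polyGerm Φ p w) ↔ IsRadical w := by
  constructor
  · intro h k g hg
    rw [← polyGerm_dvd_polyGerm_iff hw hd] at hg ⊢
    rw [map_pow] at hg
    exact h k _ hg
  · intro h k a ha
    obtain ⟨q, r, -, rfl⟩ := exists_division hd a
    have h1 : polyGerm Φ p w ∣ polyGerm Φ p (r ^ k) := by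
      rw [map_pow]
      -- `a` and its remainder `r` have congruent powers
      have h2 : polyGerm Φ p w ∣ (q * polyGerm Φ p w + polyGerm Φ p r) ^ k - polyGerm Φ p r ^ k :=
        dvd_trans ⟨q, by ring⟩ (sub_dvd_pow_sub_pow _ _ k)
      exact (dvd_sub_right ha).1 (by simpa using h2) |> fun h => by simpa using h
    exact dvd_add (dvd_mul_left _ _)
      ((polyGerm_dvd_polyGerm_iff hw hd r).2 (h k r ((polyGerm_dvd_polyGerm_iff hw hd _).1 h1)))

theorem span_isRadical_iff {R : Type*} [CommRing R] (a : R) :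
    (Ideal.span {a}).IsRadical ↔ IsRadical a :=
  isRadical_iff_span_singleton.symm

section Separable

variable {A : Type*} [CommRing A] [IsDomain A]

/-- Clearing denominators in a polynomial over the field of fractions. -/
theorem exists_map_eq_C_mul (G : (FractionRing A)[X]) :
    ∃ (b : A) (g : A[X]), b ≠ 0 ∧ g.map (algebraMap A (FractionRing A)) =
      C (algebraMap A (FractionRing A) b) * G := by
  obtain ⟨b, hb, h⟩ := IsLocalization.integerNormalization_spec (nonZeroDivisors A) G
  refine ⟨b, IsLocalization.integerNormalization (nonZeroDivisors A) G,
    nonZeroDivisors.ne_zero hb, ?_⟩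
  ext i
  rw [h, coeff_C_mul, coeff_smul, Algebra.smul_def]

theorem isRadical_map_of_monic {w : A[X]} (hw : w.Monic) (h : IsRadical w) :
    IsRadical (w.map (algebraMap A (FractionRing A))) := by
  intro k G hG
  obtain ⟨b, g, hb, hg⟩ := exists_map_eq_C_mul G
  have hb' : IsUnit (C (algebraMap A (FractionRing A) b)) :=
    isUnit_C.2 (isUnit_iff_ne_zero.2 (by
      simpa using (IsFractionRing.injective A (FractionRing A)).ne hb))
  have h1 : w ∣ g ^ k := by
    rw [← map_dvd_map (algebraMap A (FractionRing A)) (IsFractionRing.injective A _) hw,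
      Polynomial.map_pow, hg, mul_pow]
    exact dvd_mul_of_dvd_right hG _
  have h2 := Polynomial.map_dvd (algebraMap A (FractionRing A)) (h k g h1)
  rw [hg] at h2
  exact (hb'.dvd_mul_left).1 h2

omit [IsDomain A] in
theorem isRadical_of_isRadical_map {w : A[X]} (hw : w.Monic)
    (h : IsRadical (w.map (algebraMap A (FractionRing A)))) : IsRadical w := by
  intro k g hg
  rw [← map_dvd_map (algebraMap A (FractionRing A)) (IsFractionRing.injective A _) hw] at hg ⊢
  rw [Polynomial.map_pow] at hg
  exact h k _ hg

/-- A monic polynomial without multiple factors is separable over the field of fractions, so that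
the ideal of `w` and `w'` contains a nonzero constant. -/
theorem exists_discriminant [CharZero A] {w : A[X]} (hw : w.Monic) (h : IsRadical w) :
    ∃ Δ : A, Δ ≠ 0 ∧ ∃ a b : A[X], a * w + b * derivative w = C Δ := by
  have : CharZero (FractionRing A) :=
    charZero_of_injective_algebraMap (IsFractionRing.injective A (FractionRing A))
  have hinj := IsFractionRing.injective A (FractionRing A)
  have h1 : (w.map (algebraMap A (FractionRing A))).Separable :=
    PerfectField.separable_iff_squarefree.2
      ((isRadical_map_of_monic hw h).squarefree (hw.map _).ne_zero)
  obtain ⟨a', b', hab⟩ := h1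
  obtain ⟨c, a, hc, ha⟩ := exists_map_eq_C_mul a'
  obtain ⟨d, b, hd, hb⟩ := exists_map_eq_C_mul b'
  refine ⟨c * d, mul_ne_zero hc hd, C d * a, C c * b, ?_⟩
  apply Polynomial.map_injective _ hinj
  rw [derivative_map] at hab
  simp only [Polynomial.map_add, Polynomial.map_mul, map_C, ha, hb, map_mul]
  linear_combination C (algebraMap A (FractionRing A) c) * C (algebraMap A (FractionRing A) d) * hab

/-- The converse of `exists_discriminant`. -/
theorem isRadical_of_discriminant [CharZero A] {w : A[X]} (hw : w.Monic) {Δ : A} (hΔ : Δ ≠ 0)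
    {a b : A[X]} (h : a * w + b * derivative w = C Δ) : IsRadical w := by
  refine isRadical_of_isRadical_map hw (Squarefree.isRadical (Separable.squarefree ?_))
  have hu : IsUnit (C (algebraMap A (FractionRing A) Δ)) :=
    isUnit_C.2 (isUnit_iff_ne_zero.2 (by
      simpa using (IsFractionRing.injective A (FractionRing A)).ne hΔ))
  have h1 := congrArg (Polynomial.map (algebraMap A (FractionRing A))) h
  simp only [Polynomial.map_add, Polynomial.map_mul, map_C] at h1
  obtain ⟨u, hu⟩ := hu
  refine ⟨(↑u⁻¹ : (FractionRing A)[X]) * a.map (algebraMap A _),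
    (↑u⁻¹ : (FractionRing A)[X]) * b.map (algebraMap A _), ?_⟩
  rw [derivative_map]
  rw [← hu] at h1
  have := u.inv_mul
  linear_combination (↑u⁻¹ : (FractionRing A)[X]) * h1 + this

end Separable

instance (n : ℕ) (p : Cn n) : CharZero (Hol p) :=
  charZero_of_injective_ringHom (constGerm p).injective

theorem orderAlong_unit_mul (u : (Hol p)ˣ) (f : Hol p) :
    orderAlong Φ ((u : Hol p) * f) = orderAlong Φ f := by
  rw [orderAlong_mul, (orderAlong_eq_zero_iff Φ).2 (isUnit_iff_ev.1 u.isUnit), zero_add]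

/-- Regularity in a given direction is an open condition. -/
theorem eventually_orderAlong_ne_top {f : Hol p} (hf : orderAlong Φ f ≠ ⊤) :
    ∀ᶠ x in 𝓝 p, orderAlong Φ (germAt f x) ≠ ⊤ := by
  obtain ⟨d, hd⟩ := ENat.ne_top_iff_exists.1 hf
  obtain ⟨w, u, hw, -, rfl, -⟩ := exists_preparation hd.symm
  have hu : ∀ᶠ x in 𝓝 p, ev x (germAt (u : Hol p) x) ≠ 0 := by
    filter_upwards [ev_germAt (u : Hol p), (rep_analyticAt (u : Hol p)).continuousAt.eventually_ne
      (isUnit_iff_ev.1 u.isUnit)] with x h1 h2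
    rwa [h1]
  filter_upwards [hu, germAt_mul (u : Hol p) (polyGerm Φ p w), germAt_polyGerm Φ w,
    (tendsto_proj Φ p).eventually (germPolyAt_monic hw)] with x h1 h2 h3 h4
  rw [h2, orderAlong_mul, (orderAlong_eq_zero_iff Φ).2 h1, zero_add, h3]
  exact orderAlong_polyGerm_ne_top Φ (h4.1.map _).ne_zero

/-- If `f` generates a radical ideal and is regular in the direction of `Φ`, then the ideal
generated by `f` and its derivative in this direction contains a nonzero function of the remaining
coordinates: the discriminant of the Weierstrass polynomial of `f`. -/
theorem exists_pullback_mem {f : Hol p} (hf : orderAlong Φ f ≠ ⊤) (hr : IsRadical f) :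
    ∃ Δ : Hol (Φ p).1, Δ ≠ 0 ∧ ∃ U V : Hol p, pullback Φ p Δ = U * f + V * dirDeriv Φ.dir f := by
  obtain ⟨d, hd⟩ := ENat.ne_top_iff_exists.1 hf
  obtain ⟨w, u, hw, hwd, rfl, -⟩ := exists_preparation hd.symm
  rw [orderAlong_unit_mul, ← hwd] at hd
  have hr' : IsRadical (polyGerm Φ p w) := fun k g hg =>
    (u.isUnit.mul_left_dvd).1 (hr k g ((u.isUnit.mul_left_dvd).2 hg))
  obtain ⟨Δ, hΔ, a, b, h⟩ := exists_discriminant hw ((isRadical_polyGerm_iff hw hd.symm).1 hr')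
  obtain ⟨u', v', hu, hu'⟩ : ∃ u' v' : Hol p, v' * u' = 1 ∧ u' = u := ⟨u, ↑u⁻¹, u.inv_mul, rfl⟩
  rw [← hu', dirDeriv_mul]
  refine ⟨Δ, hΔ, polyGerm Φ p a * v' - polyGerm Φ p b * (v' * v' * dirDeriv Φ.dir u'),
    polyGerm Φ p b * v', ?_⟩
  have h1 := congrArg (polyGerm Φ p) h
  rw [map_add, map_mul, map_mul, polyGerm_C, ← dirDeriv_polyGerm] at h1
  rw [← h1]
  linear_combination (-(polyGerm Φ p a * polyGerm Φ p w) - polyGerm Φ p b *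
    dirDeriv Φ.dir (polyGerm Φ p w) + polyGerm Φ p b * v' * polyGerm Φ p w *
    dirDeriv Φ.dir u') * hu

/-- The converse of `exists_pullback_mem`. -/
theorem isRadical_of_pullback_mem {f : Hol p} (hf : orderAlong Φ f ≠ ⊤) {Δ : Hol (Φ p).1}
    (hΔ : Δ ≠ 0) {U V : Hol p} (h : pullback Φ p Δ = U * f + V * dirDeriv Φ.dir f) :
    IsRadical f := by
  obtain ⟨d, hd⟩ := ENat.ne_top_iff_exists.1 hf
  obtain ⟨w, u, hw, hwd, rfl, -⟩ := exists_preparation hd.symm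
  rw [orderAlong_unit_mul, ← hwd] at hd
  rw [dirDeriv_mul, dirDeriv_polyGerm] at h
  obtain ⟨q, r, -, hV⟩ := exists_division hd.symm (V * (u : Hol p))
  have h1 : polyGerm Φ p w ∣ polyGerm Φ p (C Δ - r * derivative w) := by
    rw [map_sub, map_mul, polyGerm_C, h]
    refine ⟨U * (u : Hol p) + V * dirDeriv Φ.dir (u : Hol p) + q * polyGerm Φ p (derivative w), ?_⟩
    linear_combination polyGerm Φ p (derivative w) * hV
  obtain ⟨a, ha⟩ := (polyGerm_dvd_polyGerm_iff hw hd.symm _).1 h1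
  have h2 : IsRadical w := isRadical_of_discriminant hw hΔ (a := a) (b := r)
    (by linear_combination -ha)
  have h3 := (isRadical_polyGerm_iff hw hd.symm).2 h2
  exact fun k g hg =>
    (u.isUnit.mul_left_dvd).2 (h3 k g ((u.isUnit.mul_left_dvd).1 hg))

/-- Reducedness of a principal germ is an open condition: the discriminant of the Weierstrass
polynomial at `p` is still a nonzero function in the ideal of the germ and its derivative at the
points near `p`. -/
theorem eventually_isRadical {f : Hol p} (hf : f ≠ 0) (hr : IsRadical f) :
    ∀ᶠ x in 𝓝 p, IsRadical (germAt f x) := by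
  obtain ⟨Φ, hΦ⟩ := exists_orderAlong_ne_top hf
  obtain ⟨Δ, hΔ, U, V, h⟩ := exists_pullback_mem hΦ hr
  filter_upwards [eventually_orderAlong_ne_top hΦ, germAt_pullback Φ Δ,
    (tendsto_proj Φ p).eventually (germAt_ne_zero hΔ), germAt_add (U * f) (V * dirDeriv Φ.dir f),
    germAt_mul U f, germAt_mul V (dirDeriv Φ.dir f), germAt_dirDeriv Φ.dir f]
    with x h1 h2 h3 h4 h5 h6 h7
  refine isRadical_of_pullback_mem h1 h3 (U := germAt U x) (V := germAt V x) ?_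
  rw [← h2, h, h4, h5, h6, h7]

end Reduced

/-! ### Elimination of one variable -/

section Elimination

/-- The resultant in `X` of `w` and of the generic combination `∑ T ^ j * r j` of the polynomials
`r j`, for the formal degrees `d` and `N`. It is a polynomial in `T` whose coefficients lie in the
ideal of `w` and the `r j`. -/
def eliminant {R : Type*} [CommRing R] {m : ℕ} (w : R[X]) (r : Fin m → R[X]) (d N : ℕ) : R[X] :=
  resultant (w.map C) (∑ j : Fin m, C (X ^ (j : ℕ)) * (r j).map C) d N

theorem eliminant_map {R S : Type*} [CommRing R] [CommRing S] (φ : R →+* S) {m : ℕ} (w : R[X])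
    (r : Fin m → R[X]) (d N : ℕ) :
    eliminant (w.map φ) (fun j => (r j).map φ) d N = (eliminant w r d N).map φ := by
  have h : ∀ r : R[X], (r.map φ).map C = (r.map C).map (mapRingHom φ) := by
    intro r
    rw [Polynomial.map_map, Polynomial.map_map]
    congr 1; ext; simp
  rw [eliminant, eliminant]
  change _ = (mapRingHom φ) (resultant _ _ d N)
  rw [← resultant_map_map, h]
  congr 1
  rw [Polynomial.map_sum]
  refine Finset.sum_congr rfl fun j _ => ?_
  rw [h, Polynomial.map_mul, map_C]
  simp

theorem natDegree_combination_le {R : Type*} [CommRing R] {m N : ℕ} {r : Fin m → R[X]}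
    (hr : ∀ j, (r j).natDegree ≤ N) :
    (∑ j : Fin m, C (X ^ (j : ℕ)) * (r j).map (C : R →+* R[X])).natDegree ≤ N :=
  natDegree_sum_le_of_forall_le _ _ fun j _ =>
    (natDegree_C_mul_le _ _).trans (natDegree_map_le.trans (hr j))

/-- The eliminant lies in the ideal generated by `w` and the `r j`, so that it vanishes under every
ring homomorphism for which these polynomials have a common zero. -/
theorem eliminant_map_eq_zero {R S : Type*} [CommRing R] [CommRing S] (φ : R →+* S) {m : ℕ}
    {w : R[X]} {r : Fin m → R[X]} {d N : ℕ} (hd : w.natDegree ≤ d) (hr : ∀ j, (r j).natDegree ≤ N)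
    (hN : N ≠ 0) {z : S} (hw : w.eval₂ φ z = 0) (hz : ∀ j, (r j).eval₂ φ z = 0) :
    (eliminant w r d N).map φ = 0 := by
  obtain ⟨a, b, -, -, h⟩ := exists_mul_add_mul_eq_C_resultant (m := d) (n := N) (w.map C)
    (∑ j : Fin m, C (X ^ (j : ℕ)) * (r j).map C) (natDegree_map_le.trans hd)
    (natDegree_combination_le hr) (Or.inr hN)
  have key : ∀ r : R[X], (r.map C).eval₂ (mapRingHom φ) (C z) = C (r.eval₂ φ z) := by
    intro r
    rw [eval₂_map, hom_eval₂]
    congr 1; ext; simp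
  have h1 := congrArg (eval₂ (mapRingHom φ) (C z)) h
  rw [eval₂_C, eval₂_add, eval₂_mul, eval₂_mul, key, hw, eval₂_finsetSum] at h1
  simp only [eval₂_mul, key, hz, C_0, mul_zero, zero_mul, Finset.sum_const_zero, add_zero] at h1
  rw [eliminant, ← coe_mapRingHom, ← h1]

/-- If the eliminant over an algebraically closed field is zero, then some root `z` of `w` makes
`∑ T ^ j * r j z` the zero polynomial in `T`, that is, `z` is a common root. -/
theorem exists_common_root {K : Type*} [Field K] [IsAlgClosed K] {m : ℕ} {w : K[X]}
    {r : Fin m → K[X]} {N : ℕ} (hw : w.Monic) (hr : ∀ j, (r j).natDegree ≤ N)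
    (h : eliminant w r w.natDegree N = 0) : ∃ z, w.eval z = 0 ∧ ∀ j, (r j).eval z = 0 := by
  have hs : (w.map (C : K →+* K[X])).Splits := (IsAlgClosed.splits w).map C
  have h1 := resultant_eq_prod_eval (w.map (C : K →+* K[X])) _ N (natDegree_combination_le hr) hs
  rw [hw.natDegree_map] at h1
  rw [eliminant] at h
  rw [h, (hw.map C).leadingCoeff, one_pow, one_mul, eq_comm, Multiset.prod_eq_zero_iff,
    Multiset.mem_map] at h1
  obtain ⟨z', hz', h2⟩ := h1
  rw [← roots_map_of_injective_of_card_eq_natDegree C_injective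
    ((IsAlgClosed.splits w).natDegree_eq_card_roots).symm, Multiset.mem_map] at hz'
  obtain ⟨z, hz, rfl⟩ := hz'
  refine ⟨z, (mem_roots'.1 hz).2, fun j => ?_⟩
  have h3 : (∑ j : Fin m, C ((r j).eval z) * X ^ (j : ℕ) : K[X]) = 0 := by
    rw [← h2, eval_finsetSum]
    refine Finset.sum_congr rfl fun j _ => ?_
    rw [eval_mul, eval_C, eval_map, eval₂_at_apply, mul_comm]
  have h4 := congrArg (fun P => coeff P (j : ℕ)) h3
  simp only [finsetSum_coeff, coeff_C_mul, coeff_X_pow, coeff_zero, Fin.val_inj] at h4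
  simpa using h4

end Elimination

section PolyValue

variable {n : ℕ} {q : Cn n}

/-- The polynomial with coefficients in the ring of functions formed by the representatives of the
coefficients of `r`. -/
def polyRep (r : (Hol q)[X]) : (Cn n → ℂ)[X] :=
  ∑ k ∈ Finset.range (r.natDegree + 1), monomial k (rep (r.coeff k))

/-- The complex polynomial whose coefficients are the values at `y` of the coefficients of `r`. -/
def polyValue (r : (Hol q)[X]) (y : Cn n) : ℂ[X] := (polyRep r).map (Pi.evalRingHom _ y)

theorem polyRep_map (r : (Hol q)[X]) :
    (polyRep r).map (Germ.coeRingHom (𝓝 q)) = r.map (holGerms q).subtype := by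
  ext k
  simp only [polyRep, Polynomial.map_sum, map_monomial, finsetSum_coeff, coeff_monomial, coeff_map,
    Germ.coe_coeRingHom, coe_rep]
  rw [Finset.sum_ite_eq' _ k]
  split_ifs with h
  · rfl
  · rw [coeff_eq_zero_of_natDegree_lt (by simpa using h), map_zero]

theorem natDegree_polyRep_le (r : (Hol q)[X]) : (polyRep r).natDegree ≤ r.natDegree :=
  natDegree_sum_le_of_forall_le _ _ fun _ hk =>
    (natDegree_monomial_le _).trans (Finset.mem_range_succ_iff.1 hk)

theorem natDegree_polyValue_le (r : (Hol q)[X]) (y : Cn n) :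
    (polyValue r y).natDegree ≤ r.natDegree :=
  natDegree_map_le.trans (natDegree_polyRep_le r)

theorem polyValue_coeff (r : (Hol q)[X]) :
    ∀ᶠ y in 𝓝 q, ∀ k, (polyValue r y).coeff k = rep (r.coeff k) y := by
  filter_upwards [rep_zero (p := q)] with y hy k
  simp only [polyValue, polyRep, Polynomial.map_sum, map_monomial, finsetSum_coeff, coeff_monomial]
  rw [Finset.sum_ite_eq' _ k]
  split_ifs with h
  · rfl
  · rw [coeff_eq_zero_of_natDegree_lt (by simpa using h), hy]

theorem polyValue_eq (r : (Hol q)[X]) :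
    ∀ᶠ y in 𝓝 q, (germPolyAt r y).map (ev _) = polyValue r y := by
  filter_upwards [polyValue_coeff r, coeff_germPolyAt r, eventually_all_finset
    (Finset.range (r.natDegree + 1)) |>.2 fun k _ => ev_germAt (r.coeff k)] with y h1 h2 h3
  ext k
  by_cases hk : k ∈ Finset.range (r.natDegree + 1)
  · rw [coeff_map, h1, h2, h3 k hk]
  · have hk' : r.natDegree < k := by simpa using hk
    rw [coeff_eq_zero_of_natDegree_lt ((natDegree_map_le.trans
      (natDegree_germPolyAt_le r y)).trans_lt hk'),
      coeff_eq_zero_of_natDegree_lt ((natDegree_polyValue_le r y).trans_lt hk')]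

theorem polyValue_monic {w : (Hol q)[X]} (hw : w.Monic) :
    ∀ᶠ y in 𝓝 q, (polyValue w y).Monic ∧ (polyValue w y).natDegree = w.natDegree := by
  filter_upwards [polyValue_eq w, germPolyAt_monic hw] with y h1 h2
  rw [← h1]
  exact ⟨h2.1.map _, by rw [h2.1.natDegree_map, h2.2]⟩

theorem rep_polyGerm_eq {n : ℕ} {p : Cn (n + 1)} (Φ : Splitting n) (r : (Hol (Φ p).1)[X]) :
    ∀ᶠ x in 𝓝 p, rep (polyGerm Φ p r) x = (polyValue r (Φ x).1).eval (Φ x).2 := by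
  filter_upwards [rep_polyGerm Φ r, (tendsto_proj Φ p).eventually (polyValue_eq r)] with x h1 h2
  rw [h1, h2]

/-- Near `q` the eliminant of the values is the value of the eliminant: its vanishing at `y` is
expressed by finitely many of its coefficients. -/
theorem eliminant_polyValue {m : ℕ} (w : (Hol q)[X]) (r : Fin m → (Hol q)[X]) (d N : ℕ) :
    ∃ M : ℕ, ∀ᶠ y in 𝓝 q, (∀ k : Fin M, rep ((eliminant w r d N).coeff k) y = 0) →
      eliminant (polyValue w y) (fun j => polyValue (r j) y) d N = 0 := by
  set E := eliminant (polyRep w) (fun j => polyRep (r j)) d N with hE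
  have h1 : E.map (Germ.coeRingHom (𝓝 q)) = (eliminant w r d N).map (holGerms q).subtype := by
    rw [hE, ← eliminant_map, ← eliminant_map, polyRep_map]
    simp only [polyRep_map]
  have h2 : ∀ k, rep ((eliminant w r d N).coeff k) =ᶠ[𝓝 q] E.coeff k := by
    intro k
    refine rep_eq_of_coe ?_
    have := congrArg (fun P => P.coeff k) h1
    simp only [coeff_map] at this
    exact this.symm
  refine ⟨E.natDegree + 1, ?_⟩
  filter_upwards [eventually_all.2 fun k : Fin (E.natDegree + 1) => h2 k] with y hy h0
  have h3 : eliminant (polyValue w y) (fun j => polyValue (r j) y) d N =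
      E.map (Pi.evalRingHom _ y) := by
    rw [hE, ← eliminant_map]; rfl
  rw [h3]
  ext k
  rw [coeff_map, coeff_zero]
  by_cases hk : k < E.natDegree + 1
  · have := hy ⟨k, hk⟩
    simp only at this
    rw [h0 ⟨k, hk⟩] at this
    exact this.symm
  · rw [coeff_eq_zero_of_natDegree_lt (by omega), map_zero]

/-- The roots of a Weierstrass polynomial tend to the centre. -/
theorem eventually_roots_near {w : (Hol q)[X]} (hw : w.Monic) {c : ℂ}
    (hc : w.map (ev q) = (X - C c) ^ w.natDegree) {U : ℂ → Prop} (hU : ∀ᶠ z in 𝓝 c, U z) :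
    ∀ᶠ y in 𝓝 q, ∀ z, (polyValue w y).eval z = 0 → U z := by
  obtain ⟨ε, hε, hεU⟩ := Metric.eventually_nhds_iff.1 hU
  by_cases hd : w.natDegree = 0
  · filter_upwards [polyValue_monic hw] with y hy z hz
    rw [eq_one_of_monic_natDegree_zero hy.1 (hy.2.trans hd)] at hz
    simp at hz
  set d := w.natDegree with hdd
  obtain ⟨δ, hδ, hδ1, hδ2⟩ : ∃ δ : ℝ, 0 < δ ∧ δ ≤ 1 / 2 ∧ δ * (2 * ‖c‖ + 2) ≤ ε := by
    refine ⟨min (1 / 2) (ε / (2 * ‖c‖ + 2)), by positivity, min_le_left _ _, ?_⟩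
    have : (0 : ℝ) < 2 * ‖c‖ + 2 := by positivity
    calc _ ≤ ε / (2 * ‖c‖ + 2) * (2 * ‖c‖ + 2) := by gcongr; exact min_le_right _ _
      _ = ε := by field_simp
  set η : ℝ := δ ^ d / (d + 1) with hη
  have hη0 : 0 < η := by positivity
  have hco : ∀ᶠ y in 𝓝 q, ∀ k ∈ Finset.range (d + 1),
      ‖((X - C c) ^ d : ℂ[X]).coeff k - rep (w.coeff k) y‖ < η := by
    refine eventually_all_finset _ |>.2 fun k _ => ?_
    have h1 : ContinuousAt (fun y => ‖((X - C c) ^ d : ℂ[X]).coeff k - rep (w.coeff k) y‖) q :=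
      (continuousAt_const.sub (rep_analyticAt _).continuousAt).norm
    refine h1.eventually_lt continuousAt_const ?_
    rw [← hc, coeff_map, ev_apply, sub_self, norm_zero]; exact hη0
  filter_upwards [hco, polyValue_coeff w, polyValue_monic hw] with y h1 h2 h3 z hz
  have hnd : ((X - C c) ^ d : ℂ[X]).natDegree = d := by simp
  obtain ⟨b, hb, hlt⟩ := exists_roots_norm_sub_lt_of_norm_coeff_sub_lt (g := (X - C c) ^ d) hη0 hz
    h3.1 ((monic_X_sub_C c).pow d) (hnd.trans h3.2.symm) (fun k => by
      by_cases hk : k ∈ Finset.range (d + 1)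
      · rw [h2]; exact h1 k hk
      · have hk' : d < k := by simpa using hk
        rw [coeff_eq_zero_of_natDegree_lt (hnd.trans_lt hk'),
          coeff_eq_zero_of_natDegree_lt (h3.2.trans_lt hk'), sub_zero, norm_zero]
        exact hη0) (IsAlgClosed.splits _)
  have hbc : b = c := by
    have := (mem_roots'.1 hb).2
    rw [IsRoot, eval_pow, eval_sub, eval_X, eval_C] at this
    exact sub_eq_zero.1 (pow_eq_zero_iff hd |>.1 this)
  have e : ((((polyValue w y).natDegree : ℝ) + 1) * η) ^ (((polyValue w y).natDegree : ℝ))⁻¹ =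
      δ := by
    rw [h3.2, hη, mul_div_cancel₀ _ (by positivity), ← Real.rpow_natCast,
      ← Real.rpow_mul hδ.le, mul_inv_cancel₀ (by exact_mod_cast hd), Real.rpow_one]
  rw [e, hbc] at hlt
  have hz1 : ‖z‖ ≤ 2 * ‖c‖ + 1 := by
    have := norm_sub_norm_le z c
    rcases max_cases ‖z‖ 1 with ⟨hm, -⟩ | ⟨hm, hm'⟩
    · rw [hm] at hlt; nlinarith [norm_nonneg z]
    · have := norm_nonneg c; linarith
  refine hεU ?_
  rw [dist_eq_norm]
  refine hlt.trans_le (le_trans ?_ hδ2)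
  gcongr
  exact max_le (by linarith) (by have := norm_nonneg c; linarith)

end PolyValue

/-! ### Rückert's Nullstellensatz -/

section Nullstellensatz

variable {n : ℕ}

/-- A germ vanishes at the common zeros of the divisor and of the remainder of a division. -/
theorem eventually_rep_eq_zero_of_division {p : Cn (n + 1)} {Φ : Splitting n}
    {w r : (Hol (Φ p).1)[X]} {q F : Hol p}
    (h : F = q * polyGerm Φ p w + polyGerm Φ p r) :
    ∀ᶠ x in 𝓝 p, (polyValue w (Φ x).1).eval (Φ x).2 = 0 →
      (polyValue r (Φ x).1).eval (Φ x).2 = 0 → rep F x = 0 := by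
  filter_upwards [rep_polyGerm_eq Φ w, rep_polyGerm_eq Φ r, rep_add (q * polyGerm Φ p w)
    (polyGerm Φ p r), rep_mul q (polyGerm Φ p w)] with x h1 h2 h3 h4 h5 h6
  rw [h, h3, h4, h1, h2, h5, h6, mul_zero, add_zero]

/-- An element outside a prime ideal that contains a monic polynomial germ divides, modulo the
prime, a function of the remaining coordinates outside the prime: the quotient is integral. -/
theorem exists_pullback_mem_sup {p : Cn (n + 1)} {Φ : Splitting n} {P : Ideal (Hol p)} [P.IsPrime]
    {w : (Hol (Φ p).1)[X]} (hw : w.Monic) (hd : orderAlong Φ (polyGerm Φ p w) = w.natDegree)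
    (hwP : polyGerm Φ p w ∈ P) {f : Hol p} (hf : f ∉ P) :
    ∃ a, a ∉ P.comap (pullback Φ p) ∧ ∃ b ∈ P, ∃ c, pullback Φ p a = b + c * f := by
  obtain ⟨q, r, -, hr⟩ := exists_division hd f
  have hrP : polyGerm Φ p r ∉ P := fun h => hf (by
    rw [hr]; exact P.add_mem (P.mul_mem_left _ hwP) h)
  have : Module.Finite (Hol (Φ p).1) (AdjoinRoot w) := hw.finite_adjoinRoot
  obtain ⟨g, hg, hg0⟩ := Algebra.IsIntegral.isIntegral (R := Hol (Φ p).1) (AdjoinRoot.mk w r)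
  set θ : AdjoinRoot w →+* Hol p ⧸ P := AdjoinRoot.lift ((Ideal.Quotient.mk P).comp (pullback Φ p))
    (Ideal.Quotient.mk P (coordGerm Φ p)) (by
      rw [← hom_eval₂, ← polyGerm_apply]; exact Ideal.Quotient.eq_zero_iff_mem.2 hwP) with hθ
  have h1 : θ (AdjoinRoot.mk w r) = Ideal.Quotient.mk P (polyGerm Φ p r) := by
    rw [hθ, AdjoinRoot.lift_mk, ← hom_eval₂, ← polyGerm_apply]
  have h2 : θ.comp (algebraMap (Hol (Φ p).1) (AdjoinRoot w)) =
      (Ideal.Quotient.mk P).comp (pullback Φ p) := by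
    rw [hθ]; exact AdjoinRoot.lift_comp_of _
  have h3 : g.eval₂ (pullback Φ p) (polyGerm Φ p r) ∈ P := by
    have := congrArg θ hg0
    rw [hom_eval₂, map_zero, h1, h2, ← hom_eval₂] at this
    exact Ideal.Quotient.eq_zero_iff_mem.1 this
  have h4 := Ideal.comap_lt_comap_of_root_mem_sdiff (f := pullback Φ p) (I := P)
    (J := P ⊔ Ideal.span {polyGerm Φ p r}) le_sup_left
    ⟨Ideal.mem_sup_right (Ideal.mem_span_singleton_self _), hrP⟩
    (map_monic_ne_zero hg) h3
  obtain ⟨-, a, ha, haP⟩ := SetLike.lt_iff_le_and_exists.1 h4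
  obtain ⟨b, hb, c', hc, hbc⟩ := Submodule.mem_sup.1 (Ideal.mem_comap.1 ha)
  obtain ⟨c, rfl⟩ := Ideal.mem_span_singleton'.1 hc
  refine ⟨a, haP, b - c * q * polyGerm Φ p w, P.sub_mem hb (P.mul_mem_left _ hwP), c, ?_⟩
  rw [← hbc, hr]; ring

/-- The zeros of a prime ideal near `p` are not contained in the zeros of a germ outside it. The
zeros of the contraction of the prime to one variable fewer lift, since the vanishing of the
eliminant gives a common root. -/
theorem frequently_zero_of_isPrime (n : ℕ) (p : Cn n) (P : Ideal (Hol p)) [P.IsPrime] {f : Hol p}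
    (hf : f ∉ P) {m : ℕ} (F : Fin m → Hol p) (hF : ∀ j, F j ∈ P) :
    ∃ᶠ x in 𝓝 p, (∀ j, rep (F j) x = 0) ∧ rep f x ≠ 0 := by
  induction n generalizing m with
  | zero =>
    intro h
    refine h.self_of_nhds ⟨fun j => ev_eq_zero_of_mem (Ideal.IsPrime.ne_top ‹_›) (hF j),
      ev_ne_zero_of_dim_zero fun h0 => hf (h0 ▸ P.zero_mem)⟩
  | succ n ih =>
    by_cases hP : P = ⊥
    · have h0 : ∀ j, ∀ᶠ x in 𝓝 p, rep (F j) x = 0 := by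
        intro j
        have : F j = 0 := by simpa [hP] using hF j
        rw [this]; exact rep_zero
      refine (frequently_rep_ne_zero (φ := f) fun h => hf (h ▸ P.zero_mem)).mp ?_
      filter_upwards [eventually_all.2 h0] with x hx h using ⟨hx, h⟩
    obtain ⟨g, hgP, hg⟩ := Submodule.exists_mem_ne_zero_of_ne_bot hP
    obtain ⟨Φ, hΦ⟩ := exists_orderAlong_ne_top hg
    obtain ⟨d, hd⟩ := ENat.ne_top_iff_exists.1 hΦ
    obtain ⟨w, u, hw, hwd, rfl, hwc⟩ := exists_preparation hd.symm
    rw [orderAlong_unit_mul] at hd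
    subst hwd
    have hwP : polyGerm Φ p w ∈ P := (Ideal.unit_mul_mem_iff_mem P u.isUnit).1 hgP
    obtain ⟨a, ha, b, hb, c, hab⟩ := exists_pullback_mem_sup hw hd.symm hwP hf
    have hF' : ∀ j, (Fin.cons b F : Fin (m + 1) → Hol p) j ∈ P :=
      Fin.cases hb hF
    choose Q r hrd hr using fun j => exists_division hd.symm
      ((Fin.cons b F : Fin (m + 1) → Hol p) j)
    have hrP : ∀ j, polyGerm Φ p (r j) ∈ P := fun j => by
      have : polyGerm Φ p (r j) = (Fin.cons b F : Fin (m + 1) → Hol p) j -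
        Q j * polyGerm Φ p w := by rw [hr j]; ring
      rw [this]; exact P.sub_mem (hF' j) (P.mul_mem_left _ hwP)
    have hrN : ∀ j, (r j).natDegree ≤ w.natDegree + 1 := fun j =>
      (natDegree_le_of_degree_le (hrd j).le).trans (Nat.le_succ _)
    obtain ⟨M, hM⟩ := eliminant_polyValue w r w.natDegree (w.natDegree + 1)
    set E := eliminant w r w.natDegree (w.natDegree + 1) with hE
    have hEP : ∀ k, E.coeff k ∈ P.comap (pullback Φ p) := by
      intro k
      have h1 : E.map ((Ideal.Quotient.mk P).comp (pullback Φ p)) = 0 := by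
        refine eliminant_map_eq_zero _ le_rfl hrN (Nat.succ_ne_zero _)
          (z := Ideal.Quotient.mk P (coordGerm Φ p)) ?_ fun j => ?_
        · rw [← hom_eval₂, ← polyGerm_apply]; exact Ideal.Quotient.eq_zero_iff_mem.2 hwP
        · rw [← hom_eval₂, ← polyGerm_apply]; exact Ideal.Quotient.eq_zero_iff_mem.2 (hrP j)
      have h2 := congrArg (fun P => P.coeff k) h1
      simp only [coeff_map, coeff_zero, RingHom.comp_apply] at h2
      exact Ideal.mem_comap.2 (Ideal.Quotient.eq_zero_iff_mem.1 h2)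
    have hfreq := ih (Φ p).1 (P.comap (pullback Φ p)) ha (fun k : Fin M => E.coeff k)
      fun k => hEP k
    intro hcon
    have hall : ∀ᶠ x in 𝓝 p, (rep (pullback Φ p a) x = rep a (Φ x).1 ∧
        rep (pullback Φ p a) x = rep b x + rep c x * rep f x) ∧
        (∀ j, (polyValue w (Φ x).1).eval (Φ x).2 = 0 → (polyValue (r j) (Φ x).1).eval (Φ x).2 = 0 →
          rep ((Fin.cons b F : Fin (m + 1) → Hol p) j) x = 0) ∧
        ¬((∀ j, rep (F j) x = 0) ∧ rep f x ≠ 0) := by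
      filter_upwards [rep_pullback Φ p a, eventually_all.2 fun j =>
        eventually_rep_eq_zero_of_division (hr j), hcon, rep_add b (c * f), rep_mul c f]
        with x h1 h2 h3 h4 h5
      exact ⟨⟨h1, by rw [hab, h4, h5]⟩, h2, h3⟩
    have hall' := (Φ.symm.continuous.tendsto' ((Φ p).1, (Φ p).2) p (by simp)).eventually hall
    rw [nhds_prod_eq] at hall'
    obtain ⟨pa, hpa, pb, hpb, hab'⟩ := eventually_prod_iff.1 hall'
    obtain ⟨y, ⟨hy0, hya⟩, hy1, hy2, hy3, hy4⟩ := (hfreq.and_eventually (hpa.and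
      ((eventually_roots_near hw hwc hpb).and (hM.and (polyValue_monic hw))))).exists
    obtain ⟨z, hz, hz'⟩ := exists_common_root hy4.1 (fun j => (natDegree_polyValue_le (r j) y).trans
      (hrN j)) (by rw [hy4.2]; exact hy3 hy0)
    obtain ⟨⟨h1, h2⟩, h3, h4⟩ := hab' hy1 (hy2 z hz)
    simp only [ContinuousLinearEquiv.apply_symm_apply] at h1 h3
    have h5 := fun j => h3 j hz (hz' j)
    refine h4 ⟨fun j => by simpa using h5 j.succ, fun h0 => hya ?_⟩
    rw [← h1, h2, h0, mul_zero, add_zero]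
    simpa using h5 0

/-- Rückert's Nullstellensatz: a germ that vanishes on the common zeros of a finite family lies in
the radical of the ideal generated by the family. -/
theorem mem_radical_of_eventually {p : Cn n} {m : ℕ} {F : Fin m → Hol p} {f : Hol p}
    (h : ∀ᶠ x in 𝓝 p, (∀ j, rep (F j) x = 0) → rep f x = 0) :
    f ∈ (Ideal.span (Set.range F)).radical := by
  rw [Ideal.radical_eq_sInf, Ideal.mem_sInf]
  rintro P ⟨hP, hPp⟩
  by_contra hf
  obtain ⟨x, ⟨h1, h2⟩, h3⟩ := ((frequently_zero_of_isPrime n p P hf F fun j =>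
    hP (Ideal.subset_span ⟨j, rfl⟩)).and_eventually h).exists
  exact h2 (h3 h1)

theorem eventually_rep_eq_zero_of_mem_radical {p : Cn n} {ι : Type*} [Finite ι] {F : ι → Hol p}
    {f : Hol p} (h : f ∈ (Ideal.span (Set.range F)).radical) :
    ∀ᶠ x in 𝓝 p, (∀ j, rep (F j) x = 0) → rep f x = 0 := by
  cases nonempty_fintype ι
  obtain ⟨k, hk⟩ := h
  obtain ⟨c, hc⟩ := Submodule.mem_span_range_iff_exists_fun _ |>.1 hk
  filter_upwards [rep_pow f k, rep_sum Finset.univ fun i => c i • F i,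
    eventually_all.2 fun i => rep_mul (c i) (F i)] with x h1 h2 h4
  rw [← hc, h2] at h1
  intro h0
  refine eq_zero_of_pow_eq_zero (n := k) (h1.symm.trans (Finset.sum_eq_zero fun i _ => ?_))
  rw [smul_eq_mul, h4, h0, mul_zero]

/-- Two germs that generate radical ideals and have the same zeros are associated. -/
theorem associated_of_isRadical {p : Cn n} {f g : Hol p} (hf : IsRadical f) (hg : IsRadical g)
    (h : ∀ᶠ x in 𝓝 p, rep f x = 0 ↔ rep g x = 0) : Associated f g := by
  have key : ∀ {f g : Hol p}, IsRadical f → (∀ᶠ x in 𝓝 p, rep f x = 0 ↔ rep g x = 0) → f ∣ g := by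
    intro f g hf h
    have := mem_radical_of_eventually (F := fun _ : Fin 1 => f) (f := g)
      (h.mono fun x hx h0 => hx.1 (h0 0))
    rw [Set.range_const, ((span_isRadical_iff f).2 hf).radical] at this
    exact Ideal.mem_span_singleton.1 this
  exact associated_of_dvd_dvd (key hf h) (key hg (h.mono fun x hx => hx.symm))

end Nullstellensatz

section ZeroLocus

variable {n : ℕ} {I J : Ideal (Hol (0 : Cn n))}

theorem exists_generators (I : Ideal (Hol (0 : Cn n))) :
    ∃ (m : ℕ) (F : Fin m → Hol (0 : Cn n)), Ideal.span (Set.range F) = I ∧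
      zeroLocus I = {x | ∀ j, rep (F j) x = 0} := by
  have h : I.FG := IsNoetherian.noetherian I
  refine ⟨h.choose.card, fun j => (h.choose.equivFin.symm j : Hol (0 : Cn n)), ?_, ?_⟩
  · conv_rhs => rw [← h.choose_spec]
    congr 1
    ext φ
    simp only [Set.mem_range, SetLike.mem_coe]
    exact ⟨fun ⟨j, hj⟩ => hj ▸ (h.choose.equivFin.symm j).2,
      fun hφ => ⟨h.choose.equivFin ⟨φ, hφ⟩, by simp⟩⟩
  · rw [zeroLocus, dif_pos h]
    ext x
    simp only [Set.mem_ofPred_eq]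
    exact ⟨fun hx j => hx _ (h.choose.equivFin.symm j).2,
      fun hx φ hφ => by simpa using hx (h.choose.equivFin ⟨φ, hφ⟩)⟩

/-- The Nullstellensatz for zero loci. -/
theorem le_radical_iff : J ≤ I.radical ↔ ∀ᶠ x in 𝓝 0, x ∈ zeroLocus I → x ∈ zeroLocus J := by
  obtain ⟨m, F, rfl, hF⟩ := exists_generators I
  obtain ⟨k, G, rfl, hG⟩ := exists_generators J
  rw [hF, hG]
  simp only [Set.mem_ofPred_eq]
  constructor
  · intro h
    have := fun j => eventually_rep_eq_zero_of_mem_radical (h (Ideal.subset_span ⟨j, rfl⟩) :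
      G j ∈ (Ideal.span (Set.range F)).radical)
    filter_upwards [eventually_all.2 this] with x hx h0 j using hx j h0
  · intro h
    rw [Ideal.span_le]
    rintro _ ⟨j, rfl⟩
    exact mem_radical_of_eventually (h.mono fun x hx h0 => hx h0 j)

theorem radical_eq_radical_iff : I.radical = J.radical ↔ SameGerm (zeroLocus I) (zeroLocus J) := by
  rw [SameGerm, le_antisymm_iff, Ideal.radical_le_radical_iff, Ideal.radical_le_radical_iff,
    le_radical_iff, le_radical_iff, ← eventually_and]
  exact eventually_congr (Eventually.of_forall fun x => by tauto)

/-- The zero locus is computed by any finite family of germs generating the ideal up to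
radical. -/
theorem sameGerm_zeroLocus_of_radical {ι : Type*} [Finite ι] {G : ι → Hol (0 : Cn n)}
    (h : I.radical = (Ideal.span (Set.range G)).radical) :
    SameGerm (zeroLocus I) {x | ∀ j, rep (G j) x = 0} := by
  obtain ⟨m, F, rfl, hF⟩ := exists_generators I
  have h1 := fun j => eventually_rep_eq_zero_of_mem_radical (F := G) (f := F j)
    (h ▸ Ideal.le_radical (Ideal.subset_span ⟨j, rfl⟩))
  have h2 := fun j => eventually_rep_eq_zero_of_mem_radical (F := F) (f := G j)
    (h.symm ▸ Ideal.le_radical (Ideal.subset_span ⟨j, rfl⟩))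
  filter_upwards [eventually_all.2 h1, eventually_all.2 h2] with x h3 h4
  rw [hF]
  exact ⟨fun h j => h4 j h, fun h j => h3 j h⟩

theorem zero_mem_zeroLocus (h : I ≠ ⊤) : (0 : Cn n) ∈ zeroLocus I := by
  obtain ⟨m, F, rfl, hF⟩ := exists_generators I
  rw [hF]
  exact fun j => ev_eq_zero_of_mem h (Ideal.subset_span ⟨j, rfl⟩)

theorem sameGerm_zeroLocus_empty_iff : SameGerm (zeroLocus I) ∅ ↔ I = ⊤ := by
  constructor
  · intro h
    by_contra hI
    exact (h.self_of_nhds.1 (zero_mem_zeroLocus hI)).elim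
  · rintro rfl
    have := sameGerm_zeroLocus_of_radical (I := ⊤) (G := fun _ : Unit => (1 : Hol (0 : Cn n)))
      (by rw [Set.range_const, Ideal.span_singleton_one])
    filter_upwards [this, rep_one (p := (0 : Cn n))] with x hx h1
    rw [hx]
    simp [h1]

end ZeroLocus

/-! ### Ideals stable under differentiation -/

section Simplicity

variable {n : ℕ}

theorem orderAlong_dirDeriv_add_one {p : Cn (n + 1)} (Φ : Splitting n) {f : Hol p}
    (hf : ev p f = 0) : orderAlong Φ (dirDeriv Φ.dir f) + 1 = orderAlong Φ f := by
  have h1 := (analyticAt_line f Φ.dir).analyticOrderAt_deriv_add_one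
  have h2 : (fun t : ℂ => rep f (p + t • Φ.dir) - rep f (p + (0 : ℂ) • Φ.dir)) =
      fun t => rep f (p + t • Φ.dir) := by
    ext t
    have : rep f p = 0 := hf
    simp [this]
  have h3 : deriv (fun t : ℂ => rep f (p + t • Φ.dir)) =ᶠ[𝓝 0]
      fun t => rep (dirDeriv Φ.dir f) (p + t • Φ.dir) := by
    filter_upwards [(tendsto_line p Φ.dir).eventually (rep_dirDeriv Φ.dir f),
      (tendsto_line p Φ.dir).eventually (eventually_differentiableAt f)] with t ht hd
    rw [ht]
    have h4 : HasDerivAt (fun t : ℂ => p + t • Φ.dir) Φ.dir t := by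
      simpa using ((hasDerivAt_id t).smul_const Φ.dir).const_add p
    exact (hd.hasFDerivAt.comp_hasDerivAt t h4).deriv
  rw [h2] at h1
  rw [orderAlong, orderAlong, ← analyticOrderAt_congr h3]
  exact h1

theorem exists_iterate_dirDeriv_ne_zero {p : Cn (n + 1)} {Φ : Splitting n} {f : Hol p}
    (hf : orderAlong Φ f ≠ ⊤) : ∃ k, ev p ((dirDeriv Φ.dir)^[k] f) ≠ 0 := by
  obtain ⟨d, hd⟩ := ENat.ne_top_iff_exists.1 hf
  induction d generalizing f with
  | zero => exact ⟨0, (orderAlong_eq_zero_iff Φ).1 hd.symm⟩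
  | succ d ih =>
    have h0 : ev p f = 0 := by
      by_contra h
      rw [(orderAlong_eq_zero_iff Φ).2 h] at hd
      simp at hd
    have h1 := orderAlong_dirDeriv_add_one Φ h0
    rw [← hd] at h1
    have h2 : orderAlong Φ (dirDeriv Φ.dir f) = d := by
      have : orderAlong Φ (dirDeriv Φ.dir f) + 1 = (d : ℕ∞) + 1 := by rw [h1]; simp
      exact WithTop.add_right_cancel ENat.one_ne_top this
    obtain ⟨k, hk⟩ := ih (by rw [h2]; simp) h2.symm
    exact ⟨k + 1, by simpa using hk⟩

theorem orderAlong_ne_top_of_iterate {p : Cn (n + 1)} {Φ : Splitting n} {f : Hol p} {k : ℕ}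
    (hk : ev p ((dirDeriv Φ.dir)^[k] f) ≠ 0) : orderAlong Φ f ≠ ⊤ := by
  induction k generalizing f with
  | zero => rw [(orderAlong_eq_zero_iff Φ (f := f)).2 hk]; simp
  | succ k ih =>
    by_cases h0 : ev p f = 0
    · rw [← orderAlong_dirDeriv_add_one Φ h0]
      have := ih (f := dirDeriv Φ.dir f) (by simpa using hk)
      simpa using this
    · rw [(orderAlong_eq_zero_iff Φ).2 h0]; simp

/-- The ring of germs has no ideals stable under differentiation except the trivial ones. -/
theorem eq_top_of_dirDeriv_stable {p : Cn n} {I : Ideal (Hol p)} (hI : I ≠ ⊥)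
    (h : ∀ v, ∀ φ ∈ I, dirDeriv v φ ∈ I) : I = ⊤ := by
  obtain ⟨f, hfI, hf⟩ := Submodule.exists_mem_ne_zero_of_ne_bot hI
  cases n with
  | zero => exact ideal_eq_top_of_ev hfI (ev_ne_zero_of_dim_zero hf)
  | succ n =>
    obtain ⟨Φ, hΦ⟩ := exists_orderAlong_ne_top hf
    obtain ⟨k, hk⟩ := exists_iterate_dirDeriv_ne_zero hΦ
    refine ideal_eq_top_of_ev (φ := (dirDeriv Φ.dir)^[k] f) ?_ hk
    clear hk
    induction k with
    | zero => exact hfI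
    | succ k ih => rw [Function.iterate_succ_apply']; exact h _ _ ih

end Simplicity

/-! ### Smooth points -/

section Smooth

variable {n : ℕ}

theorem dirDeriv_add_left {p : Cn n} (v w : Cn n) (φ : Hol p) :
    dirDeriv (v + w) φ = dirDeriv v φ + dirDeriv w φ := by
  refine hol_ext ?_
  filter_upwards [rep_dirDeriv (v + w) φ, rep_dirDeriv v φ, rep_dirDeriv w φ,
    rep_add (dirDeriv v φ) (dirDeriv w φ)] with x h1 h2 h3 h4
  rw [h1, h4, h2, h3, map_add]

theorem dirDeriv_smul_left {p : Cn n} (c : ℂ) (v : Cn n) (φ : Hol p) :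
    dirDeriv (c • v) φ = constGerm p c * dirDeriv v φ := by
  refine hol_ext ?_
  filter_upwards [rep_dirDeriv (c • v) φ, rep_dirDeriv v φ, rep_const (p := p) c,
    rep_mul (constGerm p c) (dirDeriv v φ)] with x h1 h2 h3 h4
  rw [h1, h4, h3, h2, map_smul, smul_eq_mul]

theorem dirDeriv_sum_left {p : Cn n} {ι : Type*} (s : Finset ι) (v : ι → Cn n) (φ : Hol p) :
    dirDeriv (∑ i ∈ s, v i) φ = ∑ i ∈ s, dirDeriv (v i) φ := by
  classical
  induction s using Finset.induction_on with
  | empty => simpa using dirDeriv_smul_left 0 0 φ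
  | insert a s ha ih => rw [Finset.sum_insert ha, Finset.sum_insert ha, dirDeriv_add_left, ih]

/-- The constant vector field lifting the `k`-th coordinate field of the first factor. -/
def Splitting.lift (Φ : Splitting n) (k : Fin n) : Cn (n + 1) := Φ.symm (Pi.single k 1, 0)

theorem apply_lift (Φ : Splitting n) (k : Fin n) : Φ (Φ.lift k) = (Pi.single k 1, 0) := by
  simp [Splitting.lift]

theorem sum_lift_add_dir (Φ : Splitting n) (v : Cn (n + 1)) :
    v = ∑ k, (Φ v).1 k • Φ.lift k + (Φ v).2 • Φ.dir := by
  apply Φ.injective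
  rw [map_add, map_sum, map_smul]
  simp only [map_smul, apply_lift]
  have hdir : Φ Φ.dir = (0, 1) := by simp [Splitting.dir]
  rw [hdir]
  ext k
  · simp [Prod.fst_sum, Finset.sum_apply, Pi.single_apply]
  · simp [Prod.snd_sum]

theorem dirDeriv_splitting {p : Cn (n + 1)} (Φ : Splitting n) (v : Cn (n + 1)) (φ : Hol p) :
    dirDeriv v φ = ∑ k, constGerm p ((Φ v).1 k) * dirDeriv (Φ.lift k) φ +
      constGerm p (Φ v).2 * dirDeriv Φ.dir φ := by
  conv_lhs => rw [sum_lift_add_dir Φ v]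
  simp only [dirDeriv_add_left, dirDeriv_sum_left, dirDeriv_smul_left]

/-- A reduced germ `g` vanishing at `p` has nonzero derivative at `p` in the direction of `Φ` if
each coordinate field of the first factor lifts to a vector field that preserves the ideal `(g)`.
The derivatives of `g` in the direction of `Φ` generate a stable ideal, so that `g` is regular in
this direction; then the functions of the remaining coordinates in the ideal of `g` and its
derivative form a stable nonzero ideal. -/
theorem ev_dirDeriv_ne_zero {p : Cn (n + 1)} {Φ : Splitting n} {g : Hol p} (hg : g ≠ 0)
    (hr : IsRadical g) (h0 : ev p g = 0) {h β : Fin n → Hol p}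
    (hh : ∀ k, dirDeriv (Φ.lift k) g + h k * dirDeriv Φ.dir g = β k * g) :
    ev p (dirDeriv Φ.dir g) ≠ 0 := by
  set dv := dirDeriv (p := p) Φ.dir with hD
  have hreg : orderAlong Φ g ≠ ⊤ := by
    set K : Ideal (Hol p) := Ideal.span (Set.range fun k => dv^[k] g) with hK
    have hgen : ∀ k, dv^[k] g ∈ K := fun k => Ideal.subset_span ⟨k, rfl⟩
    have hst : ∀ v, (∀ k, dirDeriv v (dv^[k] g) ∈ K) → ∀ φ ∈ K, dirDeriv v φ ∈ K := by
      intro v hv φ hφ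
      induction hφ using Submodule.span_induction with
      | mem φ h => obtain ⟨k, rfl⟩ := h; exact hv k
      | zero => rw [dirDeriv_zero]; exact K.zero_mem
      | add a b _ _ ha hb => rw [dirDeriv_add]; exact K.add_mem ha hb
      | smul a b hb ih =>
        rw [smul_eq_mul, dirDeriv_mul]
        exact K.add_mem (K.mul_mem_left _ hb) (K.mul_mem_left _ ih)
    have hst1 : ∀ φ ∈ K, dv φ ∈ K := hst Φ.dir fun k => by
      have := hgen (k + 1)
      rwa [Function.iterate_succ_apply'] at this
    have hst1' : ∀ k, ∀ φ ∈ K, dv^[k] φ ∈ K := by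
      intro k
      induction k with
      | zero => exact fun _ h => h
      | succ k ih =>
        intro φ hφ
        rw [Function.iterate_succ_apply']; exact hst1 _ (ih _ hφ)
    have hst2 : ∀ j, ∀ φ ∈ K, dirDeriv (Φ.lift j) φ ∈ K := by
      refine fun j => hst _ fun k => ?_
      have hcomm : dirDeriv (Φ.lift j) (dv^[k] g) = dv^[k] (dirDeriv (Φ.lift j) g) :=
        (Function.Commute.iterate_right (fun x => dirDeriv_comm _ _ x) k) g
      rw [hcomm, eq_sub_of_add_eq (hh j)]
      exact hst1' k _ (K.sub_mem (K.mul_mem_left _ (hgen 0)) (K.mul_mem_left _ (hgen 1)))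
    have htop : K = ⊤ := by
      refine eq_top_of_dirDeriv_stable (fun hb => hg ?_) fun v φ hφ => ?_
      · have := hgen 0
        rw [hb] at this
        exact this
      · rw [dirDeriv_splitting Φ v φ]
        exact K.add_mem (K.sum_mem fun k _ => K.mul_mem_left _ (hst2 k φ hφ))
          (K.mul_mem_left _ (hst1 φ hφ))
    by_contra hcon
    have hall : ∀ k, ev p (dv^[k] g) = 0 := fun k => by
      by_contra hk; exact orderAlong_ne_top_of_iterate hk hcon
    have hle : K ≤ RingHom.ker (ev p) := Ideal.span_le.2 (by rintro _ ⟨k, rfl⟩; exact hall k)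
    have := hle (htop ▸ Submodule.mem_top : (1 : Hol p) ∈ K)
    rw [RingHom.mem_ker, map_one] at this
    exact one_ne_zero this
  set J : Ideal (Hol p) := Ideal.span {g, dv g} with hJ
  have hgJ : g ∈ J := Ideal.subset_span (by simp)
  have hDJ : dv g ∈ J := Ideal.subset_span (by simp)
  obtain ⟨Δ, hΔ, U, V, hUV⟩ := exists_pullback_mem hreg hr
  have hst : ∀ k, ∀ φ ∈ J, dirDeriv (Φ.lift k) φ + h k * dv φ ∈ J := by
    intro k φ hφ
    obtain ⟨a, b, rfl⟩ := Ideal.mem_span_pair.1 hφ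
    have e : dirDeriv (Φ.lift k) (dv g) + h k * dv (dv g) =
        dv (β k) * g + (β k - dv (h k)) * dv g := by
      have := congrArg dv (hh k)
      rw [hD, dirDeriv_add, dirDeriv_mul, dirDeriv_mul, dirDeriv_comm] at this
      rw [hD]
      linear_combination this
    have e2 : dirDeriv (Φ.lift k) (a * g + b * dv g) + h k * dv (a * g + b * dv g) =
        (dirDeriv (Φ.lift k) a + h k * dv a + a * β k + b * dv (β k)) * g +
        (dirDeriv (Φ.lift k) b + h k * dv b + b * (β k - dv (h k))) * dv g := by
      have hdv : dv (a * g + b * dv g) = dv a * g + a * dv g + (dv b * dv g + b * dv (dv g)) := by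
        rw [hD, dirDeriv_add, dirDeriv_mul, dirDeriv_mul]
      rw [hdv, dirDeriv_add, dirDeriv_mul, dirDeriv_mul]
      linear_combination a * hh k + b * e
    rw [e2]
    exact J.add_mem (J.mul_mem_left _ hgJ) (J.mul_mem_left _ hDJ)
  have hdir : Φ Φ.dir = (0, 1) := by simp [Splitting.dir]
  have hpull : ∀ a, dv (pullback Φ p a) = 0 := fun a => by
    rw [hD, dirDeriv_pullback, hdir, dirDeriv_eq_applyField]; simp [applyField]
  have htop : J.comap (pullback Φ p) = ⊤ := by
    refine eq_top_of_dirDeriv_stable (fun hb => hΔ ?_) fun v φ hφ => ?_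
    · have : Δ ∈ J.comap (pullback Φ p) := by
        rw [Ideal.mem_comap, hUV]
        exact J.add_mem (J.mul_mem_left _ hgJ) (J.mul_mem_left _ hDJ)
      rw [hb] at this
      exact this
    · rw [dirDeriv_eq_applyField, applyField]
      refine Ideal.sum_mem _ fun k _ => Ideal.mul_mem_left _ _ ?_
      have h1 := hst k _ (Ideal.mem_comap.1 hφ)
      rw [hpull, mul_zero, add_zero, dirDeriv_pullback, apply_lift] at h1
      exact h1
  intro hcon
  have hle : J ≤ RingHom.ker (ev p) := Ideal.span_le.2 (by
    rintro _ (rfl | rfl)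
    · exact h0
    · exact hcon)
  have h1 : (1 : Hol p) ∈ J := by
    have : (1 : Hol (Φ p).1) ∈ J.comap (pullback Φ p) := htop ▸ Submodule.mem_top
    rwa [Ideal.mem_comap, map_one] at this
  have := hle h1
  rw [RingHom.mem_ker, map_one] at this
  exact one_ne_zero this

/-- If vector fields preserving `(g)` take `n` linearly independent values at a zero `p` of the
reduced germ `g` on `ℂ ^ (n + 1)`, then the differential of `g` at `p` is not zero. -/
theorem exists_ev_partialDeriv_ne_zero {p : Cn (n + 1)} {g : Hol p} (hg : g ≠ 0)
    (hr : IsRadical g) (h0 : ev p g = 0) {a : Fin n → Fin (n + 1) → Hol p}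
    (ha : ∀ i, applyField (a i) g ∈ Ideal.span {g})
    (hli : LinearIndependent ℂ fun i => (fun j => ev p (a i j) : Cn (n + 1))) :
    ∃ j, ev p (partialDeriv j g) ≠ 0 := by
  set V := Submodule.span ℂ (Set.range fun i => (fun j => ev p (a i j) : Cn (n + 1))) with hV
  obtain ⟨v, hv⟩ : ∃ v, v ∉ V := by
    by_contra! h
    have h1 : V = ⊤ := Submodule.eq_top_iff'.2 h
    have h2 := finrank_span_eq_card hli
    rw [← hV, h1, finrank_top] at h2
    simp at h2
  obtain ⟨Φ, hΦ⟩ := exists_splitting (v := v) (fun h => hv (h ▸ V.zero_mem))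
  set B : Matrix (Fin n) (Fin n) (Hol p) := Matrix.of fun i k =>
    ∑ j, a i j * constGerm p ((Φ (Pi.single j 1)).1 k) with hB
  set b : Fin n → Hol p := fun i => ∑ j, a i j * constGerm p (Φ (Pi.single j 1)).2 with hb
  have hap : ∀ i, applyField (a i) g = ∑ k, B i k * dirDeriv (Φ.lift k) g +
      b i * dirDeriv Φ.dir g := by
    intro i
    simp only [applyField, partialDeriv_eq_dirDeriv, hB, hb, Matrix.of_apply, Finset.sum_mul]
    rw [Finset.sum_comm, ← Finset.sum_add_distrib]
    refine Finset.sum_congr rfl fun j _ => ?_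
    rw [dirDeriv_splitting Φ (Pi.single j 1) g, mul_add, Finset.mul_sum]
    congr 1
    · exact Finset.sum_congr rfl fun k _ => by ring
    · ring
  have hBev : ∀ i k, ev p (B i k) = (Φ (fun j => ev p (a i j))).1 k := by
    intro i k
    conv_rhs => rw [← Finset.univ_sum_single (fun j => ev p (a i j)), map_sum]
    rw [Prod.fst_sum, Finset.sum_apply]
    simp only [hB, Matrix.of_apply, map_sum, map_mul, ev_const]
    refine Finset.sum_congr rfl fun j _ => ?_
    have : (Pi.single j (ev p (a i j)) : Cn (n + 1)) = ev p (a i j) • Pi.single j 1 := by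
      rw [← Pi.single_smul, smul_eq_mul, mul_one]
    rw [this, map_smul]; rfl
  have hdet : IsUnit B.det := by
    rw [isUnit_iff_ev, RingHom.map_det]
    intro hdet
    obtain ⟨c, hc, hc0⟩ := Matrix.exists_vecMul_eq_zero_iff.2 hdet
    -- the combination of the values with coefficients `c` is a multiple of `v`
    have h1 : (Φ (∑ i, c i • (fun j => ev p (a i j) : Cn (n + 1)))).1 = 0 := by
      rw [map_sum, Prod.fst_sum]
      ext k
      have := congrFun hc0 k
      simp only [Matrix.vecMul, dotProduct, RingHom.mapMatrix_apply, Matrix.map_apply, hBev] at this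
      rw [Finset.sum_apply]
      simpa using this
    set s := ∑ i, c i • (fun j => ev p (a i j) : Cn (n + 1)) with hs
    have h2 : s = (Φ s).2 • v := by
      have := sum_lift_add_dir Φ s
      rw [h1, hΦ] at this
      simpa using this
    have hsV : s ∈ V := V.sum_mem fun i _ => V.smul_mem _ (Submodule.subset_span ⟨i, rfl⟩)
    have h3 : (Φ s).2 = 0 := by
      by_contra h
      refine hv ?_
      have := V.smul_mem (Φ s).2⁻¹ hsV
      have h4 : (Φ s).2⁻¹ • s = v := by
        rw [inv_smul_eq_iff₀ h]; exact h2
      rwa [h4] at this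
    rw [h3, zero_smul] at h2
    exact hc (funext (Fintype.linearIndependent_iff.1 hli c h2))
  choose γ hγ using fun i => Ideal.mem_span_singleton'.1 (ha i)
  obtain ⟨u, hu⟩ := hdet
  have hadj : ∀ k, dirDeriv (Φ.lift k) g + (∑ i, ↑u⁻¹ * B.adjugate k i * b i) * dirDeriv Φ.dir g =
      (∑ i, ↑u⁻¹ * B.adjugate k i * γ i) * g := by
    intro k
    have h1 : ∀ l, ∑ i, B.adjugate k i * B i l = if k = l then B.det else 0 := by
      intro l
      have := congrFun (congrFun (Matrix.adjugate_mul B) k) l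
      rw [Matrix.mul_apply] at this
      rw [this]; simp [Matrix.one_apply]
    have h2 : ∑ i, B.adjugate k i * applyField (a i) g = B.det * dirDeriv (Φ.lift k) g +
        (∑ i, B.adjugate k i * b i) * dirDeriv Φ.dir g := by
      simp only [hap, mul_add, Finset.sum_add_distrib, Finset.sum_mul, Finset.mul_sum]
      congr 1
      · rw [Finset.sum_comm]
        simp only [← mul_assoc, ← Finset.sum_mul, h1]
        simp
      · exact Finset.sum_congr rfl fun i _ => by ring
    simp only [← hγ] at h2
    have hu' : (↑u⁻¹ : Hol p) * B.det = 1 := by rw [← hu]; exact u.inv_mul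
    have e : ∀ y : Fin n → Hol p, ∑ i, ↑u⁻¹ * B.adjugate k i * y i =
        ↑u⁻¹ * ∑ i, B.adjugate k i * y i := fun y => by
      rw [Finset.mul_sum]; exact Finset.sum_congr rfl fun _ _ => by ring
    have e2 : ∑ i, B.adjugate k i * (γ i * g) = (∑ i, B.adjugate k i * γ i) * g := by
      rw [Finset.sum_mul]; exact Finset.sum_congr rfl fun _ _ => by ring
    rw [e, e]
    rw [e2] at h2
    linear_combination (-(↑u⁻¹ : Hol p)) * h2 - dirDeriv (Φ.lift k) g * hu'
  by_contra! hcon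
  refine ev_dirDeriv_ne_zero hg hr h0 hadj ?_
  rw [dirDeriv_eq_applyField, applyField, map_sum]
  exact Finset.sum_eq_zero fun j _ => by rw [map_mul, hcon j, mul_zero]

end Smooth

/-! ### Rank and minors -/

section Minors

variable {K : Type*} [Field K]

/-- A matrix of rank at least `k` has `k` linearly independent rows. -/
theorem exists_linearIndependent_rows {ι κ : Type*} [Fintype ι] [Fintype κ] (A : Matrix ι κ K)
    {k : ℕ} (hk : k ≤ A.rank) : ∃ r : Fin k → ι, LinearIndependent K (A.submatrix r id).row := by
  obtain ⟨τ, a, ha, hsp, hli⟩ := exists_linearIndependent' K A.row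
  have : Finite τ := Finite.of_injective a ha
  cases nonempty_fintype τ
  have hcard : Fintype.card τ = A.rank := by
    rw [A.rank_eq_finrank_span_row, ← hsp, finrank_span_eq_card hli]
  obtain ⟨e⟩ : Nonempty (Fin k ↪ τ) := by
    rw [Function.Embedding.nonempty_iff_card_le, Fintype.card_fin, hcard]; exact hk
  exact ⟨a ∘ e, hli.comp e e.injective⟩

theorem exists_minor_ne_zero {ι κ : Type*} [Fintype ι] [Fintype κ] (A : Matrix ι κ K)
    {k : ℕ} (hk : k ≤ A.rank) :
    ∃ (r : Fin k → ι) (c : Fin k → κ), (A.submatrix r c).det ≠ 0 := by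
  obtain ⟨r, hr⟩ := exists_linearIndependent_rows A hk
  have h1 : (A.submatrix r id).transpose.rank = k := by
    rw [Matrix.rank_transpose, hr.rank_matrix, Fintype.card_fin]
  obtain ⟨c, hc⟩ := exists_linearIndependent_rows _ h1.ge
  refine ⟨r, c, ?_⟩
  rw [Matrix.linearIndependent_rows_iff_isUnit, Matrix.isUnit_iff_isUnit_det] at hc
  rw [← Matrix.det_transpose]
  exact hc.ne_zero

theorem minor_eq_zero {ι κ : Type*} [Fintype ι] [Fintype κ] {A : Matrix ι κ K}
    {k : ℕ} (hk : A.rank < k) (r : Fin k → ι) (c : Fin k → κ) : (A.submatrix r c).det = 0 := by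
  by_contra h
  have h1 := Matrix.rank_of_det_ne_zero h
  have h2 := A.rank_submatrix_le r c
  rw [h1, Fintype.card_fin] at h2
  omega

end Minors

/-! ### Fitting ideals up to radical -/

section Fitting

variable {R M K : Type*} [CommRing R] [AddCommGroup M] [Module R M] [Field K] [Algebra R K]
  {ι : Type*} [Fintype ι]

/-- The values of a linear form with values in `K` on a family of vectors. -/
def evalFamily (v : ι → M) : (M →ₗ[R] K) →ₗ[K] (ι → K) where
  toFun φ b := φ (v b)
  map_add' _ _ := rfl
  map_smul' _ _ := rfl

omit [Fintype ι] in
theorem evalFamily_injective {v : ι → M} (hv : Submodule.span R (Set.range v) = ⊤) :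
    Function.Injective (evalFamily (R := R) (K := K) v) := by
  intro φ ψ h
  exact LinearMap.ext_on_range hv fun b => congrFun h b

theorem evalFamily_mem_ker {ρ : Type*} {v : ι → M} {B : Matrix ρ ι R}
    (hB : ∀ a, ∑ b, B a b • v b = 0) (φ : M →ₗ[R] K) :
    evalFamily v φ ∈ LinearMap.ker (B.map (algebraMap R K)).mulVecLin := by
  rw [LinearMap.mem_ker]
  ext a
  have := congrArg φ (hB a)
  rw [map_sum, map_zero] at this
  simpa [Matrix.mulVec, dotProduct, evalFamily, Algebra.smul_def] using this

theorem rank_add_finrank_ker (ρ : Type*) (B : Matrix ρ ι K) :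
    B.rank + Module.finrank K (LinearMap.ker B.mulVecLin) = Fintype.card ι := by
  rw [Matrix.rank, LinearMap.finrank_range_add_finrank_ker, Module.finrank_fintype_fun_eq_card]

/-- The number of generators, minus the rank at a point of a matrix of relations, is at least the
dimension of the fibre of the module at this point (more precisely, of the dual of the fibre). -/
theorem rank_relations_add_finrank_le {ρ : Type*} {v : ι → M}
    (hv : Submodule.span R (Set.range v) = ⊤) {B : Matrix ρ ι R}
    (hB : ∀ a, ∑ b, B a b • v b = 0) :
    (B.map (algebraMap R K)).rank + Module.finrank K (M →ₗ[R] K) ≤ Fintype.card ι := by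
  rw [← rank_add_finrank_ker ρ (B.map (algebraMap R K))]
  gcongr
  rw [← LinearMap.finrank_range_of_inj (evalFamily_injective (K := K) hv)]
  refine Submodule.finrank_mono ?_
  rintro _ ⟨φ, rfl⟩
  exact evalFamily_mem_ker hB φ

/-- Equality holds in `rank_relations_add_finrank_le` if the rows of the matrix generate all
relations. -/
theorem rank_relations_add_finrank_eq {ρ : Type*} {v : ι → M}
    (hv : Submodule.span R (Set.range v) = ⊤) {B : Matrix ρ ι R}
    (hB : ∀ r : ι → R, ∑ b, r b • v b = 0 ↔ r ∈ Submodule.span R (Set.range B)) :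
    (B.map (algebraMap R K)).rank + Module.finrank K (M →ₗ[R] K) = Fintype.card ι := by
  rw [← rank_add_finrank_ker ρ (B.map (algebraMap R K)),
    ← LinearMap.finrank_range_of_inj (evalFamily_injective (K := K) hv)]
  suffices h : LinearMap.ker (B.map (algebraMap R K)).mulVecLin =
      LinearMap.range (evalFamily (R := R) (K := K) v) by rw [h]
  refine le_antisymm (fun y hy => ?_) ?_
  rotate_left
  · rintro _ ⟨φ, rfl⟩
    exact evalFamily_mem_ker (fun a => (hB _).2 (Submodule.subset_span ⟨a, rfl⟩)) φ
  · have hsurj : Function.Surjective (Fintype.linearCombination R v) := by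
      rw [← LinearMap.range_eq_top, Fintype.range_linearCombination, hv]
    have hker : LinearMap.ker (Fintype.linearCombination R v) ≤
        LinearMap.ker (Fintype.linearCombination R y) := by
      intro r hr
      rw [LinearMap.mem_ker, Fintype.linearCombination_apply, hB] at hr
      refine Submodule.span_le.2 ?_ hr
      rintro _ ⟨a, rfl⟩
      have := congrFun (LinearMap.mem_ker.1 hy) a
      rw [SetLike.mem_coe, LinearMap.mem_ker, Fintype.linearCombination_apply]
      simpa [Matrix.mulVec, dotProduct, Algebra.smul_def] using this
    refine ⟨(Submodule.liftQ _ _ hker).comp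
      (LinearMap.quotKerEquivOfSurjective _ hsurj).symm.toLinearMap, ?_⟩
    classical
    ext b
    have h1 : (LinearMap.quotKerEquivOfSurjective _ hsurj).symm (v b) =
        Submodule.Quotient.mk (Pi.single b 1) := by
      rw [LinearEquiv.symm_apply_eq]
      simp [LinearMap.quotKerEquivOfSurjective]
    change Submodule.liftQ _ _ hker ((LinearMap.quotKerEquivOfSurjective _ hsurj).symm (v b)) = y b
    rw [h1]
    simp

/-- The radical of a Fitting ideal is the radical of the ideal of minors of any matrix whose rows
generate the relations between any generators: at each prime both express the dimension of the
fibre. -/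
theorem radical_fittingIdeal {ρ : Type*} [Fintype ρ] {v : ι → M}
    (hv : Submodule.span R (Set.range v) = ⊤) {B : Matrix ρ ι R}
    (hB : ∀ r : ι → R, ∑ b, r b • v b = 0 ↔ r ∈ Submodule.span R (Set.range B)) (j : ℤ) :
    (fittingIdeal R M j).radical =
      (Ideal.span (Set.range fun x : (Fin ((Fintype.card ι : ℤ) - j).toNat → ρ) ×
        (Fin ((Fintype.card ι : ℤ) - j).toNat → ι) => (B.submatrix x.1 x.2).det)).radical := by
  set k := ((Fintype.card ι : ℤ) - j).toNat with hk
  have hrow : ∀ a, ∑ b, B a b • v b = 0 := fun a => (hB _).2 (Submodule.subset_span ⟨a, rfl⟩)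
  refine le_antisymm ?_ (Ideal.radical_mono (Ideal.span_le.2 ?_))
  · rw [Ideal.radical_eq_sInf (Ideal.span _)]
    refine le_sInf fun P hP => ?_
    obtain ⟨hP, hPp⟩ := hP
    rw [hPp.radical_le_iff]
    have hmem : ∀ a : R, algebraMap R P.ResidueField a = 0 ↔ a ∈ P := fun a =>
      Ideal.algebraMap_residueField_eq_zero
    -- at the prime `P`, the dimension `h` of the dual of the fibre bounds the ranks of all matrices
    -- of relations, with equality for `B`
    set h := Module.finrank P.ResidueField (M →ₗ[R] P.ResidueField)
    have h1 : (B.map (algebraMap R P.ResidueField)).rank + h = Fintype.card ι :=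
      rank_relations_add_finrank_eq hv hB
    have h2 : (B.map (algebraMap R P.ResidueField)).rank < k := by
      by_contra hcon
      obtain ⟨r, c, hrc⟩ := exists_minor_ne_zero _ (not_lt.1 hcon)
      rw [Matrix.submatrix_map, ← RingHom.mapMatrix_apply, ← RingHom.map_det] at hrc
      exact hrc ((hmem _).2 (hP (Ideal.subset_span ⟨(r, c), rfl⟩)))
    refine iSup_le fun m => iSup_le fun u => iSup_le fun hu => Ideal.span_le.2 ?_
    rintro _ ⟨r, c, hr, rfl⟩
    have h3 := rank_relations_add_finrank_le (K := P.ResidueField) hu (B := Matrix.of r) hr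
    rw [Fintype.card_fin] at h3
    rw [SetLike.mem_coe, ← hmem, RingHom.map_det, RingHom.mapMatrix_apply]
    exact minor_eq_zero (A := (Matrix.of r).map (algebraMap R P.ResidueField)) (by omega) id c
  · rintro _ ⟨⟨r, c⟩, rfl⟩
    let e := Fintype.equivFin ι
    refine Ideal.mem_iSup_of_mem (Fintype.card ι) (Ideal.mem_iSup_of_mem (v ∘ e.symm)
      (Ideal.mem_iSup_of_mem ?_ (Ideal.subset_span ⟨fun a b => B (r a) (e.symm b), fun a => e (c a),
        fun a => ?_, ?_⟩)))
    · rw [Set.range_comp, e.symm.range_eq_univ, Set.image_univ, hv]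
    · rw [← hrow (r a)]
      exact Equiv.sum_comp e.symm fun b => B (r a) b • v b
    · refine congrArg Matrix.det (Matrix.ext fun a b => ?_)
      simp

end Fitting

/-! ### Rank loci of the Saito matrices -/

section Loci

variable {n m : ℕ}

theorem rep_minor {p : Cn n} {ι κ : Type*} (A : Matrix ι κ (Hol p)) {k : ℕ} (r : Fin k → ι)
    (c : Fin k → κ) : rep (A.submatrix r c).det =ᶠ[𝓝 p]
      fun x => ((A.map fun φ => rep φ x).submatrix r c).det :=
  rep_det (A.submatrix r c)

/-- If an ideal has the radical of the ideal of `k`-minors of `A`, its zeros are the points at which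
the rank of `A` is less than `k`. -/
theorem sameGerm_zeroLocus_rankAt {ι κ : Type*} [Fintype ι] [Fintype κ]
    {A : Matrix ι κ (Hol (0 : Cn n))} {k : ℕ} {I : Ideal (Hol (0 : Cn n))}
    (h : I.radical = (Ideal.span (Set.range fun x : (Fin k → ι) × (Fin k → κ) =>
      (A.submatrix x.1 x.2).det)).radical) :
    SameGerm (zeroLocus I) {x | rankAt A x < k} := by
  filter_upwards [sameGerm_zeroLocus_of_radical h, eventually_all.2
    fun x : (Fin k → ι) × (Fin k → κ) => rep_minor A x.1 x.2] with x h1 h2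
  rw [h1]
  simp only [h2]
  constructor
  · intro h3
    by_contra hcon
    obtain ⟨r, c, hrc⟩ := exists_minor_ne_zero _ (not_lt.1 hcon)
    exact hrc (h3 (r, c))
  · exact fun h3 y => minor_eq_zero h3 y.1 y.2

variable {f : Hol (0 : Cn n)} {δ : Fin m → Fin n → Hol (0 : Cn n)} {α : Fin m → Hol (0 : Cn n)}

/-- The generators `∂_1 f, …, ∂_n f, f` of the Jacobian ideal. -/
def jacobianGen {p : Cn n} (f : Hol p) : Fin n ⊕ Unit → jacobianIdeal f :=
  Sum.elim (fun j => ⟨partialDeriv j f, Ideal.subset_span (Or.inl ⟨j, rfl⟩)⟩)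
    fun _ => ⟨f, Ideal.subset_span (Or.inr rfl)⟩

theorem span_jacobianGen {p : Cn n} (f : Hol p) :
    Submodule.span (Hol p) (Set.range (jacobianGen f)) = ⊤ := by
  rw [eq_top_iff]
  rintro ⟨φ, hφ⟩ -
  have h1 : Set.range (fun j => partialDeriv j f) ∪ {f} =
      (jacobianIdeal f).subtype '' Set.range (jacobianGen f) := by
    rw [← Set.range_comp, jacobianGen]
    ext ψ; constructor
    · rintro (⟨j, rfl⟩ | rfl)
      · exact ⟨Sum.inl j, rfl⟩
      · exact ⟨Sum.inr (), rfl⟩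
    · rintro ⟨j | j, rfl⟩
      · exact Or.inl ⟨j, rfl⟩
      · exact Or.inr rfl
  have h2 : φ ∈
      Submodule.span (Hol p) ((jacobianIdeal f).subtype '' Set.range (jacobianGen f)) := by
    rw [← h1]; exact hφ
  rw [← Submodule.map_span] at h2
  obtain ⟨y, hy, hy'⟩ := Submodule.mem_map.1 h2
  have : y = ⟨φ, hφ⟩ := Subtype.ext hy'
  rwa [← this]

theorem sum_jacobianGen {p : Cn n} (f : Hol p) (r : Fin n ⊕ Unit → Hol p) :
    ((∑ b, r b • jacobianGen f b : jacobianIdeal f) : Hol p) =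
      applyField (fun j => r (Sum.inl j)) f + r (Sum.inr ()) * f := by
  simp [Fintype.sum_sum_type, jacobianGen, applyField]

/-- The rows of the extended Saito matrix generate the relations between `∂_1 f, …, ∂_n f, f`. -/
theorem relation_iff_mem_span (hf : f ≠ 0) (h : IsLogGenerating f δ α)
    (r : Fin n ⊕ Unit → Hol (0 : Cn n)) :
    applyField (fun j => r (Sum.inl j)) f + r (Sum.inr ()) * f = 0 ↔
      r ∈ Submodule.span (Hol (0 : Cn n)) (Set.range (extendedSaitoMatrix δ α)) := by
  constructor
  · intro h0
    have h1 : applyField (fun j => r (Sum.inl j)) f ∈ Ideal.span {f} :=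
      Ideal.mem_span_singleton'.2 ⟨-r (Sum.inr ()), by linear_combination -h0⟩
    obtain ⟨c, hc⟩ := (Submodule.mem_span_range_iff_exists_fun _).1 ((h.1 _).2 h1)
    refine (Submodule.mem_span_range_iff_exists_fun _).2 ⟨c, ?_⟩
    have h2 : (∑ k, c k * α k + r (Sum.inr ())) * f = 0 := by
      rw [← hc, applyField_sum_smul] at h0
      simp only [h.2] at h0
      rw [add_mul, Finset.sum_mul, ← h0]
      simp only [mul_assoc]
    have h3 := (mul_eq_zero.1 h2).resolve_right hf
    ext1 (j | j)
    · have := congrFun hc j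
      simpa [extendedSaitoMatrix, saitoMatrix] using this
    · have : r (Sum.inr j) = -∑ k, c k * α k := by linear_combination h3
      rw [this]
      simp [extendedSaitoMatrix]
  · intro hr
    obtain ⟨c, rfl⟩ := (Submodule.mem_span_range_iff_exists_fun _).1 hr
    have h1 : (fun j => (∑ k, c k • extendedSaitoMatrix δ α k) (Sum.inl j)) =
        ∑ k, c k • δ k := by
      ext1 j
      simp [extendedSaitoMatrix, saitoMatrix]
    have h2 : (∑ k, c k • extendedSaitoMatrix δ α k) (Sum.inr ()) = -∑ k, c k * α k := by
      simp [extendedSaitoMatrix]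
    rw [h1, h2, applyField_sum_smul]
    simp only [h.2]
    rw [neg_mul, Finset.sum_mul]
    simp only [mul_assoc]
    exact add_neg_cancel _

/-- The ideal `Ĩ_i` is, up to radical, the ideal of `i`-minors of the extended Saito matrix. For
`i ≤ 0` both ideals are the unit ideal, the empty minor being `1`. -/
theorem radical_idealItilde (hf : f ≠ 0) (h : IsLogGenerating f δ α) (i : ℤ) :
    (idealItilde f i).radical = (Ideal.span (Set.range fun x : (Fin i.toNat → Fin m) ×
      (Fin i.toNat → Fin n ⊕ Unit) =>
        ((extendedSaitoMatrix δ α).submatrix x.1 x.2).det)).radical := by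
  have h1 := radical_fittingIdeal (span_jacobianGen f) (B := extendedSaitoMatrix δ α) (fun r => by
    rw [← relation_iff_mem_span hf h, ← sum_jacobianGen, Subtype.ext_iff]; rfl) (n + 1 - i)
  have h2 : (((Fintype.card (Fin n ⊕ Unit) : ℕ) : ℤ) - (n + 1 - i)).toNat = i.toNat := by
    simp
  rw [h2] at h1
  exact h1

/-- The generators of `𝒥_f / (f)` given by the partial derivatives. -/
def jacobianQuotientGen {p : Cn n} (f : Hol p) (j : Fin n) : JacobianQuotient f :=
  Submodule.Quotient.mk (jacobianGen f (Sum.inl j))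

theorem span_jacobianQuotientGen {p : Cn n} (f : Hol p) :
    Submodule.span (Hol p) (Set.range (jacobianQuotientGen f)) = ⊤ := by
  have h1 := congrArg (Submodule.map (Submodule.mkQ (Submodule.comap (jacobianIdeal f).subtype
    (Ideal.span {f})))) (span_jacobianGen f)
  rw [Submodule.map_span, Submodule.map_top, Submodule.range_mkQ, ← Set.range_comp] at h1
  rw [eq_top_iff, ← h1, Submodule.span_le]
  rintro _ ⟨j | j, rfl⟩
  · exact Submodule.subset_span ⟨j, rfl⟩
  · have : (Submodule.mkQ (Submodule.comap (jacobianIdeal f).subtype (Ideal.span {f})) ∘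
        jacobianGen f) (Sum.inr j) = 0 :=
      (Submodule.Quotient.mk_eq_zero _).2 (Ideal.mem_span_singleton_self f)
    rw [this]
    exact Submodule.zero_mem _

theorem sum_jacobianQuotientGen_eq_zero_iff {p : Cn n} (f : Hol p) (r : Fin n → Hol p) :
    ∑ j, r j • jacobianQuotientGen f j = 0 ↔ applyField r f ∈ Ideal.span {f} := by
  have : ∑ j, r j • jacobianQuotientGen f j = Submodule.Quotient.mk
      (∑ j, r j • jacobianGen f (Sum.inl j)) := by
    rw [← Submodule.mkQ_apply, map_sum]; rfl
  rw [this, Submodule.Quotient.mk_eq_zero, Submodule.mem_comap]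
  have h2 : (jacobianIdeal f).subtype (∑ j, r j • jacobianGen f (Sum.inl j)) = applyField r f := by
    rw [map_sum]; rfl
  rw [h2]

/-- The ideal `I_i` is, up to radical, the ideal of `i`-minors of the Saito matrix. -/
theorem radical_idealI (h : IsLogGenerating f δ α) (i : ℤ) :
    (idealI f i).radical = (Ideal.span (Set.range fun x : (Fin i.toNat → Fin m) ×
      (Fin i.toNat → Fin n) => ((saitoMatrix δ).submatrix x.1 x.2).det)).radical := by
  have h1 := radical_fittingIdeal (span_jacobianQuotientGen f) (B := saitoMatrix δ) (fun r => by
    rw [sum_jacobianQuotientGen_eq_zero_iff, ← h.1]; rfl) (n - i)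
  have h2 : (((Fintype.card (Fin n) : ℕ) : ℤ) - (n - i)).toNat = i.toNat := by
    simp
  rw [h2] at h1
  exact h1

theorem sameGerm_locusD (h : IsLogGenerating f δ α) (i : ℤ) :
    SameGerm (locusD f i) {x | (rankAt (saitoMatrix δ) x : ℤ) ≤ i} := by
  filter_upwards [sameGerm_zeroLocus_rankAt (radical_idealI h (i + 1))] with x hx
  rw [locusD, hx]
  omega

theorem sameGerm_locusDtilde (hf : f ≠ 0) (h : IsLogGenerating f δ α) (i : ℤ) :
    SameGerm (locusDtilde f i) {x | (rankAt (extendedSaitoMatrix δ α) x : ℤ) ≤ i} := by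
  filter_upwards [sameGerm_zeroLocus_rankAt (radical_idealItilde hf h (i + 1))] with x hx
  rw [locusDtilde, hx]
  omega

/-- The module of logarithmic fields is finitely generated, the ring of germs being Noetherian. -/
theorem exists_isLogGenerating (f : Hol (0 : Cn n)) :
    ∃ (m : ℕ) (δ : Fin m → Fin n → Hol (0 : Cn n)) (α : Fin m → Hol (0 : Cn n)),
      IsLogGenerating f δ α := by
  let L : Submodule (Hol (0 : Cn n)) (Fin n → Hol (0 : Cn n)) :=
    { carrier := {a | applyField a f ∈ Ideal.span {f}}
      zero_mem' := by simp [applyField]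
      add_mem' := fun {a b} ha hb => by
        simp only [Set.mem_ofPred_eq, applyField_add_left] at *
        exact Ideal.add_mem _ ha hb
      smul_mem' := fun c a ha => by
        simp only [Set.mem_ofPred_eq, applyField_smul] at *
        exact Ideal.mul_mem_left _ _ ha }
  obtain ⟨m, δ, hδ⟩ := Submodule.fg_iff_exists_fin_generating_family.1 (IsNoetherian.noetherian L)
  have hmem : ∀ k, applyField (δ k) f ∈ Ideal.span {f} := fun k =>
    show δ k ∈ L from hδ ▸ Submodule.subset_span ⟨k, rfl⟩
  choose α hα using fun k => Ideal.mem_span_singleton'.1 (hmem k)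
  exact ⟨m, δ, α, fun a => by rw [hδ]; rfl, fun k => (hα k).symm⟩

end Loci

/-! ### Logarithmic fields at nearby points -/

section Nearby

variable {n m : ℕ}

theorem germAt_applyField {p : Cn n} (a : Fin n → Hol p) (φ : Hol p) :
    ∀ᶠ x in 𝓝 p, germAt (applyField a φ) x = applyField (fun j => germAt (a j) x) (germAt φ x) := by
  filter_upwards [germAt_sum_mul a fun j => partialDeriv j φ,
    eventually_all.2 fun j => germAt_dirDeriv (Pi.single j 1) φ] with x h1 h2
  rw [applyField, h1, applyField]
  exact Finset.sum_congr rfl fun j _ => by rw [partialDeriv_eq_dirDeriv, h2]; rfl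

theorem fderiv_eq_zero_iff {p : Cn n} (g : Hol p) :
    fderiv ℂ (rep g) p = 0 ↔ ∀ j, ev p (partialDeriv j g) = 0 := by
  simp only [partialDeriv_eq_dirDeriv, ev_dirDeriv]
  constructor
  · intro h j; rw [h]; rfl
  · intro h
    refine ContinuousLinearMap.ext fun v => ?_
    rw [← Finset.univ_sum_single v, map_sum]
    refine Finset.sum_eq_zero fun j _ => ?_
    have : (Pi.single j (v j) : Cn n) = v j • Pi.single j 1 := by
      rw [← Pi.single_smul, smul_eq_mul, mul_one]
    rw [this, map_smul, h, smul_zero]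

/-- Two reduced equations of the same set differ by a unit. -/
theorem IsReducedEquation.associated {D : Set (Cn n)} {p : Cn n} {f g : Hol p}
    (hf : IsReducedEquation D p f) (hg : IsReducedEquation D p g) : Associated f g := by
  refine associated_of_isRadical ((span_isRadical_iff f).1 hf.2.1)
    ((span_isRadical_iff g).1 hg.2.1) ?_
  filter_upwards [hf.2.2, hg.2.2] with x h1 h2
  rw [← h1, h2]

theorem IsReducedEquation.ev_eq_zero_iff {D : Set (Cn n)} {p : Cn n} {f : Hol p}
    (hf : IsReducedEquation D p f) : ev p f = 0 ↔ p ∈ D :=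
  hf.2.2.self_of_nhds.symm

/-- A reduced equation at `p` is a reduced equation at the nearby points. -/
theorem eventually_isReducedEquation {D : Set (Cn (n + 1))} {p : Cn (n + 1)} {f : Hol p}
    (hf : IsReducedEquation D p f) : ∀ᶠ x in 𝓝 p, IsReducedEquation D x (germAt f x) := by
  filter_upwards [germAt_ne_zero hf.1, eventually_isRadical hf.1 ((span_isRadical_iff f).1 hf.2.1),
    hf.2.2.eventually_nhds, eventually_rep_germAt f] with x h1 h2 h3 h4
  refine ⟨h1, (span_isRadical_iff _).2 h2, ?_⟩
  filter_upwards [h3, h4] with y h5 h6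
  rw [h5, h6]

theorem mem_singularLocus_iff {D : Set (Cn n)} {p : Cn n} {f : Hol p}
    (hf : IsReducedEquation D p f) :
    p ∈ singularLocus D ↔ p ∈ D ∧ ∀ j, ev p (partialDeriv j f) = 0 := by
  refine and_congr_right fun hp => ⟨fun h => (fderiv_eq_zero_iff f).1 (h f hf), fun h g hg => ?_⟩
  obtain ⟨u, rfl⟩ := hf.associated hg
  refine (fderiv_eq_zero_iff _).2 fun j => ?_
  rw [partialDeriv_eq_dirDeriv, dirDeriv_mul, map_add, map_mul, map_mul, hf.ev_eq_zero_iff.2 hp,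
    ← partialDeriv_eq_dirDeriv, h j]
  ring

/-- A divisor is strongly Euler-homogeneous at its smooth points. -/
theorem isStronglyEulerAt_of_smooth {D : Set (Cn n)} {p : Cn n} {f : Hol p}
    (hf : IsReducedEquation D p f) (hp : p ∈ D) {j : Fin n} (hj : ev p (partialDeriv j f) ≠ 0) :
    IsStronglyEulerAt D p := by
  obtain ⟨u, hu⟩ := isUnit_iff_ev.2 hj
  refine ⟨f, hf, Pi.single j (↑u⁻¹ * f), fun k => ?_, ?_⟩
  · change ev p _ = 0
    by_cases hk : k = j
    · subst hk
      rw [Pi.single_eq_same, map_mul, hf.ev_eq_zero_iff.2 hp, mul_zero]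
    · rw [Pi.single_eq_of_ne hk, map_zero]
  · rw [applyField, Finset.sum_eq_single j (fun k _ hk => by rw [Pi.single_eq_of_ne hk, zero_mul])
      (fun h => absurd (Finset.mem_univ j) h), Pi.single_eq_same, ← hu, mul_right_comm,
      u.inv_mul, one_mul]

/-- If a field with `δ(f) = α f` vanishes at `p` and `α` is a unit, then `α⁻¹ δ` is an Euler
field. -/
theorem isStronglyEulerAt_of_field {D : Set (Cn n)} {p : Cn n} {f : Hol p}
    (hf : IsReducedEquation D p f) {a : Fin n → Hol p} {β : Hol p} (ha : ∀ j, ev p (a j) = 0)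
    (hβ : ev p β ≠ 0) (h : applyField a f = β * f) : IsStronglyEulerAt D p := by
  obtain ⟨u, hu⟩ := isUnit_iff_ev.2 hβ
  refine ⟨f, hf, (↑u⁻¹ : Hol p) • a, fun j => ?_, ?_⟩
  · change ev p (↑u⁻¹ * a j) = 0
    rw [map_mul, ha, mul_zero]
  · rw [applyField_smul, h, ← hu, ← mul_assoc, u.inv_mul, one_mul]

/-- Being strongly Euler-homogeneous does not depend on the equation: with `g = u f` and
`δ(g) = g` one gets `δ(f) = (1 - u⁻¹ δ(u)) f`. -/
theorem IsStronglyEulerAt.exists_field {D : Set (Cn n)} {p : Cn n} {f : Hol p}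
    (hf : IsReducedEquation D p f) (h : IsStronglyEulerAt D p) :
    ∃ (a : Fin n → Hol p) (β : Hol p), (∀ j, ev p (a j) = 0) ∧ ev p β = 1 ∧
      applyField a f = β * f := by
  obtain ⟨g, hg, a, ha, hag⟩ := h
  obtain ⟨u, rfl⟩ := hf.associated hg
  refine ⟨a, 1 - ↑u⁻¹ * applyField a u, ha, ?_, ?_⟩
  · have h0 : ev p (applyField a (u : Hol p)) = 0 := by
      rw [applyField, map_sum]
      exact Finset.sum_eq_zero fun j _ => by rw [map_mul, ev_apply, ha, zero_mul]
    rw [map_sub, map_mul, h0, map_one, mul_zero, sub_zero]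
  · rw [applyField_mul] at hag
    have hu : (↑u⁻¹ : Hol p) * u = 1 := u.inv_mul
    linear_combination (↑u⁻¹ : Hol p) * hag + (f - applyField a f) * hu

variable {f : Hol (0 : Cn n)} {δ : Fin m → Fin n → Hol (0 : Cn n)} {α : Fin m → Hol (0 : Cn n)}

theorem eventually_applyField_germAt (h : IsLogGenerating f δ α) :
    ∀ᶠ x in 𝓝 0, ∀ k, applyField (fun j => germAt (δ k j) x) (germAt f x) =
      germAt (α k) x * germAt f x := by
  refine eventually_all.2 fun k => ?_
  filter_upwards [germAt_applyField (δ k) f, germAt_mul (α k) f] with x h1 h2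
  rw [← h1, h.2 k, h2]

/-- By Oka's coherence theorem, generators of the logarithmic fields at `0` generate the
logarithmic fields at the nearby points. -/
theorem eventually_exists_combination (hf : f ≠ 0) (h : IsLogGenerating f δ α) :
    ∀ᶠ x in 𝓝 0, ∀ (a : Fin n → Hol x) (β : Hol x), applyField a (germAt f x) = β * germAt f x →
      ∃ e : Fin m → Hol x, (∀ j, a j = ∑ k, e k * germAt (δ k j) x) ∧
        β = ∑ k, e k * germAt (α k) x := by
  obtain ⟨κ, hκ, G, hG, hcoh⟩ := oka n (0 : Cn n) Unit (Fin n ⊕ Unit)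
    (fun _ => Sum.elim (fun j => partialDeriv j f) fun _ => f)
  have hG' : ∀ k, ∃ e : Fin m → Hol (0 : Cn n), ∑ l, e l • extendedSaitoMatrix δ α l = G k := by
    intro k
    refine (Submodule.mem_span_range_iff_exists_fun _).1
      ((relation_iff_mem_span hf h (G k)).1 ?_)
    have := hG k ()
    simpa [Fintype.sum_sum_type, applyField] using this
  choose e he using hG'
  have he1 : ∀ k j, G k (Sum.inl j) = ∑ l, e k l * δ l j := fun k j => by
    rw [← he]; simp [extendedSaitoMatrix, saitoMatrix]
  have he2 : ∀ k, G k (Sum.inr ()) = ∑ l, e k l * (-α l) := fun k => by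
    rw [← he]; simp [extendedSaitoMatrix]
  filter_upwards [hcoh, eventually_all.2 fun j => germAt_dirDeriv (Pi.single j 1) f,
    eventually_all.2 fun k => eventually_all.2 fun j => germAt_sum_mul (e k) fun l => δ l j,
    eventually_all.2 fun k => germAt_sum_mul (e k) fun l => -α l,
    eventually_all.2 fun l => germAt_neg (α l)] with x h1 h2 h3 h4 h5 a β hab
  obtain ⟨c, hc⟩ := h1 (Sum.elim a fun _ => -β) (by
    intro _
    simp only [Fintype.sum_sum_type, Sum.elim_inl, Sum.elim_inr, Finset.univ_unique,
      Finset.sum_singleton]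
    have : ∀ j, germAt (partialDeriv j f) x = partialDeriv j (germAt f x) := h2
    simp only [this]
    rw [← applyField, hab]; ring)
  refine ⟨fun l => ∑ k, c k * germAt (e k l) x, fun j => ?_, ?_⟩
  · have := hc (Sum.inl j)
    simp only [Sum.elim_inl, he1, h3] at this
    rw [this]
    simp only [Finset.mul_sum, Finset.sum_mul]
    rw [Finset.sum_comm]
    exact Finset.sum_congr rfl fun _ _ => Finset.sum_congr rfl fun _ _ => by ring
  · have := hc (Sum.inr ())
    simp only [Sum.elim_inr, he2, h4, h5] at this
    rw [← neg_inj, this]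
    simp only [Finset.mul_sum, Finset.sum_mul, ← Finset.sum_neg_distrib]
    rw [Finset.sum_comm]
    exact Finset.sum_congr rfl fun _ _ => Finset.sum_congr rfl fun _ _ => by ring

end Nearby

/-! ### The ranks of the Saito matrices at nearby points -/

section Ranks

variable {n m : ℕ}

/-- Adding a column to a matrix raises its rank if and only if some relation between the rows is
not a relation between the entries of the new column. -/
theorem rank_lt_rank_fromCols_iff {ι κ : Type*} [Fintype ι] [Fintype κ] (A : Matrix ι κ ℂ)
    (b : ι → ℂ) : A.rank < (Matrix.fromCols A (Matrix.of fun k (_ : Unit) => b k)).rank ↔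
      ∃ c : ι → ℂ, (∀ j, ∑ k, c k * A k j = 0) ∧ ∑ k, c k * b k ≠ 0 := by
  set B := Matrix.fromCols A (Matrix.of fun k (_ : Unit) => b k) with hB
  have h1 := rank_add_finrank_ker (κ) A.transpose
  have h2 := rank_add_finrank_ker (κ ⊕ Unit) B.transpose
  rw [Matrix.rank_transpose] at h1 h2
  have hA : ∀ c, c ∈ LinearMap.ker A.transpose.mulVecLin ↔ ∀ j, ∑ k, c k * A k j = 0 := by
    intro c
    rw [LinearMap.mem_ker, funext_iff]
    simp [Matrix.vecMul, dotProduct, mul_comm]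
  have hBm : ∀ c, c ∈ LinearMap.ker B.transpose.mulVecLin ↔
      (∀ j, ∑ k, c k * A k j = 0) ∧ ∑ k, c k * b k = 0 := by
    intro c
    rw [LinearMap.mem_ker, funext_iff]
    simp [Matrix.vecMul, dotProduct, mul_comm, hB]
  have hle : LinearMap.ker B.transpose.mulVecLin ≤ LinearMap.ker A.transpose.mulVecLin :=
    fun c hc => (hA c).2 ((hBm c).1 hc).1
  constructor
  · intro h
    by_contra! hcon
    have : LinearMap.ker B.transpose.mulVecLin = LinearMap.ker A.transpose.mulVecLin :=
      le_antisymm hle fun c hc => (hBm c).2 ⟨(hA c).1 hc, hcon c ((hA c).1 hc)⟩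
    rw [this] at h2
    omega
  · rintro ⟨c, hc, hcb⟩
    have hlt : LinearMap.ker B.transpose.mulVecLin < LinearMap.ker A.transpose.mulVecLin :=
      lt_of_le_of_ne hle fun heq => hcb ((hBm c).1 (heq ▸ (hA c).2 hc)).2
    have := Submodule.finrank_lt_finrank_of_lt hlt
    omega

theorem rank_fromCols_le {ι κ : Type*} [Fintype ι] [Fintype κ] (A : Matrix ι κ ℂ)
    (b : ι → ℂ) : A.rank ≤ (Matrix.fromCols A (Matrix.of fun k (_ : Unit) => b k)).rank ∧
      (Matrix.fromCols A (Matrix.of fun k (_ : Unit) => b k)).rank ≤ A.rank + 1 := by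
  set B := Matrix.fromCols A (Matrix.of fun k (_ : Unit) => b k) with hB
  refine ⟨B.rank_submatrix_le id Sum.inl, ?_⟩
  rw [Matrix.rank_eq_finrank_span_cols, Matrix.rank_eq_finrank_span_cols]
  have hsp : Submodule.span ℂ (Set.range B.col) ≤
      Submodule.span ℂ (Set.range A.col) ⊔ Submodule.span ℂ {b} := by
    rw [Submodule.span_le]
    rintro _ ⟨j | j, rfl⟩
    · exact Submodule.mem_sup_left (Submodule.subset_span ⟨j, rfl⟩)
    · exact Submodule.mem_sup_right (Submodule.subset_span rfl)
  refine (Submodule.finrank_mono hsp).trans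
    ((Submodule.finrank_add_le_finrank_add_finrank _ _).trans ?_)
  gcongr
  exact (finrank_span_le_card _).trans (by simp)

variable {f : Hol (0 : Cn n)} {δ : Fin m → Fin n → Hol (0 : Cn n)} {α : Fin m → Hol (0 : Cn n)}

/-- The space of values at `x` of the vector fields in the module generated by `δ`. -/
def valueSpace (δ : Fin m → Fin n → Hol (0 : Cn n)) (x : Cn n) : Submodule ℂ (Cn n) :=
  Submodule.span ℂ (Set.range fun k => (fun j => rep (δ k j) x : Cn n))

theorem finrank_valueSpace (δ : Fin m → Fin n → Hol (0 : Cn n)) (x : Cn n) :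
    Module.finrank ℂ (valueSpace δ x) = rankAt (saitoMatrix δ) x :=
  (Matrix.rank_eq_finrank_span_row _).symm

theorem eventually_mem_valueSpace (h : IsLogGenerating f δ α) {a : Fin n → Hol (0 : Cn n)}
    (ha : applyField a f ∈ Ideal.span {f}) :
    ∀ᶠ x in 𝓝 0, (fun j => rep (a j) x : Cn n) ∈ valueSpace δ x := by
  obtain ⟨c, rfl⟩ := (Submodule.mem_span_range_iff_exists_fun _).1 ((h.1 a).2 ha)
  have h1 : ∀ j, ∀ᶠ x in 𝓝 (0 : Cn n),
      rep ((∑ k, c k • δ k) j) x = ∑ k, rep (c k) x * rep (δ k j) x := by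
    intro j
    rw [Finset.sum_apply]
    filter_upwards [rep_sum Finset.univ fun k => (c k • δ k) j,
      eventually_all.2 fun k => rep_mul (c k) (δ k j)] with x h1 h2
    rw [h1]
    exact Finset.sum_congr rfl fun k _ => h2 k
  filter_upwards [eventually_all.2 h1] with x hx
  have : (fun j => rep ((∑ k, c k • δ k) j) x : Cn n) =
      ∑ k, rep (c k) x • (fun j => rep (δ k j) x : Cn n) := by
    ext j
    rw [hx, Finset.sum_apply]; rfl
  rw [this]
  exact Submodule.sum_mem _ fun k _ => Submodule.smul_mem _ _ (Submodule.subset_span ⟨k, rfl⟩)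

/-- Away from the divisor, the logarithmic fields `f ∂_j` span all directions. -/
theorem eventually_rank_of_ne_zero (h : IsLogGenerating f δ α) :
    ∀ᶠ x in 𝓝 0, rep f x ≠ 0 → rankAt (saitoMatrix δ) x = n := by
  obtain ⟨χ, hχ⟩ : ∃ χ : Fin n → Fin n → Hol (0 : Cn n), ∀ j, χ j = f • Pi.single j 1 :=
    ⟨_, fun _ => rfl⟩
  have h1 : ∀ j : Fin n, applyField (χ j) f ∈ Ideal.span {f} := fun j => by
    rw [hχ, applyField_smul]; exact Ideal.mul_mem_right _ _ (Ideal.mem_span_singleton_self f)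
  have h2 : ∀ j i : Fin n, ∀ᶠ x in 𝓝 (0 : Cn n),
      rep (χ j i) x = rep f x * (Pi.single j (1 : ℂ) : Cn n) i := by
    intro j i
    have : (Pi.single j (1 : Hol (0 : Cn n)) : Fin n → Hol (0 : Cn n)) i =
        constGerm 0 ((Pi.single j (1 : ℂ) : Cn n) i) := by
      rw [Pi.single_apply, Pi.single_apply]; split_ifs <;> simp
    rw [hχ, Pi.smul_apply, smul_eq_mul, this]
    filter_upwards [rep_mul f (constGerm 0 ((Pi.single j (1 : ℂ) : Cn n) i)),
      rep_const (p := (0 : Cn n)) ((Pi.single j (1 : ℂ) : Cn n) i)] with x h1 h2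
    rw [h1, h2]
  filter_upwards [eventually_all.2 fun j => eventually_mem_valueSpace h (h1 j),
    eventually_all.2 fun j => eventually_all.2 (h2 j)] with x h3 h4 hx
  rw [← finrank_valueSpace]
  have htop : valueSpace δ x = ⊤ := by
    rw [eq_top_iff]
    intro v _
    rw [← Finset.univ_sum_single v]
    refine Submodule.sum_mem _ fun j _ => ?_
    have h5 := Submodule.smul_mem _ (v j * (rep f x)⁻¹) (h3 j)
    convert h5 using 1
    ext i
    simp only [h4, Pi.smul_apply, smul_eq_mul]
    by_cases hij : i = j
    · subst hij; simp [hx]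
    · simp [hij]
  rw [htop, finrank_top]; simp

/-- At a smooth point the logarithmic fields `∂_j f ∂_i - ∂_i f ∂_j` span the tangent space. -/
theorem eventually_le_rank_of_smooth (h : IsLogGenerating f δ α) :
    ∀ᶠ x in 𝓝 0, ∀ j, ev x (partialDeriv j (germAt f x)) ≠ 0 →
      n ≤ rankAt (saitoMatrix δ) x + 1 := by
  refine eventually_all.2 fun j => ?_
  let χ : Fin n → Fin n → Hol (0 : Cn n) := fun i =>
    partialDeriv j f • Pi.single i 1 + (-partialDeriv i f) • Pi.single j 1
  have hs : ∀ i : Fin n, applyField (Pi.single i (1 : Hol (0 : Cn n))) f = partialDeriv i f := by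
    intro i
    rw [applyField, Finset.sum_eq_single i (fun k _ hk => by rw [Pi.single_eq_of_ne hk, zero_mul])
      (fun h => absurd (Finset.mem_univ i) h), Pi.single_eq_same, one_mul]
  have h1 : ∀ i, applyField (χ i) f ∈ Ideal.span {f} := by
    intro i
    have : applyField (χ i) f = 0 := by
      rw [applyField_add_left, applyField_smul, applyField_smul, hs, hs]; ring
    rw [this]; exact Ideal.zero_mem _
  have h2 : ∀ i l : Fin n, ∀ᶠ x in 𝓝 (0 : Cn n), rep (χ i l) x =
      rep (partialDeriv j f) x * (Pi.single i (1 : ℂ) : Cn n) l -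
        rep (partialDeriv i f) x * (Pi.single j (1 : ℂ) : Cn n) l := by
    intro i l
    have e : ∀ i : Fin n, (Pi.single i (1 : Hol (0 : Cn n)) : Fin n → Hol (0 : Cn n)) l =
        constGerm 0 ((Pi.single i (1 : ℂ) : Cn n) l) := by
      intro i
      rw [Pi.single_apply, Pi.single_apply]; split_ifs <;> simp
    have e2 : χ i l = partialDeriv j f * constGerm 0 ((Pi.single i (1 : ℂ) : Cn n) l) -
        partialDeriv i f * constGerm 0 ((Pi.single j (1 : ℂ) : Cn n) l) := by
      change partialDeriv j f * _ + -partialDeriv i f * _ = _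
      rw [e, e]; ring
    rw [e2]
    filter_upwards [rep_sub (partialDeriv j f * constGerm 0 ((Pi.single i (1 : ℂ) : Cn n) l))
        (partialDeriv i f * constGerm 0 ((Pi.single j (1 : ℂ) : Cn n) l)),
      rep_mul (partialDeriv j f) (constGerm 0 ((Pi.single i (1 : ℂ) : Cn n) l)),
      rep_mul (partialDeriv i f) (constGerm 0 ((Pi.single j (1 : ℂ) : Cn n) l)),
      rep_const (p := (0 : Cn n)) ((Pi.single i (1 : ℂ) : Cn n) l),
      rep_const (p := (0 : Cn n)) ((Pi.single j (1 : ℂ) : Cn n) l)] with x h1 h2 h3 h4 h5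
    rw [h1, h2, h3, h4, h5]
  filter_upwards [eventually_all.2 fun i => eventually_mem_valueSpace h (h1 i),
    eventually_all.2 fun i => eventually_all.2 (h2 i), germAt_dirDeriv (Pi.single j 1) f,
    ev_germAt (partialDeriv j f)] with x h3 h4 h5 h6 hx
  rw [partialDeriv_eq_dirDeriv, ← h5, ← partialDeriv_eq_dirDeriv, h6] at hx
  rw [← finrank_valueSpace]
  have htop : valueSpace δ x ⊔ Submodule.span ℂ {(Pi.single j 1 : Cn n)} = ⊤ := by
    rw [eq_top_iff]
    intro v _
    rw [← Finset.univ_sum_single v]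
    refine Submodule.sum_mem _ fun i _ => ?_
    have h7 := Submodule.add_mem_sup
      (Submodule.smul_mem _ (v i * (rep (partialDeriv j f) x)⁻¹) (h3 i))
      (Submodule.mem_span_singleton.2 ⟨v i * (rep (partialDeriv j f) x)⁻¹ *
        rep (partialDeriv i f) x, rfl⟩ : _ ∈ Submodule.span ℂ {(Pi.single j 1 : Cn n)})
    convert h7 using 1
    ext l
    have e3 : (Pi.single i (v i) : Cn n) l = v i * (Pi.single i (1 : ℂ) : Cn n) l := by
      rw [Pi.single_apply, Pi.single_apply]; split_ifs <;> simp
    simp only [h4, Pi.smul_apply, smul_eq_mul, Pi.add_apply, e3]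
    field_simp
    ring
  have h8 := Submodule.finrank_add_le_finrank_add_finrank (valueSpace δ x)
    (Submodule.span ℂ {(Pi.single j 1 : Cn n)})
  rw [htop, finrank_top, Module.finrank_fintype_fun_eq_card, Fintype.card_fin] at h8
  refine h8.trans ?_
  gcongr
  exact (finrank_span_le_card _).trans (by simp)

end Ranks

/-! ### The local structure of the divisor in terms of ranks -/

section LocalStructure

variable {n m : ℕ} {D : Set (Cn (n + 1))} {f : Hol (0 : Cn (n + 1))}
  {δ : Fin m → Fin (n + 1) → Hol (0 : Cn (n + 1))} {α : Fin m → Hol (0 : Cn (n + 1))}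

theorem eventually_ev_germAt (δ : Fin m → Fin (n + 1) → Hol (0 : Cn (n + 1))) :
    ∀ᶠ x in 𝓝 0, ∀ k j, ev x (germAt (δ k j) x) = rep (δ k j) x :=
  eventually_all.2 fun k => eventually_all.2 fun j => ev_germAt (δ k j)

/-- A point of the divisor near `0` at which the Saito matrix has corank at most one is a smooth
point. -/
theorem eventually_smooth_of_le_rank (hf : IsReducedEquation D 0 f) (h : IsLogGenerating f δ α) :
    ∀ᶠ x in 𝓝 0, x ∈ D → n ≤ rankAt (saitoMatrix δ) x →
      ∃ j, ev x (partialDeriv j (germAt f x)) ≠ 0 := by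
  filter_upwards [eventually_isReducedEquation hf, eventually_ev_germAt δ,
    eventually_applyField_germAt h] with x h1 h2 h3 hx hr
  obtain ⟨r, hr⟩ := exists_linearIndependent_rows ((saitoMatrix δ).map fun φ => rep φ x) hr
  refine exists_ev_partialDeriv_ne_zero h1.1 ((span_isRadical_iff _).1 h1.2.1)
    (h1.ev_eq_zero_iff.2 hx) (a := fun i j => germAt (δ (r i) j) x)
    (fun i => Ideal.mem_span_singleton'.2 ⟨_, (h3 (r i)).symm⟩) ?_
  simp only [h2]
  exact hr

/-- At a smooth point the values of the logarithmic fields lie in the tangent space, and at a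
singular point the rank is smaller still. -/
theorem eventually_rank_le_of_mem (hf : IsReducedEquation D 0 f) (h : IsLogGenerating f δ α) :
    ∀ᶠ x in 𝓝 0, x ∈ D → rankAt (saitoMatrix δ) x ≤ n := by
  filter_upwards [eventually_isReducedEquation hf, eventually_ev_germAt δ,
    eventually_applyField_germAt h, eventually_smooth_of_le_rank hf h] with x h1 h2 h3 h4 hx
  by_contra! hcon
  obtain ⟨j, hj⟩ := h4 hx (by omega)
  have htop : valueSpace δ x = ⊤ := by
    refine Submodule.eq_top_of_finrank_eq (le_antisymm (Submodule.finrank_le _) ?_)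
    rw [finrank_valueSpace, Module.finrank_fintype_fun_eq_card, Fintype.card_fin]
    exact hcon
  -- the differential of `f` at `x`, as a linear form, kills the values of the logarithmic fields
  let L : Cn (n + 1) →ₗ[ℂ] ℂ := Fintype.linearCombination ℂ
    fun j => ev x (partialDeriv j (germAt f x))
  have hL : valueSpace δ x ≤ LinearMap.ker L := by
    refine Submodule.span_le.2 ?_
    rintro _ ⟨k, rfl⟩
    have := congrArg (ev x) (h3 k)
    rw [applyField, map_sum, map_mul, h1.ev_eq_zero_iff.2 hx, mul_zero] at this
    simpa [L, Fintype.linearCombination_apply, h2] using this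
  have h5 : L (Pi.single j 1) = 0 := hL (htop ▸ Submodule.mem_top)
  rw [Fintype.linearCombination_apply_single, one_smul] at h5
  exact hj h5

theorem rankAt_extendedSaitoMatrix (x : Cn (n + 1)) :
    rankAt (extendedSaitoMatrix δ α) x =
      (Matrix.fromCols ((saitoMatrix δ).map fun φ => rep φ x)
        (Matrix.of fun k (_ : Unit) => rep (-α k) x)).rank := by
  rw [rankAt, extendedSaitoMatrix]
  congr 1
  ext k (j | j) <;> rfl

/-- At the points of the divisor near `0`, strong Euler-homogeneity means that the ranks of the two
Saito matrices differ. -/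
theorem eventually_isStronglyEulerAt_iff (hf : IsReducedEquation D 0 f)
    (h : IsLogGenerating f δ α) :
    ∀ᶠ x in 𝓝 0, IsStronglyEulerAt D x ↔
      rankAt (saitoMatrix δ) x < rankAt (extendedSaitoMatrix δ α) x := by
  filter_upwards [eventually_isReducedEquation hf, eventually_ev_germAt δ,
    eventually_applyField_germAt h, eventually_exists_combination hf.1 h,
    eventually_all.2 fun k => ev_germAt (α k), eventually_all.2 fun k => rep_neg (α k)]
    with x h1 h2 h3 h4 h5 h6
  rw [rankAt_extendedSaitoMatrix, rankAt, rank_lt_rank_fromCols_iff]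
  constructor
  · intro hE
    obtain ⟨a, β, ha, hβ, hab⟩ := hE.exists_field h1
    obtain ⟨e, he1, he2⟩ := h4 a β hab
    refine ⟨fun k => ev x (e k), fun j => ?_, ?_⟩
    · have := congrArg (ev x) (he1 j)
      rw [ha, map_sum] at this
      simp only [map_mul, h2] at this
      exact this.symm
    · have := congrArg (ev x) he2
      rw [hβ, map_sum] at this
      simp only [map_mul, h5] at this
      simp only [h6, mul_neg, Finset.sum_neg_distrib, ← this]
      exact neg_ne_zero.2 one_ne_zero
  · rintro ⟨c, hc, hcα⟩
    refine isStronglyEulerAt_of_field h1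
      (a := ∑ k, constGerm x (c k) • fun j => germAt (δ k j) x)
      (β := ∑ k, constGerm x (c k) * germAt (α k) x) (fun j => ?_) ?_ ?_
    · rw [Finset.sum_apply, map_sum, ← hc j]
      refine Finset.sum_congr rfl fun k _ => ?_
      rw [Pi.smul_apply, smul_eq_mul, map_mul, ev_const, h2]; rfl
    · intro h0
      refine hcα ?_
      rw [map_sum] at h0
      simp only [map_mul, ev_const, h5] at h0
      simp only [h6, mul_neg, Finset.sum_neg_distrib, h0, neg_zero]
    · rw [applyField_sum_smul, Finset.sum_mul]
      exact Finset.sum_congr rfl fun k _ => by rw [h3]; ring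

/-- The complete description, near `0`, of the divisor, its singular locus and the points of strong
Euler-homogeneity by the ranks of the Saito matrices. -/
theorem eventually_local_structure (hf : IsReducedEquation D 0 f) (h : IsLogGenerating f δ α) :
    ∀ᶠ x in 𝓝 0,
      (rankAt (saitoMatrix δ) x ≤ rankAt (extendedSaitoMatrix δ α) x ∧
        rankAt (extendedSaitoMatrix δ α) x ≤ rankAt (saitoMatrix δ) x + 1) ∧
      (x ∈ D ↔ rankAt (saitoMatrix δ) x ≤ n) ∧
      (x ∈ singularLocus D ↔ rankAt (saitoMatrix δ) x < n) ∧
      (IsStronglyEulerAt D x ↔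
        rankAt (saitoMatrix δ) x < rankAt (extendedSaitoMatrix δ α) x) ∧
      (x ∈ D → x ∉ singularLocus D → IsStronglyEulerAt D x) := by
  filter_upwards [eventually_isReducedEquation hf, eventually_smooth_of_le_rank hf h,
    eventually_rank_le_of_mem hf h, eventually_isStronglyEulerAt_iff hf h,
    eventually_rank_of_ne_zero h, eventually_le_rank_of_smooth h, ev_germAt f]
    with x h1 h2 h3 h4 h5 h6 h7
  have hD : x ∈ D ↔ rankAt (saitoMatrix δ) x ≤ n := by
    refine ⟨h3, fun hr => ?_⟩
    by_contra hx
    rw [← h1.ev_eq_zero_iff, h7] at hx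
    have := h5 hx
    omega
  refine ⟨?_, hD, ?_, h4, fun hx hs => ?_⟩
  · rw [rankAt_extendedSaitoMatrix]
    exact rank_fromCols_le _ _
  · rw [mem_singularLocus_iff h1]
    constructor
    · rintro ⟨hx, hx0⟩
      by_contra! hr
      obtain ⟨j, hj⟩ := h2 hx hr
      exact hj (hx0 j)
    · intro hr
      refine ⟨hD.2 hr.le, fun j => ?_⟩
      by_contra hj
      have := h6 j hj
      omega
  · rw [mem_singularLocus_iff h1] at hs
    push Not at hs
    obtain ⟨j, hj⟩ := hs hx
    exact isStronglyEulerAt_of_smooth h1 hx hj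

end LocalStructure

theorem sameGerm_congr {n : ℕ} {S S' T T' : Set (Cn n)} (h : SameGerm S S') (h' : SameGerm T T') :
    SameGerm S T ↔ SameGerm S' T' := by
  refine eventually_congr ?_
  filter_upwards [h, h'] with x h1 h2
  rw [h1, h2]

end DivisorGerm

end

theorem mainTheorem5 (n : ℕ) (hn : 2 ≤ n) (D : Set (Cn n)) (f : Hol (0 : Cn n))
    (hf : IsReducedEquation D 0 f) :
    -- the sets `D_i` and `D̃_i` are the rank loci of the (extended) Saito matrices
    (∀ (m : ℕ) (δ : Fin m → Fin n → Hol (0 : Cn n)) (α : Fin m → Hol (0 : Cn n)),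
      IsLogGenerating f δ α → ∀ i : ℤ,
        SameGerm (locusD f i) {x | (rankAt (saitoMatrix δ) x : ℤ) ≤ i} ∧
        SameGerm (locusDtilde f i) {x | (rankAt (extendedSaitoMatrix δ α) x : ℤ) ≤ i}) ∧
    -- the decomposition `Sing D = D_E ⊔ D_NE`, all unions being disjoint
    SameGerm (singularLocus D) (locusE f ∪ locusNE f) ∧
    SameGerm (locusE f ∩ locusNE f) ∅ ∧
    (∀ i ∈ Set.Icc (0 : ℤ) (n - 2), ∀ j ∈ Set.Icc (0 : ℤ) (n - 2), i ≠ j →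
      SameGerm ((locusD f i \ locusDtilde f i) ∩ (locusD f j \ locusDtilde f j)) ∅ ∧
      SameGerm ((locusDtilde f i \ locusD f (i - 1)) ∩
        (locusDtilde f j \ locusD f (j - 1))) ∅) ∧
    -- the meaning of the two parts
    SameGerm (locusE f) {p | p ∈ singularLocus D ∧ IsStronglyEulerAt D p} ∧
    SameGerm (locusNE f) {p | p ∈ singularLocus D ∧ ¬ IsStronglyEulerAt D p} ∧
    SameGerm (locusDtilde f 0) (locusD f 0 ∩ locusNE f) ∧
    -- the geometric criterion
    (IsStronglyEulerOn D (locusD f 0) ↔ SameGerm (locusDtilde f 0) ∅) ∧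
    (IsStronglyEulerOn D (D \ locusD f 0) ↔
      ∀ i ∈ Set.Icc (1 : ℤ) (n - 2), SameGerm (locusDtilde f i) (locusD f (i - 1))) ∧
    (IsStronglyEulerOn D D ↔ SameGerm (locusDtilde f 0) ∅ ∧
      ∀ i ∈ Set.Icc (1 : ℤ) (n - 2), SameGerm (locusDtilde f i) (locusD f (i - 1))) ∧
    (n = 2 → (IsStronglyEulerOn D D ↔ SameGerm (locusDtilde f 0) ∅)) ∧
    -- the algebraic criterion
    (IsStronglyEulerOn D (locusD f 0) ↔ idealItilde f 1 = ⊤) ∧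
    (IsStronglyEulerOn D (D \ locusD f 0) ↔
      ∀ i ∈ Set.Icc (1 : ℤ) (n - 2), (idealItilde f (i + 1)).radical = (idealI f i).radical) ∧
    (IsStronglyEulerOn D D ↔ idealItilde f 1 = ⊤ ∧
      ∀ i ∈ Set.Icc (1 : ℤ) (n - 2), (idealItilde f (i + 1)).radical = (idealI f i).radical) ∧
    -- the algebraic criterion in terms of Fitting ideals
    (IsStronglyEulerOn D (locusD f 0) ↔
      (fittingIdeal (Hol (0 : Cn n)) (jacobianIdeal f) n).radical =
        (fittingIdeal (Hol (0 : Cn n)) (JacobianQuotient f) n).radical) ∧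
    (IsStronglyEulerOn D (D \ locusD f 0) ↔ ∀ i ∈ Set.Icc (2 : ℤ) (n - 1),
      (fittingIdeal (Hol (0 : Cn n)) (jacobianIdeal f) i).radical =
        (fittingIdeal (Hol (0 : Cn n)) (JacobianQuotient f) i).radical) ∧
    (IsStronglyEulerOn D D ↔ ∀ i ∈ Set.Icc (2 : ℤ) n,
      (fittingIdeal (Hol (0 : Cn n)) (jacobianIdeal f) i).radical =
        (fittingIdeal (Hol (0 : Cn n)) (JacobianQuotient f) i).radical) := by
  obtain ⟨n, rfl⟩ : ∃ k, n = k + 1 := ⟨n - 1, by omega⟩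
  obtain ⟨m, δ, α, hδ⟩ := exists_isLogGenerating f
  -- near `0` every set in the statement is described by the two ranks `r x` and `s x`
  obtain ⟨r, hr⟩ : ∃ r : Cn (n + 1) → ℕ, ∀ x, rankAt (saitoMatrix δ) x = r x := ⟨_, fun _ => rfl⟩
  obtain ⟨s, hs⟩ : ∃ s : Cn (n + 1) → ℕ, ∀ x, rankAt (extendedSaitoMatrix δ α) x = s x :=
    ⟨_, fun _ => rfl⟩
  have hloc : ∀ᶠ x in 𝓝 0, ((r x ≤ s x ∧ s x ≤ r x + 1) ∧ (x ∈ D ↔ r x ≤ n) ∧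
      (x ∈ singularLocus D ↔ r x < n) ∧ (IsStronglyEulerAt D x ↔ r x < s x) ∧
      (x ∈ D → x ∉ singularLocus D → IsStronglyEulerAt D x)) ∧
      ∀ i ∈ Finset.Icc (-1 : ℤ) n, (x ∈ locusD f i ↔ (r x : ℤ) ≤ i) ∧
        (x ∈ locusDtilde f i ↔ (s x : ℤ) ≤ i) := by
    have h1 := eventually_local_structure hf hδ
    simp only [hr, hs] at h1
    refine h1.and (eventually_all_finset _ |>.2 fun i _ => ?_)
    filter_upwards [sameGerm_locusD hδ i, sameGerm_locusDtilde hf.1 hδ i] with x h2 h3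
    rw [h2, h3]
    simp only [hr, hs, and_self]
  have hE : ∀ᶠ x in 𝓝 0, x ∈ locusE f ↔ r x < n ∧ r x < s x := by
    filter_upwards [hloc] with x ⟨⟨hrs, _⟩, hx⟩
    simp only [locusE, Set.mem_iUnion, Set.mem_Icc, Set.mem_sdiff, exists_prop]
    constructor
    · rintro ⟨i, hi, h1, h2⟩
      rw [(hx i (by simp; omega)).1] at h1
      rw [(hx i (by simp; omega)).2] at h2
      push_cast at hi
      omega
    · intro h
      refine ⟨r x, by push_cast; omega, ?_, ?_⟩
      · rw [(hx _ (by simp; omega)).1]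
      · rw [(hx _ (by simp; omega)).2]; omega
  have hNE : ∀ᶠ x in 𝓝 0, x ∈ locusNE f ↔ r x < n ∧ r x = s x := by
    filter_upwards [hloc] with x ⟨⟨hrs, _⟩, hx⟩
    simp only [locusNE, Set.mem_iUnion, Set.mem_Icc, Set.mem_sdiff, exists_prop]
    constructor
    · rintro ⟨i, hi, h1, h2⟩
      push_cast at hi
      rw [(hx i (by simp; omega)).2] at h1
      rw [(hx (i - 1) (by simp; omega)).1] at h2
      omega
    · intro h
      refine ⟨r x, by push_cast; omega, ?_, ?_⟩
      · rw [(hx _ (by simp; omega)).2]; omega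
      · rw [(hx _ (by simp; omega)).1]; omega
  have hD0 : IsStronglyEulerOn D (locusD f 0) ↔ SameGerm (locusDtilde f 0) ∅ := by
    refine eventually_congr ?_
    filter_upwards [hloc] with x ⟨⟨h1, h2, h3, h4, h5⟩, hx⟩
    rw [(hx 0 (by simp)).1, (hx 0 (by simp)).2, h4]
    simp only [Set.mem_empty_iff_false, iff_false]
    omega
  have hD1 : IsStronglyEulerOn D (D \ locusD f 0) ↔ ∀ i ∈ Set.Icc (1 : ℤ) ((n + 1 : ℕ) - 2),
      SameGerm (locusDtilde f i) (locusD f (i - 1)) := by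
    rw [← Finset.coe_Icc]
    simp only [Finset.mem_coe]
    refine Iff.trans ?_ (eventually_all_finset _)
    refine eventually_congr ?_
    filter_upwards [hloc] with x ⟨⟨h1, h2, h3, h4, h5⟩, hx⟩
    rw [Set.mem_sdiff, (hx 0 (by simp)).1, h4]
    constructor
    · intro h i hi
      simp only [Finset.mem_Icc] at hi
      push_cast at hi
      rw [(hx i (by simp; omega)).2, (hx (i - 1) (by simp; omega)).1]
      rw [h2] at h
      omega
    · intro h h6
      by_contra h7
      -- if `r x = s x` at a singular point outside `D_0`, the equality of sets fails for `i = r x`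
      have h8 : x ∈ singularLocus D := by
        by_contra h9
        exact h7 (h4.1 (h5 h6.1 h9))
      rw [h3] at h8
      have h9 := h (r x) (by simp only [Finset.mem_Icc]; push_cast; omega)
      rw [(hx _ (by simp; omega)).2, (hx _ (by simp; omega)).1] at h9
      omega
  have hDD : IsStronglyEulerOn D D ↔
      IsStronglyEulerOn D (locusD f 0) ∧ IsStronglyEulerOn D (D \ locusD f 0) := by
    refine Iff.trans ?_ eventually_and
    refine eventually_congr ?_
    filter_upwards [hloc] with x ⟨⟨h1, h2, h3, h4, h5⟩, hx⟩
    have h6 : x ∈ locusD f 0 → x ∈ D := by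
      rw [(hx 0 (by simp)).1, h2]; omega
    exact ⟨fun h => ⟨fun h0 => h (h6 h0), fun hd => h hd.1⟩, fun h hd =>
      (em (x ∈ locusD f 0)).elim h.1 fun h0 => h.2 ⟨hd, h0⟩⟩
  have hT : SameGerm (locusDtilde f 0) ∅ ↔ idealItilde f 1 = ⊤ := sameGerm_zeroLocus_empty_iff
  have hR : ∀ i : ℤ, SameGerm (locusDtilde f i) (locusD f (i - 1)) ↔
      (idealItilde f (i + 1)).radical = (idealI f i).radical := by
    intro i
    rw [radical_eq_radical_iff, locusDtilde, locusD, sub_add_cancel]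
  have hF0 : SameGerm (locusDtilde f 0) ∅ ↔
      (fittingIdeal (Hol (0 : Cn (n + 1))) (jacobianIdeal f) (n + 1 : ℕ)).radical =
        (fittingIdeal (Hol (0 : Cn (n + 1))) (JacobianQuotient f) (n + 1 : ℕ)).radical := by
    have h1 := hR 0
    have e : ((n + 1 : ℕ) : ℤ) + 1 - (0 + 1) = ((n + 1 : ℕ) : ℤ) := by ring
    rw [idealItilde, idealI, e, sub_zero] at h1
    rw [← h1]
    refine sameGerm_congr (Eventually.of_forall fun _ => Iff.rfl) ?_
    filter_upwards [hloc] with x ⟨_, hx⟩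
    rw [(hx (0 - 1) (by simp)).1]
    simp only [Set.mem_empty_iff_false, false_iff]
    omega
  have hF1 : (∀ i ∈ Set.Icc (1 : ℤ) ((n + 1 : ℕ) - 2), SameGerm (locusDtilde f i)
      (locusD f (i - 1))) ↔ ∀ i ∈ Set.Icc (2 : ℤ) ((n + 1 : ℕ) - 1),
      (fittingIdeal (Hol (0 : Cn (n + 1))) (jacobianIdeal f) i).radical =
        (fittingIdeal (Hol (0 : Cn (n + 1))) (JacobianQuotient f) i).radical := by
    have h1 : ∀ i : ℤ, SameGerm (locusDtilde f i) (locusD f (i - 1)) ↔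
        (fittingIdeal (Hol (0 : Cn (n + 1))) (jacobianIdeal f) ((n + 1 : ℕ) - i)).radical =
        (fittingIdeal (Hol (0 : Cn (n + 1))) (JacobianQuotient f) ((n + 1 : ℕ) - i)).radical := by
      intro i
      have e : ((n + 1 : ℕ) : ℤ) + 1 - (i + 1) = ((n + 1 : ℕ) : ℤ) - i := by ring
      rw [hR, idealItilde, idealI, e]
    constructor
    · intro h i hi
      have h2 := (h1 ((n + 1 : ℕ) - i)).1 (h _ ⟨by linarith [hi.2], by linarith [hi.1]⟩)
      rwa [sub_sub_cancel] at h2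
    · intro h i hi
      exact (h1 i).2 (h _ ⟨by linarith [hi.2], by linarith [hi.1]⟩)
  have hF2 : (∀ i ∈ Set.Icc (2 : ℤ) (n + 1 : ℕ),
      (fittingIdeal (Hol (0 : Cn (n + 1))) (jacobianIdeal f) i).radical =
        (fittingIdeal (Hol (0 : Cn (n + 1))) (JacobianQuotient f) i).radical) ↔
      SameGerm (locusDtilde f 0) ∅ ∧ ∀ i ∈ Set.Icc (1 : ℤ) ((n + 1 : ℕ) - 2),
        SameGerm (locusDtilde f i) (locusD f (i - 1)) := by
    rw [hF0, hF1]
    constructor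
    · exact fun h => ⟨h _ ⟨by exact_mod_cast hn, le_rfl⟩,
        fun i hi => h i ⟨hi.1, by linarith [hi.2]⟩⟩
    · rintro ⟨h1, h2⟩ i hi
      rcases hi.2.eq_or_lt with rfl | hlt
      · exact h1
      · exact h2 i ⟨hi.1, by omega⟩
  refine ⟨fun m δ α hδ i => ⟨sameGerm_locusD hδ i, sameGerm_locusDtilde hf.1 hδ i⟩, ?_, ?_,
    fun i hi j hj hij => ⟨?_, ?_⟩, ?_, ?_, ?_, hD0, hD1, by rw [hDD, hD0, hD1], fun hn2 => ?_,
    hD0.trans hT, ?_, ?_, hD0.trans hF0, hD1.trans hF1, by rw [hF2, hDD, hD0, hD1]⟩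
  · filter_upwards [hloc, hE, hNE] with x ⟨⟨h1, h2, h3, h4, h5⟩, hx⟩ h6 h7
    rw [Set.mem_union, h3, h6, h7]
    omega
  · filter_upwards [hE, hNE] with x h6 h7
    rw [Set.mem_inter_iff, h6, h7]
    simp only [Set.mem_empty_iff_false, iff_false]
    omega
  · filter_upwards [hloc] with x ⟨⟨h1, _⟩, hx⟩
    have hi' := hi.2
    have hj' := hj.2
    push_cast at hi' hj'
    have h6 := hx i (by have := hi.1; simp; omega)
    have h7 := hx j (by have := hj.1; simp; omega)
    simp only [Set.mem_inter_iff, Set.mem_sdiff, h6, h7, Set.mem_empty_iff_false, iff_false]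
    omega
  · filter_upwards [hloc] with x ⟨⟨h1, _⟩, hx⟩
    have hi' := hi.2
    have hj' := hj.2
    push_cast at hi' hj'
    have h6 := (hx i (by have := hi.1; simp; omega)).2
    have h7 := (hx j (by have := hj.1; simp; omega)).2
    have h8 := (hx (i - 1) (by have := hi.1; simp; omega)).1
    have h9 := (hx (j - 1) (by have := hj.1; simp; omega)).1
    simp only [Set.mem_inter_iff, Set.mem_sdiff, h6, h7, h8, h9, Set.mem_empty_iff_false, iff_false]
    omega
  · filter_upwards [hloc, hE] with x ⟨⟨h1, h2, h3, h4, h5⟩, hx⟩ h6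
    rw [h6, h3, h4]
  · filter_upwards [hloc, hNE] with x ⟨⟨h1, h2, h3, h4, h5⟩, hx⟩ h6
    rw [h6, h3, h4]
    omega
  · filter_upwards [hloc, hNE] with x ⟨⟨h1, h2, h3, h4, h5⟩, hx⟩ h6
    rw [Set.mem_inter_iff, (hx 0 (by simp)).1, (hx 0 (by simp)).2, h6]
    omega
  · rw [hDD, hD0, hD1, and_iff_left_iff_imp]
    intro _ i hi
    have h1 := hi.1
    have h2 := hi.2
    push_cast at h2
    omega
  · rw [hD1]
    simp only [hR]
  · rw [hDD, hD0, hD1, hT]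
    simp only [hR]
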